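/- Conventions. Let $G$ be a finite graph (loops and multiple edges allowed) with oriented edges; $I(k)$ and $T(k)$ denote the initial and terminal vertex of the edge $k$, and two edges are disjoint if they have no common end point. Let $Z(G)$ be the free $\mathbb Z$-module on symbols $E^{e,e'}=E^{e',e}$, one for each unordered pair of disjoint edges; for an edge $e$ and a vertex $v$ not on $e$ put $$\delta(V^{e,v})=\sum_{I(k)=v,\ e\cap k=\emptyset}E^{e,k}-\sum_{T(k)=v,\ e\cap k=\emptyset}E^{e,k},$$ let $B(G)\subseteq Z(G)$ be the submodule generated by all $\delta(V^{e,v})$, and call $L(G)=Z(G)/B(G)$ the linking module of $G$. For an embedding $f$ of $G$ in $\mathbb R^3\subset S^3$, the Wu invariant is $$\mathcal L(f)=\Big[\sum_{e\cap e'=\emptyset}\ell(f(e),f(e'))\,E^{e,e'}\Big]\in L(G),$$ the sum being over unordered pairs of disjoint edges and $\ell(f(e),f(e'))$ being the sum of the signs of the crossings between $f(e)$ and $f(e')$ in any regular projection of $f$, if $f$ is polygonal. For an arbitrary embedding $f$, the same formula is applied to any polygonal map $g$ of $G$ so close to $f$ that $|f(x)-g(x)|+|f(y)-g(y)|<|f(x)-f(y)|$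 whenever $x$ and $y$ lie on disjoint edges. For a homomorphism $\varepsilon:L(G)\to\mathbb Z$ the integer $\tilde{\mathcal L}_\varepsilon(f)=\varepsilon(\mathcal L(f))$ is the reduced Wu invariant of $f$ with respect to $\varepsilon$. Theorem. Let $G_1,\dots,G_k$ be all the subgraphs of $G$ that are homeomorphic to $2K_3$ (two disjoint triangles), $K_5$ or $K_{3,3}$, with the orientations inherited from $G$. For each $q\le k$ let $\varepsilon_q:L(G_q)\to\mathbb Z$ be an isomorphism. Then for every homomorphism $\varepsilon:L(G)\to\mathbb Z$ there are integers $m\neq0$ and $m_1,\dots,m_k$ such that for every embedding $f$ of $G$ $$m\,\tilde{\mathcal L}_\varepsilon(f)=\sum_{q=1}^k m_q\,\tilde{\mathcal L}_{\varepsilon_q}(f|_{G_q}).$$ Here the Wu invariants of $f$ and of the restrictions $f|_{G_q}$ may each be computed from their own regular projection (and polygonal map). -/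

import Mathlib

open scoped unitInterval

/-- A graph with vertex set `V` and edge set `E` all of whose edges are oriented. Loops and
multiple edges are allowed. -/
structure OrientedGraph (V E : Type*) where
  /-- the initial vertex of an edge -/
  src : E → V
  /-- the terminal vertex of an edge -/
  tgt : E → V

namespace OrientedGraph

variable {V E : Type*}

/-! ### The linking module -/

/-- Two edges are disjoint if they have no end point in common. -/
def Disj (G : OrientedGraph V E) (e e' : E) : Prop :=
  G.src e ≠ G.src e' ∧ G.src e ≠ G.tgt e' ∧ G.tgt e ≠ G.src e' ∧ G.tgt e ≠ G.tgt e'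

theorem disj_symmetric (G : OrientedGraph V E) : Std.Symm G.Disj :=
  ⟨fun _ _ h => ⟨h.1.symm, h.2.2.1.symm, h.2.1.symm, h.2.2.2.symm⟩⟩

/-- The set of unordered pairs of disjoint edges. -/
def disjointPairs (G : OrientedGraph V E) : Set (Sym2 E) :=
  Sym2.fromRel G.disj_symmetric

/-- `Z(G)`: the free `ℤ`-module on the symbols `E^{e,e'} = E^{e',e}`, one for each unordered pair
of disjoint edges. -/
abbrev PairModule (G : OrientedGraph V E) : Type _ :=
  G.disjointPairs →₀ ℤ

open Classical in
/-- The generator `E^{e,e'}` of `Z(G)` if `e` and `e'` are disjoint, and `0` otherwise. -/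
noncomputable def pairSymbol (G : OrientedGraph V E) (e e' : E) : G.PairModule :=
  if h : G.Disj e e' then Finsupp.single ⟨s(e, e'), Sym2.fromRel_prop.mpr h⟩ 1 else 0

open Classical in
/-- `δ(V^{e,v})`: the sum of the `E^{e,k}` over the edges `k` disjoint from `e` with initial
vertex `v`, minus the sum of the `E^{e,k}` over those with terminal vertex `v`. -/
noncomputable def delta [Fintype E] (G : OrientedGraph V E) (e : E) (v : V) : G.PairModule :=
  (∑ k with G.src k = v, G.pairSymbol e k) - ∑ k with G.tgt k = v, G.pairSymbol e k

/-- `B(G)`: the submodule of `Z(G)` generated by the `δ(V^{e,v})`, for `v` a vertex not on `e`. -/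
noncomputable def boundaries [Fintype E] (G : OrientedGraph V E) : Submodule ℤ G.PairModule :=
  Submodule.span ℤ {z | ∃ e v, v ≠ G.src e ∧ v ≠ G.tgt e ∧ z = G.delta e v}

/-- The linking module `L(G) = Z(G) / B(G)`. -/
abbrev LinkingModule [Fintype E] (G : OrientedGraph V E) : Type _ :=
  G.PairModule ⧸ G.boundaries

/-! ### Subgraphs, and subgraphs homeomorphic to `2K₃`, `K₅` or `K₃,₃` -/

/-- A subgraph: a set of vertices and a set of edges containing with every edge its end points. -/
@[ext]
structure Subgraph (G : OrientedGraph V E) where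
  verts : Set V
  edges : Set E
  src_mem : ∀ e ∈ edges, G.src e ∈ verts
  tgt_mem : ∀ e ∈ edges, G.tgt e ∈ verts

/-- A subgraph as an oriented graph, with the inherited orientation. -/
def Subgraph.toGraph {G : OrientedGraph V E} (K : G.Subgraph) :
    OrientedGraph K.verts K.edges where
  src e := ⟨G.src e, K.src_mem e e.2⟩
  tgt e := ⟨G.tgt e, K.tgt_mem e e.2⟩

noncomputable instance Subgraph.fintypeEdges [Fintype E] {G : OrientedGraph V E}
    (K : G.Subgraph) : Fintype K.edges :=
  Fintype.ofFinite _

/-- `K` is a subdivision of `M`, orientations disregarded: `K` arises from `M` by dividing each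
edge `h` of `M` into `len h ≥ 1` edges. The consecutive vertices of the path in `K` that replaces
`h` are `vert h 0, …, vert h (len h)` and its edges are `edge ⟨h, 0⟩, …, edge ⟨h, len h - 1⟩`;
every edge of `K` is one of these exactly once, and every vertex of `K` is exactly once either
the image of a vertex of `M` or an interior vertex of one of the paths. -/
def IsSubdivisionOf {W F : Type*} (K : OrientedGraph V E) (M : OrientedGraph W F) : Prop :=
  ∃ (φ : W → V) (len : F → ℕ) (vert : F → ℕ → V) (edge : (Σ h : F, Fin (len h)) → E),
    (∀ h, 0 < len h) ∧
    (∀ h, vert h 0 = φ (M.src h)) ∧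
    (∀ h, vert h (len h) = φ (M.tgt h)) ∧
    (∀ h (i : Fin (len h)),
      s(K.src (edge ⟨h, i⟩), K.tgt (edge ⟨h, i⟩)) = s(vert h i, vert h (i + 1))) ∧
    Function.Bijective edge ∧
    Function.Bijective
      (Sum.elim φ (fun x : (Σ h : F, Fin (len h - 1)) => vert x.1 (x.2 + 1)))

/-- Two disjoint loops. A graph is homeomorphic to `2K₃`, that is to a disjoint union of two
circles, if and only if it is a subdivision of this graph. -/
def twoLoops : OrientedGraph (Fin 2) (Fin 2) where
  src := id
  tgt := id

/-- The complete graph on five vertices. -/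
def completeFive : OrientedGraph (Fin 5) {p : Fin 5 × Fin 5 // p.1 < p.2} where
  src p := p.1.1
  tgt p := p.1.2

/-- The complete bipartite graph on three and three vertices. -/
def completeThreeThree : OrientedGraph (Fin 3 ⊕ Fin 3) (Fin 3 × Fin 3) where
  src p := Sum.inl p.1
  tgt p := Sum.inr p.2

/-- The underlying space of the graph is homeomorphic to that of `2K₃`, `K₅` or `K₃,₃`. Since `K₅`
and `K₃,₃` have no vertices of degree two, the graphs homeomorphic to them are exactly their
subdivisions. -/
def IsTwoTrianglesOrKuratowski (K : OrientedGraph V E) : Prop :=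
  K.IsSubdivisionOf twoLoops ∨ K.IsSubdivisionOf completeFive ∨
    K.IsSubdivisionOf completeThreeThree

end OrientedGraph

/-! ### Crossing signs -/

/-- Euclidean 3-space. -/
abbrev Space3 : Type := EuclideanSpace ℝ (Fin 3)

/-- The triple product `(u × w) · d`. -/
noncomputable def tripleProduct (u w d : Space3) : ℝ :=
  (Matrix.of ![u.ofLp, w.ofLp, d.ofLp]).det

/-- An oriented straight segment in space. -/
structure Segment3 where
  initial : Space3
  final : Space3

namespace Segment3

/-- The point of a segment at parameter `s`. -/
noncomputable def point (a : Segment3) (s : ℝ) : Space3 :=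
  AffineMap.lineMap a.initial a.final s

/-- The direction vector of a segment. -/
noncomputable def dir (a : Segment3) : Space3 := a.final - a.initial

/-- Seen from the direction `d`, the segment `a` crosses over the segment `b`. -/
def Over (d : Space3) (a b : Segment3) : Prop :=
  ∃ s ∈ I, ∃ t ∈ I, ∃ r : ℝ, 0 < r ∧ a.point s - b.point t = r • d

open Classical in
/-- The sign of the crossing between `a` and `b` in the projection along `d`, and `0` if there is
none. A crossing is positive if (over strand, under strand, direction towards the viewer) is a
positively oriented basis. -/
noncomputable def crossingSign (d : Space3) (a b : Segment3) : ℤ :=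
  (if Over d a b then (SignType.sign (tripleProduct a.dir b.dir d) : ℤ) else 0) +
    (if Over d b a then (SignType.sign (tripleProduct b.dir a.dir d) : ℤ) else 0)

theorem crossingSign_comm (d : Space3) (a b : Segment3) :
    crossingSign d a b = crossingSign d b a :=
  add_comm _ _

/-- The projections of `a` and `b` along `d` are disjoint or cross transversally in a point
interior to both of them. -/
def IsRegularPair (d : Space3) (a b : Segment3) : Prop :=
  ∀ s ∈ I, ∀ t ∈ I, ∀ r : ℝ, a.point s - b.point t = r • d →
    s ∈ Set.Ioo (0 : ℝ) 1 ∧ t ∈ Set.Ioo (0 : ℝ) 1 ∧ tripleProduct a.dir b.dir d ≠ 0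

end Segment3

namespace OrientedGraph

variable {V E : Type*}

/-! ### Spatial embeddings -/

/-- A topological embedding of the graph in space: positions of the vertices and, for each edge,
an arc that joins the positions of its end points in accordance with the orientation, such that
the resulting map from the underlying space of the graph is injective. -/
structure SpatialEmbedding (G : OrientedGraph V E) where
  pos : V → Space3
  curve : ∀ e, Path (pos (G.src e)) (pos (G.tgt e))
  pos_injective : Function.Injective pos
  curve_injective : ∀ e e' (s s' : I), (s : ℝ) ∈ Set.Ioo (0 : ℝ) 1 → (s' : ℝ) ∈ Set.Ioo (0 : ℝ) 1 →
    curve e s = curve e' s' → e = e' ∧ s = s'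
  curve_ne_pos : ∀ e v (s : I), (s : ℝ) ∈ Set.Ioo (0 : ℝ) 1 → curve e s ≠ pos v

/-- The restriction of an embedding to a subgraph. -/
def SpatialEmbedding.restrict {G : OrientedGraph V E} (f : G.SpatialEmbedding) (K : G.Subgraph) :
    K.toGraph.SpatialEmbedding where
  pos v := f.pos v
  curve e := f.curve e
  pos_injective _ _ h := Subtype.ext (f.pos_injective h)
  curve_injective e e' s s' hs hs' h :=
    ⟨Subtype.ext (f.curve_injective e e' s s' hs hs' h).1,
      (f.curve_injective e e' s s' hs hs' h).2⟩
  curve_ne_pos e v s hs := f.curve_ne_pos e v s hs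

/-- A polygonal (piecewise linear) map from the graph to space, not necessarily injective. The
edge `e`, parametrized by `[0, 1]`, is divided at the times
`0 = time e 0 < time e 1 < ⋯ < time e (num e) = 1`; the map sends the time `time e i` to
`corner e i` and is affine between consecutive times. The values of `time e` and `corner e`
beyond `num e` are irrelevant. -/
structure PolygonalMap (G : OrientedGraph V E) where
  num : E → ℕ
  time : E → ℕ → ℝ
  time_zero : ∀ e, time e 0 = 0
  time_num : ∀ e, time e (num e) = 1
  time_lt : ∀ e, ∀ i < num e, time e i < time e (i + 1)
  pos : V → Space3
  corner : E → ℕ → Space3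
  corner_zero : ∀ e, corner e 0 = pos (G.src e)
  corner_num : ∀ e, corner e (num e) = pos (G.tgt e)

namespace PolygonalMap

variable {G : OrientedGraph V E}

/-- The `i`-th oriented segment of the image of `e`. -/
def seg (g : G.PolygonalMap) (e : E) (i : ℕ) : Segment3 :=
  ⟨g.corner e i, g.corner e (i + 1)⟩

/-- The time at which the polygonal map passes through the point `(g.seg e i).point s`. -/
noncomputable def param (g : G.PolygonalMap) (e : E) (i : ℕ) (s : ℝ) : ℝ :=
  AffineMap.lineMap (g.time e i) (g.time e (i + 1)) s

/-- The polygonal map `g` approximates the embedding `f`: at any two points on disjoint edges,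
the distances between `f` and `g` add up to less than the distance of the two values of `f`. Hence
during the straight-line homotopy from `f` to `g` the images of disjoint edges remain
disjoint. If `f` is itself polygonal, then `g = f` is allowed. -/
def Approximates (g : G.PolygonalMap) (f : G.SpatialEmbedding) : Prop :=
  ∀ e e', G.Disj e e' → ∀ i < g.num e, ∀ j < g.num e', ∀ s ∈ I, ∀ t ∈ I,
    dist ((f.curve e).extend (g.param e i s)) ((g.seg e i).point s) +
        dist ((f.curve e').extend (g.param e' j t)) ((g.seg e' j).point t) <
      dist ((f.curve e).extend (g.param e i s)) ((f.curve e').extend (g.param e' j t))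

/-- The projection along `d` is regular as far as crossings between disjoint edges are
concerned: they are transverse, and do not involve vertices or corners. -/
def IsRegularDirection (g : G.PolygonalMap) (d : Space3) : Prop :=
  d ≠ 0 ∧ ∀ e e', G.Disj e e' → ∀ i < g.num e, ∀ j < g.num e',
    Segment3.IsRegularPair d (g.seg e i) (g.seg e' j)

/-- `ℓ(g(e), g(e'))`: the sum of the signs of the crossings between `e` and `e'` in the projection
along `d`. -/
noncomputable def crossingSum (g : G.PolygonalMap) (d : Space3) (e e' : E) : ℤ :=
  ∑ i ∈ Finset.range (g.num e), ∑ j ∈ Finset.range (g.num e'),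
    Segment3.crossingSign d (g.seg e i) (g.seg e' j)

theorem crossingSum_comm (g : G.PolygonalMap) (d : Space3) (e e' : E) :
    g.crossingSum d e e' = g.crossingSum d e' e := by
  unfold crossingSum
  rw [Finset.sum_comm]
  simp only [Segment3.crossingSign_comm]

/-- The class in `L(G)` of the sum of `ℓ(g(e), g(e')) E^{e,e'}` over all unordered pairs of
disjoint edges. -/
noncomputable def linkingClass [Fintype E] (g : G.PolygonalMap) (d : Space3) : G.LinkingModule :=
  Submodule.Quotient.mk (Finsupp.equivFunOnFinite.symm fun p : G.disjointPairs =>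
    Sym2.lift ⟨g.crossingSum d, g.crossingSum_comm d⟩ p.1)

end PolygonalMap

/-- `x` is the Wu invariant `𝓛(f)` of the embedding `f`, computed from some regular projection:
the class in `L(G)` given by the crossing signs in a regular projection of a polygonal
approximation of `f` (of `f` itself, when `f` is polygonal). -/
def SpatialEmbedding.IsWuInvariant [Fintype E] {G : OrientedGraph V E} (f : G.SpatialEmbedding)
    (x : G.LinkingModule) : Prop :=
  ∃ (g : G.PolygonalMap) (d : Space3),
    g.Approximates f ∧ g.IsRegularDirection d ∧ x = g.linkingClass d

end OrientedGraph

/-! Homomorphisms `L(G) → ℚ` correspond to Wu cycles: symmetric functions `w` on pairs of edges that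
vanish off the disjoint pairs and for which every `w e` is a flow (`isWuCycle_homValues`,
`IsWuCycle.toHom`). Evaluating such a homomorphism on the Wu invariant gives half the sum of `w e e'
* ℓ(e, e')` over ordered pairs. The theorem therefore rests on two facts. Over `ℚ` the Wu cycles of
`G` are spanned by those supported on subgraphs of the three types (`IsWuCycle.mem_gen`), and the
pairing of a Wu cycle with crossing numbers depends only on the embedding
(`Approximates.sum_crossingSum_eq`). As `L(G_q) ≅ ℤ`, the Wu cycles on `G_q` are the rational
multiples of the one given by `ε_q`. The integer `m` is a common denominator.

Generation is by induction on the set `A` of edges that carry `w`. It is enough to find one edge `e`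
of `A` for which the flow `w e` is the value at `e` of a generated cycle: subtracting that cycle
removes `e` from the support. If `e` is a loop or has a parallel edge, every circuit in `w e` is
disjoint from a circuit through `e`. Otherwise a double count shows that `w e` splits along every
separation of order at most two of the ends `u`, `v` of `e` in `A \ e` (`IsWuCycle.restr_isFlow`),
so `w e` is a combination of circuits `C` that no such separation splits. Such a `C` is treated in
`Ends.mem_of_unsplit`. If `u` and `v` are connected off `C`, there is a `2K₃`. If the attachments of
the components of `u` and `v` alternate on `C`, there is a `K₃,₃`. Three common attachments give a
`K₅`, or else `C` is a sum of two cycles of the previous kinds. In the remaining case the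
attachments lie on complementary arcs. Then either a path across `C` makes it a sum of two unsplit
cycles off which `u` reaches more vertices, or the ends of the arcs yield a separation of order two
that splits `C`, which is impossible.

Invariance comes from the Gauss integral. The solid angle form is closed, so under a homotopy of two
disjoint arcs the integral changes only by terms that belong to the end points of one arc
(`Curve3.gauss_sub_gauss`). In a combination with the coefficients of a Wu cycle these terms cancel
by the flow condition. Two approximations of one embedding are joined by an admissible straight-line
homotopy. So are a polygonal map and its image squeezed by a factor `l` along the direction of
projection. As `l → 0` the Gauss integral of two segments concentrates at their crossing and tends
to a positive constant times its sign (`Segment3.tendsto_gauss_squeeze`), which turns Gauss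
integrals into crossing sums. -/

set_option linter.unusedSectionVars false

namespace OrientedGraph

/-! ### Flows and Wu cycles -/

section Flows

variable {V E : Type*}

/-- `x` is an end point of the edge `b`. -/
def IsEnd (G : OrientedGraph V E) (b : E) (x : V) : Prop := G.src b = x ∨ G.tgt b = x

open Classical in
/-- The incidence number of an edge and a vertex. -/
noncomputable def inc (G : OrientedGraph V E) (b : E) (x : V) : ℚ :=
  (if G.tgt b = x then 1 else 0) - (if G.src b = x then 1 else 0)

theorem inc_eq_zero {G : OrientedGraph V E} {b : E} {x : V} (h : ¬ G.IsEnd b x) :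
    G.inc b x = 0 := by
  unfold IsEnd at h
  push Not at h
  simp [inc, h.1, h.2]

theorem sum_inc [Fintype V] (G : OrientedGraph V E) (b : E) : ∑ x, G.inc b x = 0 := by
  classical
  simp [inc, Finset.sum_sub_distrib]

theorem not_disj_of_isEnd {G : OrientedGraph V E} {b c : E} {x : V} (hb : G.IsEnd b x)
    (hc : G.IsEnd c x) : ¬ G.Disj b c := by
  rintro ⟨h1, h2, h3, h4⟩
  rcases hb with hb | hb <;> rcases hc with hc | hc <;> simp_all

theorem disj_of_forall {G : OrientedGraph V E} {b c : E}
    (h : ∀ x, G.IsEnd b x → ¬ G.IsEnd c x) : G.Disj b c :=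
  ⟨fun h' => h _ (Or.inl rfl) (Or.inl h'.symm), fun h' => h _ (Or.inl rfl) (Or.inr h'.symm),
    fun h' => h _ (Or.inr rfl) (Or.inl h'.symm), fun h' => h _ (Or.inr rfl) (Or.inr h'.symm)⟩

variable [Fintype E]

/-- The boundary of a `1`-chain. -/
noncomputable def bdry (G : OrientedGraph V E) : (E → ℚ) →ₗ[ℚ] (V → ℚ) where
  toFun z x := ∑ b, z b * G.inc b x
  map_add' z z' := by ext x; simp [add_mul, Finset.sum_add_distrib]
  map_smul' r z := by ext x; simp [Finset.mul_sum, mul_assoc]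

theorem bdry_apply (G : OrientedGraph V E) (z : E → ℚ) (x : V) :
    G.bdry z x = ∑ b, z b * G.inc b x := rfl

theorem sum_bdry [Fintype V] (G : OrientedGraph V E) (z : E → ℚ) : ∑ x, G.bdry z x = 0 := by
  simp only [bdry_apply]
  rw [Finset.sum_comm]
  simp [← Finset.mul_sum, sum_inc]

theorem bdry_eq_zero_of_notMem {G : OrientedGraph V E} {z : E → ℚ} {x : V}
    (h : ∀ b, z b ≠ 0 → ¬ G.IsEnd b x) : G.bdry z x = 0 := by
  rw [bdry_apply]
  refine Finset.sum_eq_zero fun b _ => ?_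
  by_cases hb : z b = 0
  · simp [hb]
  · simp [inc_eq_zero (h b hb)]

/-- The flows of a graph: chains with boundary zero. -/
def IsFlow (G : OrientedGraph V E) (z : E → ℚ) : Prop := G.bdry z = 0

theorem IsFlow.add {G : OrientedGraph V E} {z z' : E → ℚ} (h : G.IsFlow z) (h' : G.IsFlow z') :
    G.IsFlow (z + z') := by
  unfold IsFlow at *; rw [map_add, h, h', add_zero]

theorem IsFlow.sub {G : OrientedGraph V E} {z z' : E → ℚ} (h : G.IsFlow z) (h' : G.IsFlow z') :
    G.IsFlow (z - z') := by
  unfold IsFlow at *; rw [map_sub, h, h', sub_zero]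

theorem IsFlow.smul {G : OrientedGraph V E} {z : E → ℚ} (h : G.IsFlow z) (r : ℚ) :
    G.IsFlow (r • z) := by
  unfold IsFlow at *; rw [map_smul, h, smul_zero]

/-- The symmetric `2`-cycles of the deleted product, as functions on pairs of edges. -/
structure IsWuCycle (G : OrientedGraph V E) (w : E → E → ℚ) : Prop where
  symm : ∀ e e', w e e' = w e' e
  disj : ∀ e e', w e e' ≠ 0 → G.Disj e e'
  flow : ∀ e, G.IsFlow (w e)

/-- The module of symmetric `2`-cycles of the deleted product. -/
def wuCycles (G : OrientedGraph V E) : Submodule ℚ (E → E → ℚ) where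
  carrier := {w | G.IsWuCycle w}
  zero_mem' := ⟨fun _ _ => rfl, fun _ _ h => absurd rfl h, fun _ => map_zero G.bdry⟩
  add_mem' {w w'} h h' := ⟨fun e e' => by simp [h.symm e e', h'.symm e e'],
    fun e e' hne => by
      by_contra hd
      have h1 : w e e' = 0 := by by_contra h1; exact hd (h.disj _ _ h1)
      have h2 : w' e e' = 0 := by by_contra h1; exact hd (h'.disj _ _ h1)
      exact hne (by simp [h1, h2]),
    fun e => (h.flow e).add (h'.flow e)⟩
  smul_mem' r w h := ⟨fun e e' => by simp [h.symm e e'],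
    fun e e' hne => h.disj _ _ fun h0 => hne (by simp [h0]), fun e => (h.flow e).smul r⟩

/-- The span of the symmetric `2`-cycles that are supported on a subgraph homeomorphic to `2K₃`,
`K₅` or `K₃,₃` with edges in `A`. -/
def gen (G : OrientedGraph V E) (A : Finset E) : Submodule ℚ (E → E → ℚ) :=
  Submodule.span ℚ {w | G.IsWuCycle w ∧ ∃ K : G.Subgraph, K.toGraph.IsTwoTrianglesOrKuratowski ∧
    (∀ e e', w e e' ≠ 0 → e ∈ K.edges ∧ e' ∈ K.edges) ∧ K.edges ⊆ A}

theorem gen_le_wuCycles (G : OrientedGraph V E) (A : Finset E) : G.gen A ≤ G.wuCycles :=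
  Submodule.span_le.mpr fun _ h => h.1

theorem gen_mono (G : OrientedGraph V E) {A B : Finset E} (h : A ⊆ B) : G.gen A ≤ G.gen B := by
  refine Submodule.span_mono ?_
  rintro w ⟨h1, K, h2, h3, h4⟩
  exact ⟨h1, K, h2, h3, h4.trans (by exact_mod_cast h)⟩

theorem gen_support (G : OrientedGraph V E) (A : Finset E) {w : E → E → ℚ} (h : w ∈ G.gen A) :
    ∀ e e', w e e' ≠ 0 → e ∈ A ∧ e' ∈ A := by
  refine Submodule.span_induction (p := fun w _ => ∀ e e', w e e' ≠ 0 → e ∈ A ∧ e' ∈ A)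
    ?_ ?_ ?_ ?_ h
  · rintro w ⟨_, K, _, h3, h4⟩ e e' hne
    exact ⟨by exact_mod_cast h4 (h3 _ _ hne).1, by exact_mod_cast h4 (h3 _ _ hne).2⟩
  · intro e e' hne; exact absurd rfl hne
  · intro w w' _ _ h h' e e' hne
    by_cases h0 : w e e' = 0
    · exact h' e e' (by simpa [h0] using hne)
    · exact h e e' h0
  · intro r w _ h e e' hne
    exact h e e' fun h0 => hne (by simp [h0])

/-- The chains that occur as the value at `e` of an element of `G.gen A`. -/
def genAt (G : OrientedGraph V E) (A : Finset E) (e : E) : Submodule ℚ (E → ℚ) :=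
  (G.gen A).map (LinearMap.proj e)

theorem mem_genAt {G : OrientedGraph V E} {A : Finset E} {e : E} {z : E → ℚ} :
    z ∈ G.genAt A e ↔ ∃ w ∈ G.gen A, w e = z := by
  simp [genAt]

/-- Reduction to the values at one edge. -/
theorem mem_gen_of_forall (G : OrientedGraph V E)
    (key : ∀ A : Finset E, A.Nonempty → ∃ e ∈ A, ∀ w, G.IsWuCycle w →
      (∀ b c, w b c ≠ 0 → b ∈ A) → w e ∈ G.genAt A e) :
    ∀ (A : Finset E) (w : E → E → ℚ), G.IsWuCycle w → (∀ b c, w b c ≠ 0 → b ∈ A) →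
      w ∈ G.gen A := by
  classical
  intro A
  induction A using Finset.strongInduction with
  | H A ih =>
    intro w hw hA
    rcases A.eq_empty_or_nonempty with rfl | hne
    · have : w = 0 := by
        ext b c
        by_contra h
        exact absurd (hA b c h) (Finset.notMem_empty _)
      rw [this]; exact Submodule.zero_mem _
    obtain ⟨e, he, hk⟩ := key A hne
    -- The difference `w - w'` vanishes at `e` in the first argument, so it is carried by `A.erase
    -- e` and the induction applies.
    obtain ⟨w', hw', hww⟩ := mem_genAt.mp (hk w hw hA)
    have hW' := gen_le_wuCycles G A hw'
    have hsub : w - w' ∈ G.gen (A.erase e) := by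
      refine ih _ (Finset.erase_ssubset he) _ (sub_mem (S := Submodule ℚ _) hw hW') ?_
      intro b c hbc
      refine Finset.mem_erase.mpr ⟨?_, ?_⟩
      · rintro rfl
        exact hbc (by simp [hww])
      · by_cases h0 : w b c = 0
        · exact (gen_support G A hw' b c fun h => hbc (by simp [h0, h])).1
        · exact hA b c h0
    have := add_mem (gen_mono G (Finset.erase_subset e A) hsub) hw'
    simpa using this

/-! ### Separations of order at most two -/

open Classical in
/-- The restriction of a chain to a set of edges. -/
noncomputable def restr (F : Finset E) (z : E → ℚ) : E → ℚ := fun b => if b ∈ F then z b else 0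

theorem restr_apply_ne_zero {F : Finset E} {z : E → ℚ} {b : E} (h : restr F z b ≠ 0) :
    b ∈ F ∧ z b ≠ 0 := by
  unfold restr at h
  split_ifs at h with h1
  · exact ⟨h1, h⟩
  · exact absurd rfl h

open Classical in
theorem bdry_restr (G : OrientedGraph V E) (F : Finset E) (z : E → ℚ) (x : V) :
    G.bdry (restr F z) x = ∑ b ∈ F, z b * G.inc b x := by
  rw [bdry_apply]
  simp [restr, Finset.sum_ite_mem]

variable [Fintype V]

open Classical in
/-- The vertices that are common to a set `F` of edges and its complement in `H`. -/
noncomputable def sepBdry (G : OrientedGraph V E) (H F : Finset E) : Finset V :=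
  {x | (∃ b ∈ F, G.IsEnd b x) ∧ ∃ c ∈ H \ F, G.IsEnd c x}

theorem mem_sepBdry {G : OrientedGraph V E} [DecidableEq E] {H F : Finset E} {x : V} :
    x ∈ G.sepBdry H F ↔ (∃ b ∈ F, G.IsEnd b x) ∧ ∃ c ∈ H, c ∉ F ∧ G.IsEnd c x := by
  simp [sepBdry, and_assoc]

/-- `F` is the `u`-side of a separation of order at most two of `u` and `v` in `H`. -/
structure IsSep (G : OrientedGraph V E) (H : Finset E) (u v : V) (F : Finset E) : Prop where
  sub : F ⊆ H
  left : ∀ b ∈ H, b ∉ F → ¬ G.IsEnd b u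
  right : ∀ b ∈ F, ¬ G.IsEnd b v
  card : (G.sepBdry H F).card ≤ 2

theorem IsSep.swap [DecidableEq E] {G : OrientedGraph V E} {H : Finset E} {u v : V}
    {F : Finset E} (h : G.IsSep H u v F) : G.IsSep H v u (H \ F) where
  sub := Finset.sdiff_subset
  left b hb hF := h.right b (by simpa [hb] using hF)
  right b hb := h.left b (Finset.mem_sdiff.mp hb).1 (Finset.mem_sdiff.mp hb).2
  card := by
    refine (Finset.card_le_card fun x hx => ?_).trans h.card
    rw [mem_sepBdry] at hx ⊢
    obtain ⟨⟨b, hb, hbx⟩, c, hc, hcF, hcx⟩ := hx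
    rw [Finset.mem_sdiff] at hb
    exact ⟨⟨c, by simpa [hc] using hcF, hcx⟩, b, hb.1, hb.2, hbx⟩

/-- Submodularity: the boundaries of `F ∩ F'` and `F ∪ F'` have together at most as many vertices as
those of `F` and `F'`, hence at most four, so one of the two has at most two. -/
theorem IsSep.inter_or_union [DecidableEq E] {G : OrientedGraph V E} {H : Finset E} {u v : V}
    {F F' : Finset E} (h : G.IsSep H u v F) (h' : G.IsSep H u v F') :
    G.IsSep H u v (F ∩ F') ∨ G.IsSep H u v (F ∪ F') := by
  classical
  have key : (G.sepBdry H (F ∩ F')).card + (G.sepBdry H (F ∪ F')).card ≤ 4 := by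
    rw [← Finset.card_union_add_card_inter]
    have h1 : G.sepBdry H (F ∩ F') ∪ G.sepBdry H (F ∪ F') ⊆ G.sepBdry H F ∪ G.sepBdry H F' := by
      intro x hx
      simp only [Finset.mem_union, mem_sepBdry, Finset.mem_inter] at hx ⊢
      grind
    have h2 : G.sepBdry H (F ∩ F') ∩ G.sepBdry H (F ∪ F') ⊆ G.sepBdry H F ∩ G.sepBdry H F' := by
      intro x hx
      simp only [Finset.mem_union, mem_sepBdry, Finset.mem_inter] at hx ⊢
      grind
    have h3 := Finset.card_union_add_card_inter (G.sepBdry H F) (G.sepBdry H F')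
    have := Finset.card_le_card h1
    have := Finset.card_le_card h2
    have := h.card
    have := h'.card
    omega
  rcases Nat.lt_or_ge 2 (G.sepBdry H (F ∩ F')).card with h3 | h3
  · right
    refine ⟨Finset.union_subset h.sub h'.sub, fun b hb hF => h.left b hb ?_, fun b hb => ?_,
      by omega⟩
    · exact fun hb' => hF (Finset.mem_union_left _ hb')
    · rcases Finset.mem_union.mp hb with hb | hb
      · exact h.right b hb
      · exact h'.right b hb
  · left
    refine ⟨Finset.inter_subset_left.trans h.sub, fun b hb hF => ?_, fun b hb => ?_, h3⟩
    · by_cases hbF : b ∈ F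
      · exact h'.left b hb fun hb' => hF (Finset.mem_inter.mpr ⟨hbF, hb'⟩)
      · exact h.left b hb hbF
    · exact h.right b (Finset.mem_inter.mp hb).1

/-- When all edges of `H` at `x` belong to `F`, conservation of `y` at `x` involves only `F` and
`e`, so the restriction misses exactly the contribution of `e`. -/
theorem bdry_restr_of_forall {G : OrientedGraph V E} [DecidableEq E] {H F : Finset E} {e : E}
    (he : e ∉ H) (hF : F ⊆ H) {y : E → ℚ} (hy : G.IsFlow y) (hs : ∀ b, y b ≠ 0 → b = e ∨ b ∈ H)
    {x : V} (hx : ∀ c ∈ H, c ∉ F → ¬ G.IsEnd c x) :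
    G.bdry (restr F y) x = - (y e * G.inc e x) := by
  have h0 : G.bdry y x = 0 := by rw [hy]; rfl
  rw [bdry_apply] at h0
  rw [bdry_restr]
  have h1 : ∑ b ∈ insert e F, y b * G.inc b x = ∑ b, y b * G.inc b x := by
    refine Finset.sum_subset (Finset.subset_univ _) fun b _ hb => ?_
    by_cases hyb : y b = 0
    · simp [hyb]
    · rcases hs b hyb with rfl | hbH
      · simp at hb
      · rw [inc_eq_zero (hx b hbH fun h => hb (Finset.mem_insert_of_mem h)), mul_zero]
  rw [Finset.sum_insert (fun h => he (hF h)), h0] at h1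
  linarith

theorem eq_zero_of_sum_eq_zero {D : V → ℚ} (hs : ∑ x, D x = 0) (p : V)
    (h : ∀ x, x ≠ p → D x = 0) : D = 0 := by
  classical
  rw [Finset.sum_eq_single p (fun x _ hx => h x hx) (by simp)] at hs
  ext x
  by_cases hx : x = p
  · rw [hx, hs]; rfl
  · exact h x hx

/-- A boundary has total zero by `sum_bdry`, so one that lives on two vertices takes opposite values
there. This is how the flux through one vertex of a separation is computed from the flux at another
vertex. -/
theorem add_eq_zero_of_sum_eq_zero {D : V → ℚ} (hs : ∑ x, D x = 0) {p q : V} (hpq : p ≠ q)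
    (h : ∀ x, x ≠ p → x ≠ q → D x = 0) : D p + D q = 0 := by
  classical
  rw [← hs, ← Finset.sum_pair hpq]
  refine Finset.sum_subset (Finset.subset_univ _) fun x _ hx => ?_
  simp only [Finset.mem_insert, Finset.mem_singleton, not_or] at hx
  exact h x hx.1 hx.2

/-- The value at `e` of a symmetric cycle splits along every separation of order at most two of
the ends of `e`. -/
theorem IsWuCycle.restr_isFlow {G : OrientedGraph V E} [DecidableEq E] {w : E → E → ℚ}
    (hw : G.IsWuCycle w) {H : Finset E} {e : E} (he : e ∉ H) (huv : G.src e ≠ G.tgt e)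
    (hs : ∀ b c, w b c ≠ 0 → b = e ∨ b ∈ H) {F : Finset E}
    (hF : G.IsSep H (G.src e) (G.tgt e) F) : G.IsFlow (restr F (w e)) := by
  have : DecidableEq V := Classical.decEq V
  have hs' : ∀ b c, w b c ≠ 0 → c = e ∨ c ∈ H := fun b c h => hs c b (by rwa [hw.symm])
  have hee : w e e = 0 := by
    by_contra h
    exact (hw.disj _ _ h).1 rfl
  have incu : G.inc e (G.src e) = -1 := by simp [inc, huv.symm]
  have incv : G.inc e (G.tgt e) = 1 := by simp [inc, huv]
  -- A vertex off the boundary of `F` either meets no edge of `F` or meets only edges of `F` among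
  -- those of `H`.
  have hoff : ∀ y : E → ℚ, G.IsFlow y → (∀ b, y b ≠ 0 → b = e ∨ b ∈ H) → ∀ x,
      x ∉ G.sepBdry H F → G.bdry (restr F y) x = 0 ∨
        (G.bdry (restr F y) x = - (y e * G.inc e x) ∧ ∀ c ∈ H, c ∉ F → ¬ G.IsEnd c x) := by
    intro y hy hsy x hx
    by_cases h1 : ∃ b ∈ F, G.IsEnd b x
    · right
      have h2 : ∀ c ∈ H, c ∉ F → ¬ G.IsEnd c x := fun c hc hcF hcx =>
        hx (mem_sepBdry.mpr ⟨h1, c, hc, hcF, hcx⟩)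
      exact ⟨bdry_restr_of_forall he hF.sub hy hsy h2, h2⟩
    · left
      exact bdry_eq_zero_of_notMem fun b hb hbx => h1 ⟨b, (restr_apply_ne_zero hb).1, hbx⟩
  have hz : ∀ x, x ∉ G.sepBdry H F → G.bdry (restr F (w e)) x = 0 := by
    intro x hx
    rcases hoff _ (hw.flow e) (hs' e) x hx with h | h
    · exact h
    · rw [h.1, hee]; simp
  have hsum := sum_bdry G (restr F (w e))
  -- For order at most one there is nothing to count: a function with total zero that is supported
  -- on one vertex vanishes.
  rcases Nat.lt_or_ge (G.sepBdry H F).card 2 with hc | hc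
  · rcases Nat.lt_or_ge (G.sepBdry H F).card 1 with hc' | hc'
    · have : G.sepBdry H F = ∅ := Finset.card_eq_zero.mp (by omega)
      ext x
      exact hz x (by simp [this])
    · obtain ⟨p, hp⟩ := Finset.card_eq_one.mp (show (G.sepBdry H F).card = 1 by omega)
      exact eq_zero_of_sum_eq_zero hsum p fun x hx => hz x (by simpa [hp] using hx)
  -- For order two let `φ` be the boundary of `w e` restricted to `F`, so that `φ p + φ q = 0`. It
  -- suffices to show `φ p = φ q`, and both will be equal to the sum of `inc b p * inc c q * w b c`
  -- over `b ∈ F` and `c ∈ H \ F`. For `b ∈ F` at `p` the flow `w b` avoids `p` by disjointness, so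
  -- what it carries through `e` must pass from one side to the other at `q`. Thus the inner sum
  -- over `c` is `w b e`. The inner sum over `b` for an edge `c` at `q` is treated in the same way,
  -- with `p` in place of `q`.
  obtain ⟨p, q, hpq, hbd⟩ := Finset.card_eq_two.mp (le_antisymm hF.card hc)
  have hpb : p ∈ G.sepBdry H F := by simp [hbd]
  have hqb : q ∈ G.sepBdry H F := by simp [hbd]
  have hne : ∀ x ∈ G.sepBdry H F, x ≠ G.src e ∧ x ≠ G.tgt e := by
    intro x hx
    obtain ⟨⟨b, hb, hbx⟩, c, hc, hcF, hcx⟩ := mem_sepBdry.mp hx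
    exact ⟨fun h => hF.left c hc hcF (h ▸ hcx), fun h => hF.right b hb (h ▸ hbx)⟩
  have hz' : ∀ x, x ≠ p → x ≠ q → G.bdry (restr F (w e)) x = 0 := fun x h1 h2 =>
    hz x (by simp [hbd, h1, h2])
  have hφ := add_eq_zero_of_sum_eq_zero hsum hpq hz'
  -- the flow of `w c` through `F`, for an edge `c` at `q` or `b` at `p`
  have hF1 : ∀ b, G.IsEnd b p → b ∈ F → G.bdry (restr (H \ F) (w b)) q = w b e := by
    intro b hbp hbF
    have hsw := hF.swap
    set D := G.bdry (restr (H \ F) (w b)) with hD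
    have hDp : D p = 0 := bdry_eq_zero_of_notMem fun c hc hcp =>
      not_disj_of_isEnd hbp hcp (hw.disj _ _ (restr_apply_ne_zero hc).2)
    have hDv : D (G.tgt e) = - w b e := by
      rw [hD, bdry_restr_of_forall he Finset.sdiff_subset (hw.flow b) (hs' b), incv, mul_one]
      intro c hc hcF
      exact hF.right c (by simpa [hc] using hcF)
    have hD0 : ∀ x, x ≠ q → x ≠ G.tgt e → D x = 0 := by
      intro x hxq hxv
      by_cases hxp : x = p
      · rw [hxp, hDp]
      by_cases h1 : ∃ c ∈ H \ F, G.IsEnd c x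
      · obtain ⟨c, hc, hcx⟩ := h1
        rw [Finset.mem_sdiff] at hc
        rw [hD, bdry_restr_of_forall he Finset.sdiff_subset (hw.flow b) (hs' b), inc_eq_zero]
        · simp
        · rintro (h | h)
          · exact hF.left c hc.1 hc.2 (h ▸ hcx)
          · exact hxv h.symm
        · intro d hd hdF hdx
          have hxb : x ∈ G.sepBdry H F :=
            mem_sepBdry.mpr ⟨⟨d, by simpa [hd] using hdF, hdx⟩, c, hc.1, hc.2, hcx⟩
          simp [hbd, hxp, hxq] at hxb
      · exact bdry_eq_zero_of_notMem fun c hc hcx => h1 ⟨c, (restr_apply_ne_zero hc).1, hcx⟩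
    have := add_eq_zero_of_sum_eq_zero (sum_bdry G _) (hne q hqb).2 hD0
    linarith
  have hF2 : ∀ c, G.IsEnd c q → c ∈ H → c ∉ F → G.bdry (restr F (w c)) p = - w c e := by
    intro b hbq hbH hbF
    set D := G.bdry (restr F (w b)) with hD
    have hDq : D q = 0 := bdry_eq_zero_of_notMem fun c hc hcq =>
      not_disj_of_isEnd hbq hcq (hw.disj _ _ (restr_apply_ne_zero hc).2)
    have hDu : D (G.src e) = w b e := by
      rw [hD, bdry_restr_of_forall he hF.sub (hw.flow b) (hs' b) hF.left, incu]
      ring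
    have hD0 : ∀ x, x ≠ p → x ≠ G.src e → D x = 0 := by
      intro x hxp hxu
      by_cases hxq : x = q
      · rw [hxq, hDq]
      rcases hoff _ (hw.flow b) (hs' b) x (by simp [hbd, hxp, hxq]) with h | ⟨h, h2⟩
      · exact h
      · by_cases hxv : x = G.tgt e
        · rw [hxv]
          exact bdry_eq_zero_of_notMem fun c hc => hF.right c (restr_apply_ne_zero hc).1
        · rw [hD, h, inc_eq_zero]
          · simp
          · rintro (h | h)
            · exact hxu h.symm
            · exact hxv h.symm
    have := add_eq_zero_of_sum_eq_zero (sum_bdry G _) (hne p hpb).1 hD0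
    linarith
  -- double counting
  have hX1 : ∑ b ∈ F, ∑ c ∈ H \ F, G.inc b p * G.inc c q * w b c
      = G.bdry (restr F (w e)) p := by
    rw [bdry_restr]
    refine Finset.sum_congr rfl fun b hb => ?_
    by_cases hbp : G.IsEnd b p
    · have := hF1 b hbp hb
      rw [bdry_restr] at this
      rw [hw.symm e b, ← this, Finset.sum_mul]
      exact Finset.sum_congr rfl fun c _ => by ring
    · simp [inc_eq_zero hbp]
  have hX2 : ∑ b ∈ F, ∑ c ∈ H \ F, G.inc b p * G.inc c q * w b c
      = - G.bdry (restr (H \ F) (w e)) q := by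
    rw [Finset.sum_comm, bdry_restr, ← Finset.sum_neg_distrib]
    refine Finset.sum_congr rfl fun c hc => ?_
    rw [Finset.mem_sdiff] at hc
    by_cases hcq : G.IsEnd c q
    · have := hF2 c hcq hc.1 hc.2
      rw [bdry_restr] at this
      rw [hw.symm e c, show -(w c e * G.inc c q) = (-w c e) * G.inc c q by ring, ← this,
        Finset.sum_mul]
      exact Finset.sum_congr rfl fun b _ => by rw [hw.symm b c]; ring
    · simp [inc_eq_zero hcq]
  have hadd : restr F (w e) + restr (H \ F) (w e) = w e := by
    ext b
    by_cases hb : b ∈ F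
    · simp [restr, hb]
    · by_cases hbH : b ∈ H
      · simp [restr, hb, hbH]
      · have : w e b = 0 := by
          by_contra h
          rcases hs' e b h with rfl | h'
          · exact h hee
          · exact hbH h'
        simp [restr, hb, hbH, this]
  have hq : G.bdry (restr F (w e)) q + G.bdry (restr (H \ F) (w e)) q = 0 := by
    have := congrFun (hw.flow e) q
    rwa [← hadd, map_add] at this
  ext x
  by_cases hxp : x = p
  · rw [hxp]; change _ = (0 : ℚ); linarith
  by_cases hxq : x = q
  · rw [hxq]; change _ = (0 : ℚ); linarith
  exact hz' x hxp hxq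

/-- Restricting to one side of a separation preserves being split by all separations. -/
theorem restr_isFlow_of_forall [DecidableEq E] {G : OrientedGraph V E} {H : Finset E} {u v : V}
    {z : E → ℚ} (hz : ∀ F, G.IsSep H u v F → G.IsFlow (restr F z)) {F : Finset E}
    (hF : G.IsSep H u v F) : ∀ F', G.IsSep H u v F' → G.IsFlow (restr F' (restr F z)) := by
  intro F' hF'
  have h1 : restr F' (restr F z) = restr (F ∩ F') z := by
    ext b; simp only [restr, Finset.mem_inter]; grind
  rw [h1]
  -- One of the intersection and the union is again a separation. In the second case inclusion and
  -- exclusion recovers the restriction to the intersection.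
  rcases hF.inter_or_union hF' with h | h
  · exact hz _ h
  · have h2 : restr (F ∩ F') z = restr F z + restr F' z - restr (F ∪ F') z := by
      ext b
      simp only [restr, Finset.mem_inter, Finset.mem_union, Pi.add_apply, Pi.sub_apply]
      by_cases h1 : b ∈ F <;> by_cases h2 : b ∈ F' <;> simp [h1, h2]
    rw [h2]
    exact ((hz _ hF).add (hz _ hF')).sub (hz _ h)

/-- A flow that is split by all separations is a sum of such flows whose supports are not split by
any separation. -/
theorem mem_of_forall_sep [DecidableEq E] {G : OrientedGraph V E} {H : Finset E} {u v : V}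
    (S : Submodule ℚ (E → ℚ))
    (hS : ∀ z, G.IsFlow z → (∀ b, z b ≠ 0 → b ∈ H ∧ ¬ G.IsEnd b u ∧ ¬ G.IsEnd b v) →
      (∀ F, G.IsSep H u v F → (∀ b, z b ≠ 0 → b ∈ F) ∨ (∀ b, z b ≠ 0 → b ∉ F)) → z ∈ S)
    (z : E → ℚ) (hz0 : G.IsFlow z)
    (hzH : ∀ b, z b ≠ 0 → b ∈ H ∧ ¬ G.IsEnd b u ∧ ¬ G.IsEnd b v)
    (hz : ∀ F, G.IsSep H u v F → G.IsFlow (restr F z)) : z ∈ S := by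
  classical
  -- Induction on the size of the support: a separation that splits it leaves a strictly smaller
  -- support on either side.
  generalize hn : (Finset.univ.filter fun b => z b ≠ 0).card = n
  induction n using Nat.strong_induction_on generalizing z with
  | _ n ih =>
    by_cases hsplit : ∀ F, G.IsSep H u v F → (∀ b, z b ≠ 0 → b ∈ F) ∨ (∀ b, z b ≠ 0 → b ∉ F)
    · exact hS z hz0 hzH hsplit
    push Not at hsplit
    obtain ⟨F, hF, ⟨b, hb, hbF⟩, c, hc, hcF⟩ := hsplit
    have h1 : restr F z ∈ S := by
      refine ih _ ?_ _ (hz F hF) (fun b hb => hzH b (restr_apply_ne_zero hb).2)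
        (restr_isFlow_of_forall hz hF) rfl
      rw [← hn]
      refine Finset.card_lt_card ⟨fun x hx => ?_, fun h => ?_⟩
      · simp only [Finset.mem_filter, Finset.mem_univ, true_and] at hx ⊢
        exact (restr_apply_ne_zero hx).2
      · have := h (x := b) (by simp [hb])
        simp [restr, hbF] at this
    have h2 : z - restr F z ∈ S := by
      refine ih _ ?_ _ (hz0.sub (hz F hF)) (fun b hb => hzH b ?_) (fun F' hF' => ?_) rfl
      · rw [← hn]
        refine Finset.card_lt_card ⟨fun x hx => ?_, fun h => ?_⟩
        · simp only [Finset.mem_filter, Finset.mem_univ, true_and, Pi.sub_apply] at hx ⊢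
          intro h0
          simp [restr, h0] at hx
        · have := h (x := c) (by simp [hc])
          exact (Finset.mem_filter.mp this).2 (by simp [restr, hcF])
      · intro h0
        simp [restr, h0] at hb
      · have : restr F' (z - restr F z) = restr F' z - restr F' (restr F z) := by
          ext b; simp only [restr, Pi.sub_apply]; split_ifs <;> simp
        rw [this]
        exact (hz _ hF').sub (restr_isFlow_of_forall hz hF _ hF')
    simpa using add_mem h2 h1

end Flows

end OrientedGraph

namespace OrientedGraph

/-! ### Subdivisions and circuits in a graph -/

section Models

variable {V E W F : Type*}

open Classical in
/-- The chain of the edge `b` traversed starting from `x`. -/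
noncomputable def step (G : OrientedGraph V E) (b : E) (x : V) : E → ℚ :=
  Pi.single b (if G.src b = x then 1 else -1)

theorem step_apply_ne_zero {G : OrientedGraph V E} {b c : E} {x : V} (h : G.step b x c ≠ 0) :
    c = b := by
  classical
  by_contra hne
  exact h (by simp [step, hne])

theorem step_self (G : OrientedGraph V E) (b : E) (x : V) :
    G.step b x b = 1 ∨ G.step b x b = -1 := by
  classical
  unfold step
  split_ifs <;> simp

open Classical in
theorem bdry_step [Fintype E] {G : OrientedGraph V E} {b : E} {x y : V}
    (h : s(G.src b, G.tgt b) = s(x, y)) (t : V) :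
    G.bdry (G.step b x) t = (if y = t then 1 else 0) - (if x = t then 1 else 0) := by
  rw [bdry_apply, Finset.sum_eq_single b (fun c _ hc => by simp [step, hc]) (by simp)]
  rw [Sym2.eq_iff] at h
  simp only [step, inc, Pi.single_eq_same]
  rcases h with ⟨rfl, rfl⟩ | ⟨rfl, rfl⟩
  · simp
  · by_cases h : G.src b = G.tgt b
    · simp [h]
    · simp [h]

theorem isEnd_iff_of_joins {G : OrientedGraph V E} {b : E} {x y : V}
    (h : s(G.src b, G.tgt b) = s(x, y)) (t : V) : G.IsEnd b t ↔ t = x ∨ t = y := by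
  rw [Sym2.eq_iff] at h
  unfold IsEnd
  rcases h with ⟨h1, h2⟩ | ⟨h1, h2⟩ <;> rw [h1, h2] <;> grind

/-- A subdivision of `M` in `G`. -/
structure Model (G : OrientedGraph V E) (M : OrientedGraph W F) where
  φ : W → V
  len : F → ℕ
  vert : F → ℕ → V
  edge : F → ℕ → E
  len_pos : ∀ h, 0 < len h
  vert_zero : ∀ h, vert h 0 = φ (M.src h)
  vert_len : ∀ h, vert h (len h) = φ (M.tgt h)
  joins : ∀ h, ∀ i < len h,
    s(G.src (edge h i), G.tgt (edge h i)) = s(vert h i, vert h (i + 1))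
  edge_inj : ∀ h i h' i', i < len h → i' < len h' → edge h i = edge h' i' → h = h' ∧ i = i'
  φ_inj : Function.Injective φ
  vert_ne : ∀ h i, 0 < i → i < len h → ∀ x, vert h i ≠ φ x
  vert_inj : ∀ h i h' i', 0 < i → i < len h → 0 < i' → i' < len h' →
    vert h i = vert h' i' → h = h' ∧ i = i'

namespace Model

variable {G : OrientedGraph V E} {M : OrientedGraph W F} (m : Model G M)

/-- The subgraph covered by a model. -/
def subgraph : G.Subgraph where
  verts := {x | x ∈ Set.range m.φ ∨ ∃ h i, i ≤ m.len h ∧ x = m.vert h i}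
  edges := {b | ∃ h i, i < m.len h ∧ b = m.edge h i}
  src_mem := by
    rintro _ ⟨h, i, hi, rfl⟩
    rcases (isEnd_iff_of_joins (m.joins h i hi) _).mp (Or.inl rfl) with h1 | h1 <;> rw [h1]
    · exact Or.inr ⟨h, i, hi.le, rfl⟩
    · exact Or.inr ⟨h, i + 1, hi, rfl⟩
  tgt_mem := by
    rintro _ ⟨h, i, hi, rfl⟩
    rcases (isEnd_iff_of_joins (m.joins h i hi) _).mp (Or.inr rfl) with h1 | h1 <;> rw [h1]
    · exact Or.inr ⟨h, i, hi.le, rfl⟩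
    · exact Or.inr ⟨h, i + 1, hi, rfl⟩

theorem isSubdivisionOf : m.subgraph.toGraph.IsSubdivisionOf M := by
  classical
  -- The values of `vert h` beyond `len h` need not lie in the subgraph, so the index is cut off at
  -- `len h`.
  refine ⟨fun x => ⟨m.φ x, Or.inl ⟨x, rfl⟩⟩, m.len,
    fun h i => ⟨m.vert h (min i (m.len h)), Or.inr ⟨h, _, min_le_right _ _, rfl⟩⟩,
    fun x => ⟨m.edge x.1 x.2, x.1, x.2, x.2.2, rfl⟩, m.len_pos, ?_, ?_, ?_, ⟨?_, ?_⟩, ⟨?_, ?_⟩⟩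
  · intro h; simp [m.vert_zero]
  · intro h; simp [m.vert_len]
  · intro h i
    have := m.joins h i i.2
    have h1 : min (i : ℕ) (m.len h) = i := min_eq_left i.2.le
    have h2 : min ((i : ℕ) + 1) (m.len h) = i + 1 := min_eq_left i.2
    rw [Sym2.eq_iff] at this ⊢
    simp only [Subgraph.toGraph, Subtype.mk.injEq, h1, h2]
    exact this
  · rintro ⟨h, i⟩ ⟨h', i'⟩ hh
    obtain ⟨rfl, h2⟩ := m.edge_inj h i h' i' i.2 i'.2 (congrArg Subtype.val hh)
    rw [Fin.ext h2]
  · rintro ⟨_, h, i, hi, rfl⟩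
    exact ⟨⟨h, i, hi⟩, rfl⟩
  · have aux : ∀ h (i : Fin (m.len h - 1)), min ((i : ℕ) + 1) (m.len h) = i + 1 := fun h i =>
      min_eq_left (by have := i.2; omega)
    rintro (x | ⟨h, i⟩) (y | ⟨h', i'⟩) hh
    · have := congrArg Subtype.val hh
      simp only [Sum.elim_inl] at this
      rw [m.φ_inj this]
    · have := congrArg Subtype.val hh
      simp only [Sum.elim_inl, Sum.elim_inr, aux] at this
      exact absurd this.symm (m.vert_ne h' _ (by omega) (by have := i'.2; omega) x)
    · have := congrArg Subtype.val hh
      simp only [Sum.elim_inl, Sum.elim_inr, aux] at this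
      exact absurd this (m.vert_ne h _ (by omega) (by have := i.2; omega) y)
    · have := congrArg Subtype.val hh
      simp only [Sum.elim_inr, aux] at this
      obtain ⟨rfl, h2⟩ := m.vert_inj h _ h' _ (by omega) (by have := i.2; omega) (by omega)
        (by have := i'.2; omega) this
      rw [show i = i' from Fin.ext (by omega)]
  · rintro ⟨_, ⟨x, rfl⟩ | ⟨h, i, hi, rfl⟩⟩
    · exact ⟨Sum.inl x, rfl⟩
    · rcases Nat.eq_zero_or_pos i with rfl | h0
      · exact ⟨Sum.inl (M.src h), by simp [m.vert_zero]⟩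
      rcases hi.eq_or_lt with rfl | h1
      · exact ⟨Sum.inl (M.tgt h), by simp [m.vert_len]⟩
      · refine ⟨Sum.inr ⟨h, i - 1, by omega⟩, ?_⟩
        have h2 : i - 1 + 1 = i := by omega
        simp [h2, hi]

/-- The chain of the path that replaces the edge `h`. -/
noncomputable def chain (h : F) : E → ℚ :=
  ∑ i ∈ Finset.range (m.len h), G.step (m.edge h i) (m.vert h i)

theorem chain_ne_zero {h : F} {b : E} (hb : m.chain h b ≠ 0) :
    ∃ i < m.len h, b = m.edge h i := by
  rw [chain, Finset.sum_apply] at hb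
  obtain ⟨i, hi, h1⟩ := Finset.exists_ne_zero_of_sum_ne_zero hb
  exact ⟨i, Finset.mem_range.mp hi, step_apply_ne_zero h1⟩

theorem chain_edge (h : F) (i : ℕ) (hi : i < m.len h) :
    m.chain h (m.edge h i) = 1 ∨ m.chain h (m.edge h i) = -1 := by
  rw [chain, Finset.sum_apply, Finset.sum_eq_single i]
  · exact step_self _ _ _
  · intro j hj hji
    by_contra h1
    exact hji (m.edge_inj h i h j hi (Finset.mem_range.mp hj) (step_apply_ne_zero h1)).2.symm
  · intro h1; exact absurd (Finset.mem_range.mpr hi) h1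

theorem chain_edge_of_ne {h h' : F} (hne : h ≠ h') {i : ℕ} (hi : i < m.len h) :
    m.chain h' (m.edge h i) = 0 := by
  by_contra h1
  obtain ⟨j, hj, h2⟩ := m.chain_ne_zero h1
  exact hne (m.edge_inj h i h' j hi hj h2).1

-- The boundaries of the consecutive steps telescope.
open Classical in
theorem bdry_chain [Fintype E] (h : F) (t : V) : G.bdry (m.chain h) t =
    (if m.φ (M.tgt h) = t then 1 else 0) - (if m.φ (M.src h) = t then 1 else 0) := by
  rw [chain, map_sum, Finset.sum_apply]
  rw [Finset.sum_congr rfl fun i hi => bdry_step (m.joins h i (Finset.mem_range.mp hi)) t]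
  rw [Finset.sum_range_sub (fun i => if m.vert h i = t then (1 : ℚ) else 0), m.vert_zero,
    m.vert_len]

/-- Paths of a subdivision can meet only in images of vertices of `M`, and there only at their own
ends, which are different for disjoint edges of `M`. -/
theorem disj_edge {h h' : F} (hd : M.Disj h h') {i i' : ℕ} (hi : i < m.len h)
    (hi' : i' < m.len h') : G.Disj (m.edge h i) (m.edge h' i') := by
  have key : ∀ j ≤ m.len h, ∀ j' ≤ m.len h', m.vert h j ≠ m.vert h' j' := by
    have ends : ∀ h j, j ≤ m.len h → (0 < j ∧ j < m.len h) ∨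
        (m.vert h j = m.φ (M.src h) ∨ m.vert h j = m.φ (M.tgt h)) := by
      intro h j hj
      rcases Nat.eq_zero_or_pos j with rfl | h0
      · exact Or.inr (Or.inl (m.vert_zero h))
      rcases hj.eq_or_lt with rfl | h1
      · exact Or.inr (Or.inr (m.vert_len h))
      · exact Or.inl ⟨h0, h1⟩
    intro j hj j' hj' heq
    rcases ends h j hj with ⟨h0, h1⟩ | h1 <;> rcases ends h' j' hj' with ⟨h0', h1'⟩ | h1'
    · obtain ⟨rfl, -⟩ := m.vert_inj h j h' j' h0 h1 h0' h1' heq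
      exact hd.1 rfl
    · rcases h1' with h1' | h1' <;> exact m.vert_ne h j h0 h1 _ (heq.trans h1')
    · rcases h1 with h1 | h1 <;> exact m.vert_ne h' j' h0' h1' _ (heq.symm.trans h1)
    · rcases h1 with h1 | h1 <;> rcases h1' with h1' | h1' <;>
        rw [h1, h1'] at heq <;> have := m.φ_inj heq
      · exact hd.1 this
      · exact hd.2.1 this
      · exact hd.2.2.1 this
      · exact hd.2.2.2 this
  refine disj_of_forall fun x hx hx' => ?_
  rw [isEnd_iff_of_joins (m.joins h i hi)] at hx
  rw [isEnd_iff_of_joins (m.joins h' i' hi')] at hx'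
  rcases hx with rfl | rfl <;> rcases hx' with h1 | h1
  · exact key _ hi.le _ hi'.le h1
  · exact key _ hi.le _ hi' h1
  · exact key _ hi _ hi'.le h1
  · exact key _ hi _ hi' h1

variable [Fintype F]

/-- The push-forward of a symmetric cycle along a model. -/
noncomputable def lift (w : F → F → ℚ) : E → E → ℚ :=
  fun b b' => ∑ h, ∑ h', w h h' * (m.chain h b * m.chain h' b')

theorem lift_ne_zero {w : F → F → ℚ} {b b' : E} (h : m.lift w b b' ≠ 0) :
    ∃ h h', w h h' ≠ 0 ∧ m.chain h b ≠ 0 ∧ m.chain h' b' ≠ 0 := by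
  obtain ⟨h1, -, hh⟩ := Finset.exists_ne_zero_of_sum_ne_zero h
  obtain ⟨h2, -, hh⟩ := Finset.exists_ne_zero_of_sum_ne_zero hh
  refine ⟨h1, h2, fun h0 => hh (by simp [h0]), fun h0 => hh (by simp [h0]),
    fun h0 => hh (by simp [h0])⟩

/-- For fixed `h` the path chains weighted by `w h` have the boundary of `w h` transported along the
injective map `φ`, which is zero. -/
theorem lift_isWuCycle [Fintype E] {w : F → F → ℚ} (hw : M.IsWuCycle w) :
    G.IsWuCycle (m.lift w) where
  symm b b' := by
    unfold lift
    rw [Finset.sum_comm]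
    refine Finset.sum_congr rfl fun h _ => Finset.sum_congr rfl fun h' _ => ?_
    rw [hw.symm]; ring
  disj b b' h := by
    obtain ⟨h, h', h0, h1, h2⟩ := m.lift_ne_zero h
    obtain ⟨i, hi, rfl⟩ := m.chain_ne_zero h1
    obtain ⟨i', hi', rfl⟩ := m.chain_ne_zero h2
    exact m.disj_edge (hw.disj _ _ h0) hi hi'
  flow b := by
    classical
    have h1 : m.lift w b = ∑ h, m.chain h b • ∑ h', w h h' • m.chain h' := by
      ext b'
      simp only [lift, Finset.sum_apply, Pi.smul_apply, smul_eq_mul, Finset.mul_sum]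
      refine Finset.sum_congr rfl fun h _ => Finset.sum_congr rfl fun h' _ => by ring
    unfold IsFlow
    rw [h1, map_sum]
    refine Finset.sum_eq_zero fun h _ => ?_
    rw [map_smul]
    suffices h2 : G.bdry (∑ h', w h h' • m.chain h') = 0 by rw [h2, smul_zero]
    ext t
    rw [map_sum, Finset.sum_apply]
    simp only [map_smul, Pi.smul_apply, smul_eq_mul, bdry_chain]
    by_cases ht : ∃ y, m.φ y = t
    · obtain ⟨y, rfl⟩ := ht
      have := congrFun (hw.flow h) y
      rw [bdry_apply] at this
      simp only [m.φ_inj.eq_iff]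
      exact this
    · push Not at ht
      simp [ht]

theorem lift_mem_gen [Fintype E] {w : F → F → ℚ} (hw : M.IsWuCycle w) {A : Finset E}
    (hA : ∀ h i, i < m.len h → m.edge h i ∈ A)
    (hM : m.subgraph.toGraph.IsTwoTrianglesOrKuratowski) : m.lift w ∈ G.gen A := by
  refine Submodule.subset_span ⟨m.lift_isWuCycle hw, m.subgraph, hM, fun e e' hne => ?_, ?_⟩
  · obtain ⟨h, h', -, h1, h2⟩ := m.lift_ne_zero hne
    obtain ⟨i, hi, rfl⟩ := m.chain_ne_zero h1
    obtain ⟨i', hi', rfl⟩ := m.chain_ne_zero h2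
    exact ⟨⟨h, i, hi, rfl⟩, h', i', hi', rfl⟩
  · rintro _ ⟨h, i, hi, rfl⟩
    exact_mod_cast hA h i hi

/-- An edge of the model lies on one path only, so a single term of the outer sum survives. -/
theorem lift_edge (w : F → F → ℚ) (h : F) {i : ℕ} (hi : i < m.len h) :
    m.lift w (m.edge h i) = m.chain h (m.edge h i) • ∑ h', w h h' • m.chain h' := by
  ext b
  unfold lift
  rw [Finset.sum_eq_single h (fun h' _ hne => by simp [m.chain_edge_of_ne hne.symm hi]) (by simp)]
  simp only [Finset.sum_apply, Pi.smul_apply, smul_eq_mul, Finset.mul_sum]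
  exact Finset.sum_congr rfl fun h' _ => by ring

/-- The chain seen by an edge of a model. -/
theorem sum_chain_mem_genAt [Fintype E] {w : F → F → ℚ} (hw : M.IsWuCycle w) {A : Finset E}
    (hA : ∀ h i, i < m.len h → m.edge h i ∈ A)
    (hM : m.subgraph.toGraph.IsTwoTrianglesOrKuratowski) {e : E} (h : F) (i : ℕ)
    (hi : i < m.len h) (he : m.edge h i = e) : ∑ h', w h h' • m.chain h' ∈ G.genAt A e := by
  subst he
  have h1 : m.lift w (m.edge h i) ∈ G.genAt A (m.edge h i) :=
    mem_genAt.mpr ⟨_, m.lift_mem_gen hw hA hM, rfl⟩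
  rw [m.lift_edge w h hi] at h1
  rcases m.chain_edge h i hi with h2 | h2 <;> rw [h2] at h1
  · simpa using h1
  · simpa using h1

end Model

/-- A circuit: a closed path without repeated vertices. -/
structure Circuit (G : OrientedGraph V E) where
  n : ℕ
  vert : ℕ → V
  edge : ℕ → E
  pos : 0 < n
  closed : vert n = vert 0
  joins : ∀ i < n, s(G.src (edge i), G.tgt (edge i)) = s(vert i, vert (i + 1))
  vert_inj : ∀ i < n, ∀ j < n, vert i = vert j → i = j
  edge_inj : ∀ i < n, ∀ j < n, edge i = edge j → i = j

namespace Circuit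

variable {G : OrientedGraph V E} (C : Circuit G)

/-- The chain of a circuit. -/
noncomputable def chain : E → ℚ := ∑ i ∈ Finset.range C.n, G.step (C.edge i) (C.vert i)

theorem chain_ne_zero {b : E} (hb : C.chain b ≠ 0) : ∃ i < C.n, b = C.edge i := by
  rw [chain, Finset.sum_apply] at hb
  obtain ⟨i, hi, h1⟩ := Finset.exists_ne_zero_of_sum_ne_zero hb
  exact ⟨i, Finset.mem_range.mp hi, step_apply_ne_zero h1⟩

theorem chain_edge (i : ℕ) (hi : i < C.n) :
    C.chain (C.edge i) = 1 ∨ C.chain (C.edge i) = -1 := by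
  rw [chain, Finset.sum_apply, Finset.sum_eq_single i]
  · exact step_self _ _ _
  · intro j hj hji
    by_contra h1
    exact hji (C.edge_inj i hi j (Finset.mem_range.mp hj) (step_apply_ne_zero h1)).symm
  · intro h1; exact absurd (Finset.mem_range.mpr hi) h1

theorem chain_isFlow [Fintype E] : G.IsFlow C.chain := by
  classical
  ext t
  rw [chain, map_sum, Finset.sum_apply,
    Finset.sum_congr rfl fun i hi => bdry_step (C.joins i (Finset.mem_range.mp hi)) t,
    Finset.sum_range_sub (fun i => if C.vert i = t then (1 : ℚ) else 0), C.closed, sub_self]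
  rfl

/-- Two disjoint circuits form a subdivision of two loops. -/
def pair (D : Circuit G) (h : ∀ i < C.n, ∀ j < D.n, C.vert i ≠ D.vert j) :
    Model G twoLoops where
  φ k := (![C, D] k).vert 0
  len k := (![C, D] k).n
  vert k := (![C, D] k).vert
  edge k := (![C, D] k).edge
  len_pos k := (![C, D] k).pos
  vert_zero k := rfl
  vert_len k := (![C, D] k).closed
  joins k := (![C, D] k).joins
  edge_inj k i k' i' hi hi' heq := by
    have key : ∀ i < C.n, ∀ j < D.n, C.edge i ≠ D.edge j := by
      intro i hi j hj heq
      have h1 := (C.joins i hi).symm.trans ((congrArg (fun b => s(G.src b, G.tgt b)) heq).trans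
        (D.joins j hj))
      have h2 : C.vert i = D.vert j ∨ C.vert i = D.vert (j + 1) := by
        rw [Sym2.eq_iff] at h1
        rcases h1 with h1 | h1
        · exact Or.inl h1.1
        · exact Or.inr h1.1
      rcases h2 with h2 | h2
      · exact h i hi j hj h2
      · rcases Nat.lt_or_ge (j + 1) D.n with h3 | h3
        · exact h i hi _ h3 h2
        · rw [show j + 1 = D.n by omega, D.closed] at h2
          exact h i hi 0 D.pos h2
    fin_cases k <;> fin_cases k'
    · exact ⟨rfl, C.edge_inj _ hi _ hi' heq⟩
    · exact absurd heq (key _ hi _ hi')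
    · exact absurd heq.symm (key _ hi' _ hi)
    · exact ⟨rfl, D.edge_inj _ hi _ hi' heq⟩
  φ_inj k k' heq := by
    fin_cases k <;> fin_cases k'
    · rfl
    · exact absurd heq (h 0 C.pos 0 D.pos)
    · exact absurd heq.symm (h 0 C.pos 0 D.pos)
    · rfl
  vert_ne k i h0 hi k' heq := by
    fin_cases k <;> fin_cases k'
    · exact h0.ne' (C.vert_inj _ hi _ C.pos heq)
    · exact h _ hi _ D.pos heq
    · exact h _ C.pos _ hi heq.symm
    · exact h0.ne' (D.vert_inj _ hi _ D.pos heq)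
  vert_inj k i k' i' h0 hi h0' hi' heq := by
    fin_cases k <;> fin_cases k'
    · exact ⟨rfl, C.vert_inj _ hi _ hi' heq⟩
    · exact absurd heq (h _ hi _ hi')
    · exact absurd heq.symm (h _ hi' _ hi)
    · exact ⟨rfl, D.vert_inj _ hi _ hi' heq⟩

theorem twoLoops_isWuCycle :
    twoLoops.IsWuCycle fun k k' : Fin 2 => if k = k' then (0 : ℚ) else 1 where
  symm k k' := by simp [eq_comm]
  disj k k' h := by
    have : k ≠ k' := fun h' => h (by simp [h'])
    exact ⟨this, this, this, this⟩
  flow k := by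
    ext x
    rw [bdry_apply]
    exact Finset.sum_eq_zero fun b _ => by rw [show twoLoops.inc b x = 0 from sub_self _, mul_zero]

/-- A circuit that is disjoint from a circuit through `e`. -/
theorem chain_mem_genAt [Fintype E] (D : Circuit G)
    (h : ∀ i < C.n, ∀ j < D.n, C.vert i ≠ D.vert j) {A : Finset E}
    (hC : ∀ i < C.n, C.edge i ∈ A) (hD : ∀ i < D.n, D.edge i ∈ A) {i : ℕ} (hi : i < D.n) :
    C.chain ∈ G.genAt A (D.edge i) := by
  have := (C.pair D h).sum_chain_mem_genAt twoLoops_isWuCycle (A := A) (e := D.edge i) (by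
      intro k i hi
      fin_cases k
      · exact hC i hi
      · exact hD i hi) (Or.inl (C.pair D h).isSubdivisionOf) 1 i hi rfl
  simpa [Fin.sum_univ_two, Model.chain, chain, pair] using this

end Circuit

/-- Conservation at `x` forbids that `b` is the only edge of the support there, because a non-loop
has non-zero incidence with its end. This allows a walk in the support to be continued without
turning back. -/
theorem exists_isEnd_ne [Fintype E] {G : OrientedGraph V E} {z : E → ℚ} (hz : G.IsFlow z) {b : E}
    (hb : z b ≠ 0) {x : V} (hx : G.IsEnd b x) (hl : G.src b ≠ G.tgt b) :
    ∃ c, c ≠ b ∧ z c ≠ 0 ∧ G.IsEnd c x := by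
  classical
  by_contra hcon
  push Not at hcon
  have h0 : G.bdry z x = 0 := by rw [hz]; rfl
  rw [bdry_apply, Finset.sum_eq_single b] at h0
  · have : G.inc b x ≠ 0 := by
      unfold inc
      rcases hx with rfl | rfl
      · simp [hl.symm]
      · simp [hl]
    exact (mul_ne_zero hb this) h0
  · intro c _ hc
    by_cases hzc : z c = 0
    · simp [hzc]
    · rw [inc_eq_zero (hcon c hc hzc), mul_zero]
  · simp

theorem exists_joins {G : OrientedGraph V E} {b : E} {x : V} (h : G.IsEnd b x) :
    ∃ y, s(G.src b, G.tgt b) = s(x, y) := by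
  rcases h with rfl | rfl
  · exact ⟨_, rfl⟩
  · exact ⟨_, Sym2.eq_swap⟩

/-- The support of a non-zero flow contains a circuit. -/
theorem exists_circuit [Finite V] [Fintype E] {G : OrientedGraph V E} {z : E → ℚ}
    (hz : G.IsFlow z) (hne : z ≠ 0) : ∃ C : Circuit G, ∀ i < C.n, z (C.edge i) ≠ 0 := by
  classical
  obtain ⟨b, hb⟩ := Function.ne_iff.mp hne
  by_cases hl : ∃ l, z l ≠ 0 ∧ G.src l = G.tgt l
  · obtain ⟨l, hl, hl'⟩ := hl
    exact ⟨⟨1, fun _ => G.src l, fun _ => l, one_pos, rfl, fun i _ => by rw [← hl'],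
      fun i hi j hj _ => by omega, fun i hi j hj _ => by omega⟩, fun i _ => hl⟩
  push Not at hl
  -- an infinite walk without immediate reversals
  let S := {p : E × V // z p.1 ≠ 0 ∧ G.IsEnd p.1 p.2}
  have hstep : ∀ p : S, ∃ q : S, q.1.1 ≠ p.1.1 ∧ s(G.src q.1.1, G.tgt q.1.1) = s(p.1.2, q.1.2) := by
    rintro ⟨⟨c, x⟩, hc, hx⟩
    obtain ⟨d, hdc, hd, hdx⟩ := exists_isEnd_ne hz hc hx (hl c hc)
    obtain ⟨y, hy⟩ := exists_joins hdx
    exact ⟨⟨⟨d, y⟩, hd, (isEnd_iff_of_joins hy y).mpr (Or.inr rfl)⟩, hdc, hy⟩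
  choose next hnext using hstep
  let st : ℕ → S := fun k => Nat.rec ⟨⟨b, G.src b⟩, hb, Or.inl rfl⟩ (fun _ p => next p) k
  have hst : ∀ k, st (k + 1) = next (st k) := fun k => rfl
  let x : ℕ → V := fun k => (st k).1.2
  let c : ℕ → E := fun k => (st (k + 1)).1.1
  have hxj : ∀ k, s(G.src (c k), G.tgt (c k)) = s(x k, x (k + 1)) := fun k => (hnext (st k)).2
  have hcc : ∀ k, c (k + 1) ≠ c k := fun k => (hnext (st (k + 1))).1
  have hzc : ∀ k, z (c k) ≠ 0 := fun k => (st (k + 1)).2.1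
  have hrep : ∃ j, ∃ i < j, x i = x j := by
    obtain ⟨i, j, hij, hx⟩ := Finite.exists_ne_map_eq_of_infinite x
    rcases lt_or_gt_of_ne hij with h | h
    · exact ⟨j, i, h, hx⟩
    · exact ⟨i, j, h, hx.symm⟩
  -- At the first repetition `x i = x j` the vertices before time `j` are distinct, so the walk from
  -- `i` to `j` is a circuit.
  obtain ⟨i, hij, hxij⟩ := Nat.find_spec hrep
  set j := Nat.find hrep with hj
  have hinj : ∀ k < j, ∀ l < j, x k = x l → k = l := by
    intro k hk l hl hkl
    by_contra hne
    rcases lt_or_gt_of_ne hne with h | h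
    · exact Nat.find_min hrep hl ⟨k, h, hkl⟩
    · exact Nat.find_min hrep hk ⟨l, h, hkl.symm⟩
  have hinj' : ∀ k < j - i, ∀ l < j - i, x (i + k) = x (i + l) → k = l := fun k hk l hl h => by
    have := hinj (i + k) (by omega) (i + l) (by omega) h
    omega
  -- An edge used twice would be traversed backwards the second time, and by injectivity at the very
  -- next step. The walk makes no immediate reversals.
  have hedge : ∀ k l, k < l → l < j - i → c (i + k) ≠ c (i + l) := by
    intro k l hkl hl heq
    have h1 := (hxj (i + k)).symm.trans
      ((congrArg (fun b => s(G.src b, G.tgt b)) heq).trans (hxj (i + l)))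
    rw [Sym2.eq_iff] at h1
    rcases h1 with h1 | h1
    · have := hinj' k (by omega) l hl h1.1
      omega
    · have := hinj' (k + 1) (by omega) l hl h1.2
      rw [← this, ← add_assoc] at heq
      exact hcc _ heq.symm
  refine ⟨⟨j - i, fun k => x (i + k), fun k => c (i + k), by omega, ?_, fun k _ => hxj (i + k),
    hinj', fun k hk l hl h => ?_⟩, fun k _ => hzc _⟩
  · rw [show i + (j - i) = j by omega, ← hxij, add_zero]
  · by_contra hne
    rcases lt_or_gt_of_ne hne with h' | h'
    · exact hedge k l h' hl h
    · exact hedge l k h' hk h.symm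

/-- Flows are combinations of circuits in their support. -/
theorem mem_of_forall_circuit [Finite V] [Fintype E] {G : OrientedGraph V E}
    (S : Submodule ℚ (E → ℚ)) (z : E → ℚ) (hz : G.IsFlow z)
    (hS : ∀ C : Circuit G, (∀ i < C.n, z (C.edge i) ≠ 0) → C.chain ∈ S) : z ∈ S := by
  classical
  generalize hn : (Finset.univ.filter fun b => z b ≠ 0).card = n
  induction n using Nat.strong_induction_on generalizing z with
  | _ n ih =>
    by_cases h0 : z = 0
    · rw [h0]; exact S.zero_mem
    obtain ⟨C, hC⟩ := exists_circuit hz h0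
    -- The coefficients of a circuit are `±1`, so a multiple of it can be subtracted that makes the
    -- coefficient of its first edge vanish. The support shrinks.
    obtain ⟨r, hr⟩ : ∃ r : ℚ, z (C.edge 0) - r * C.chain (C.edge 0) = 0 := by
      rcases C.chain_edge 0 C.pos with h | h <;> rw [h]
      · exact ⟨z (C.edge 0), by ring⟩
      · exact ⟨-z (C.edge 0), by ring⟩
    have hsupp : ∀ b, (z - r • C.chain) b ≠ 0 → z b ≠ 0 := by
      intro b hb h1
      by_cases h2 : C.chain b = 0
      · exact hb (by simp [h1, h2])
      · obtain ⟨i, hi, rfl⟩ := C.chain_ne_zero h2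
        exact hC i hi h1
    have h1 : z - r • C.chain ∈ S := by
      refine ih _ ?_ _ (hz.sub (C.chain_isFlow.smul r))
        (fun D hD => hS D fun i hi => hsupp _ (hD i hi)) rfl
      rw [← hn]
      refine Finset.card_lt_card ⟨fun b hb => ?_, fun h => ?_⟩
      · simp only [Finset.mem_filter, Finset.mem_univ, true_and] at hb ⊢
        exact hsupp b hb
      · have := h (x := C.edge 0) (by simpa using hC 0 C.pos)
        exact (Finset.mem_filter.mp this).2 (by simpa using hr)
    simpa using add_mem h1 (S.smul_mem r (hS C hC))

end Models

end OrientedGraph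

namespace OrientedGraph

/-! ### Walks and cycles -/

section Walks

variable {V E W F : Type*}

/-- The simple graph of a set of edges. -/
def sg (G : OrientedGraph V E) (H : Finset E) : SimpleGraph V where
  Adj x y := x ≠ y ∧ ∃ b ∈ H, s(G.src b, G.tgt b) = s(x, y)
  symm := ⟨fun _ _ ⟨h, b, hb, hxy⟩ => ⟨h.symm, b, hb, hxy.trans Sym2.eq_swap⟩⟩
  loopless := ⟨fun _ h => h.1 rfl⟩

theorem sg_mono (G : OrientedGraph V E) {H H' : Finset E} (h : H ⊆ H') : G.sg H ≤ G.sg H' :=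
  fun _ _ ⟨h1, b, hb, hxy⟩ => ⟨h1, b, h hb, hxy⟩

/-- A set of edges without loops and multiple edges. -/
structure SimpleOn (G : OrientedGraph V E) (A : Finset E) : Prop where
  ne : ∀ b ∈ A, G.src b ≠ G.tgt b
  eq : ∀ b ∈ A, ∀ c ∈ A, s(G.src b, G.tgt b) = s(G.src c, G.tgt c) → b = c

open Classical in
/-- The chain of the edge of `A` from `x` to `y`. -/
noncomputable def dart (G : OrientedGraph V E) (A : Finset E) (x y : V) : E → ℚ :=
  ∑ b ∈ A with s(G.src b, G.tgt b) = s(x, y), G.step b x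

theorem SimpleOn.dart_eq {G : OrientedGraph V E} {A : Finset E} (hA : G.SimpleOn A) {b : E}
    (hb : b ∈ A) {x y : V} (h : s(G.src b, G.tgt b) = s(x, y)) : G.dart A x y = G.step b x := by
  classical
  unfold dart
  rw [Finset.sum_eq_single_of_mem b (Finset.mem_filter.mpr ⟨hb, h⟩)]
  intro c hc hcb
  rw [Finset.mem_filter] at hc
  exact absurd (hA.eq c hc.1 b hb (hc.2.trans h.symm)) hcb

theorem SimpleOn.dart_swap {G : OrientedGraph V E} {A : Finset E} (hA : G.SimpleOn A) {x y : V}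
    (h : (G.sg A).Adj x y) : G.dart A y x = - G.dart A x y := by
  classical
  obtain ⟨hne, b, hb, hxy⟩ := h
  rw [hA.dart_eq hb hxy, hA.dart_eq hb (hxy.trans Sym2.eq_swap)]
  have := hA.ne b hb
  rw [Sym2.eq_iff] at hxy
  unfold step
  rw [← Pi.single_neg]
  rcases hxy with ⟨rfl, rfl⟩ | ⟨rfl, rfl⟩ <;> simp [this]

/-- The sum of a function of darts along a walk. -/
def wchain {N : Type*} [AddCommGroup N] (δ : V → V → N) {S : SimpleGraph V} :
    ∀ {x y : V}, S.Walk x y → N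
  | _, _, .nil => 0
  | x, _, .cons (v := y) _ p => δ x y + wchain δ p

section wchain

variable {N : Type*} [AddCommGroup N] (δ : V → V → N) {S S' : SimpleGraph V} {x y z : V}

@[simp] theorem wchain_nil : wchain δ (.nil : S.Walk x x) = 0 := rfl

@[simp] theorem wchain_cons (h : S.Adj x y) (p : S.Walk y z) :
    wchain δ (.cons h p) = δ x y + wchain δ p := rfl

@[simp] theorem wchain_append (p : S.Walk x y) (q : S.Walk y z) :
    wchain δ (p.append q) = wchain δ p + wchain δ q := by
  induction p with
  | nil => simp
  | cons h p ih => simp [ih, add_assoc]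

@[simp] theorem wchain_concat (p : S.Walk x y) (h : S.Adj y z) :
    wchain δ (p.concat h) = wchain δ p + δ y z := by
  simp [SimpleGraph.Walk.concat_eq_append]

theorem wchain_reverse (hδ : ∀ x y, S.Adj x y → δ y x = - δ x y) (p : S.Walk x y) :
    wchain δ p.reverse = - wchain δ p := by
  induction p with
  | nil => simp
  | cons h p ih => simp [ih, hδ _ _ h, SimpleGraph.Walk.reverse_cons]

@[simp] theorem wchain_mapLe (h : S ≤ S') (p : S.Walk x y) :
    wchain δ (p.mapLe h) = wchain δ p := by
  induction p with
  | nil => rfl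
  | cons h' p ih => exact congrArg (δ _ _ + ·) ih

theorem wchain_eq_sum (p : S.Walk x y) :
    wchain δ p = ∑ i ∈ Finset.range p.length, δ (p.getVert i) (p.getVert (i + 1)) := by
  induction p with
  | nil => simp
  | cons h p ih =>
    rw [wchain_cons, SimpleGraph.Walk.length_cons, Finset.sum_range_succ', ih, add_comm]
    simp

end wchain

/-! ### Subdivisions from systems of paths -/

/-- A system of paths that forms a subdivision of `M`. -/
structure PathSystem (S : SimpleGraph V) (M : OrientedGraph W F) where
  φ : W → V
  path : ∀ h, S.Walk (φ (M.src h)) (φ (M.tgt h))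
  isPath : ∀ h, (path h).IsPath
  φ_inj : Function.Injective φ
  ends : ∀ h y, φ y ∈ (path h).support → y = M.src h ∨ y = M.tgt h
  meet : ∀ h h', h ≠ h' → ∀ x ∈ (path h).support, x ∈ (path h').support → x ∈ Set.range φ

namespace PathSystem

variable {G : OrientedGraph V E} {A : Finset E} {M : OrientedGraph W F}
  (P : PathSystem (G.sg A) M)

/-- The edges of a path system. -/
noncomputable def edge (h : F) (i : ℕ) (hi : i < (P.path h).length) : E :=
  ((P.path h).adj_getVert_succ hi).2.choose

theorem edge_spec (h : F) (i : ℕ) (hi : i < (P.path h).length) : P.edge h i hi ∈ A ∧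
    s(G.src (P.edge h i hi), G.tgt (P.edge h i hi)) =
      s((P.path h).getVert i, (P.path h).getVert (i + 1)) :=
  ((P.path h).adj_getVert_succ hi).2.choose_spec

/-- An edge common to two different paths has both its end points in the image of `φ`. These are
then the images of the two ends of `h` and of `h'`, which is impossible because `M` has no parallel
edges. -/
theorem edge_inj (hM : ∀ h, M.src h ≠ M.tgt h)
    (hM' : ∀ h h', s(M.src h, M.tgt h) = s(M.src h', M.tgt h') → h = h')
    (h : F) (i : ℕ) (h' : F) (i' : ℕ) (hi : i < (P.path h).length) (hi' : i' < (P.path h').length)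
    (heq : P.edge h i hi = P.edge h' i' hi') : h = h' ∧ i = i' := by
  have h1 := (P.edge_spec h i hi).2
  rw [heq, (P.edge_spec h' i' hi').2] at h1
  by_cases hh : h = h'
  · subst hh
    refine ⟨rfl, ?_⟩
    have inj := (P.isPath h).getVert_injOn
    rw [Sym2.eq_iff] at h1
    rcases h1 with h1 | h1
    · exact (inj (Set.mem_ofPred.mpr hi'.le) (Set.mem_ofPred.mpr hi.le) h1.1).symm
    · have e1 := inj (Set.mem_ofPred.mpr hi'.le) (Set.mem_ofPred.mpr hi) h1.1
      have e2 := inj (Set.mem_ofPred.mpr hi') (Set.mem_ofPred.mpr hi.le) h1.2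
      omega
  · exfalso
    have m1 := (P.path h).getVert_mem_support i
    have m2 := (P.path h).getVert_mem_support (i + 1)
    have hne := ((P.path h).adj_getVert_succ hi).ne
    have m3 : (P.path h).getVert i ∈ (P.path h').support := by
      rw [Sym2.eq_iff] at h1
      rcases h1 with h1 | h1
      · rw [← h1.1]; exact (P.path h').getVert_mem_support _
      · rw [← h1.2]; exact (P.path h').getVert_mem_support _
    have m4 : (P.path h).getVert (i + 1) ∈ (P.path h').support := by
      rw [Sym2.eq_iff] at h1
      rcases h1 with h1 | h1
      · rw [← h1.2]; exact (P.path h').getVert_mem_support _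
      · rw [← h1.1]; exact (P.path h').getVert_mem_support _
    obtain ⟨a, ha⟩ := P.meet h h' hh _ m1 m3
    obtain ⟨b, hb⟩ := P.meet h h' hh _ m2 m4
    rw [← ha] at m1 m3 hne
    rw [← hb] at m2 m4 hne
    have hab : a ≠ b := fun h => hne (by rw [h])
    refine hh (hM' _ _ ?_)
    rw [Sym2.eq_iff]
    rcases P.ends _ _ m1 with rfl | rfl <;> rcases P.ends _ _ m2 with rfl | rfl <;>
      rcases P.ends _ _ m3 with h3 | h3 <;> rcases P.ends _ _ m4 with h4 | h4 <;> simp_all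

open Classical in
/-- The subdivision given by a path system. -/
noncomputable def model (hM : ∀ h, M.src h ≠ M.tgt h)
    (hM' : ∀ h h', s(M.src h, M.tgt h) = s(M.src h', M.tgt h') → h = h') : Model G M where
  φ := P.φ
  len h := (P.path h).length
  vert h := (P.path h).getVert
  -- Indices past the end are irrelevant and get the first edge. It exists because a path of length
  -- zero would make `φ` identify the two ends of a non-loop.
  edge h i := if hi : i < (P.path h).length then P.edge h i hi
    else (P.edge h 0 (by
      by_contra h0
      exact hM h (P.φ_inj (SimpleGraph.Walk.eq_of_length_eq_zero (p := P.path h) (by omega)))))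
  len_pos h := by
    by_contra h0
    exact hM h (P.φ_inj (SimpleGraph.Walk.eq_of_length_eq_zero (p := P.path h) (by omega)))
  vert_zero h := (P.path h).getVert_zero
  vert_len h := (P.path h).getVert_length
  joins h i hi := by simp only [hi, dif_pos]; exact (P.edge_spec h i hi).2
  edge_inj h i h' i' hi hi' heq := by
    simp only [hi, hi', dif_pos] at heq
    exact P.edge_inj hM hM' h i h' i' hi hi' heq
  φ_inj := P.φ_inj
  vert_ne h i h0 hi y heq := by
    have hm := (P.path h).getVert_mem_support i
    rw [heq] at hm
    rcases P.ends h y hm with rfl | rfl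
    · exact h0.ne' (((P.isPath h).getVert_eq_start_iff hi.le).mp heq)
    · exact hi.ne (((P.isPath h).getVert_eq_end_iff hi.le).mp heq)
  vert_inj h i h' i' h0 hi h0' hi' heq := by
    by_cases hh : h = h'
    · subst hh
      exact ⟨rfl, (P.isPath h).getVert_injOn (Set.mem_ofPred.mpr hi.le)
        (Set.mem_ofPred.mpr hi'.le) heq⟩
    · exfalso
      have hm := (P.path h).getVert_mem_support i
      obtain ⟨y, hy⟩ := P.meet h h' hh _ hm (heq ▸ (P.path h').getVert_mem_support i')
      rw [← hy] at hm
      rcases P.ends h y hm with rfl | rfl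
      · exact h0.ne' (((P.isPath h).getVert_eq_start_iff hi.le).mp hy.symm)
      · exact hi.ne (((P.isPath h).getVert_eq_end_iff hi.le).mp hy.symm)

/-- This is the device by which a subdivision with a path through `e` yields elements of `genAt A
e`: the Wu cycle `w` of `M` is pushed forward and read off at `e`. -/
theorem sum_wchain_mem_genAt [Fintype E] [Fintype F] (hA : G.SimpleOn A)
    (hM : ∀ h, M.src h ≠ M.tgt h)
    (hM' : ∀ h h', s(M.src h, M.tgt h) = s(M.src h', M.tgt h') → h = h')
    {w : F → F → ℚ} (hw : M.IsWuCycle w)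
    (hT : (P.model hM hM').subgraph.toGraph.IsTwoTrianglesOrKuratowski) {e : E} (heA : e ∈ A)
    (h : F) (he : s(G.src e, G.tgt e) ∈ (P.path h).edges) :
    ∑ h', w h h' • wchain (G.dart A) (P.path h') ∈ G.genAt A e := by
  obtain ⟨i, hi, h1⟩ : ∃ i, ∃ hi : i < (P.path h).length,
      s(G.src e, G.tgt e) = s((P.path h).getVert i, (P.path h).getVert (i + 1)) := by
    obtain ⟨i, hi, h1⟩ := List.getElem_of_mem he
    refine ⟨i, by simpa using hi, ?_⟩
    rw [← h1, SimpleGraph.Walk.getElem_edges]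
  have hchain : ∀ h', (P.model hM hM').chain h' = wchain (G.dart A) (P.path h') := by
    intro h'
    rw [wchain_eq_sum, Model.chain]
    refine Finset.sum_congr rfl fun j hj => ?_
    have hj : j < (P.path h').length := Finset.mem_range.mp hj
    rw [hA.dart_eq (P.edge_spec h' j hj).1 (P.edge_spec h' j hj).2]
    simp [model, hj]
  have hed : (P.model hM hM').edge h i = e := by
    simp only [model, hi, dif_pos]
    exact hA.eq _ (P.edge_spec h i hi).1 _ heA ((P.edge_spec h i hi).2.trans h1.symm)
  simp only [← hchain]
  refine (P.model hM hM').sum_chain_mem_genAt hw (fun h' j hj => ?_) hT h i hi hed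
  have hj : j < (P.path h').length := hj
  simp only [model, hj, dif_pos]
  exact (P.edge_spec h' j hj).1

end PathSystem

/-! ### Cycles as periodic sequences and their arcs -/

/-- A cycle of a simple graph, as a periodic sequence. -/
structure Cyc (S : SimpleGraph V) where
  n : ℕ
  three_le : 3 ≤ n
  c : ℕ → V
  adj : ∀ k, S.Adj (c k) (c (k + 1))
  per : ∀ k, c (k + n) = c k
  inj : ∀ k l, k < l → l < k + n → c k ≠ c l

namespace Cyc

variable {S : SimpleGraph V} (C : Cyc S)

/-- The vertices of a cycle. -/
def verts : Set V := Set.range C.c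

theorem mem_verts (k : ℕ) : C.c k ∈ C.verts := ⟨k, rfl⟩

theorem per_mul (k m : ℕ) : C.c (k + C.n * m) = C.c k := by
  induction m with
  | zero => simp
  | succ m ih => rw [Nat.mul_succ, ← add_assoc, C.per, ih]

theorem exists_ge {x : V} (hx : x ∈ C.verts) (k : ℕ) : ∃ l, k ≤ l ∧ l < k + C.n ∧ C.c l = x := by
  obtain ⟨m, rfl⟩ := hx
  have hn : 0 < C.n := by have := C.three_le; omega
  -- reduce `m` modulo `n`, counted from `k`
  refine ⟨k + (m + C.n * k - k) % C.n, by omega, ?_, ?_⟩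
  · have := Nat.mod_lt (m + C.n * k - k) hn; omega
  · have h1 : k ≤ C.n * k := Nat.le_mul_of_pos_left k hn
    have h2 := Nat.mod_add_div (m + C.n * k - k) C.n
    rw [← C.per_mul _ ((m + C.n * k - k) / C.n), add_assoc, h2, ← C.per_mul m k]
    congr 1
    omega

theorem eq_of_c_eq {k l i : ℕ} (hk : i ≤ k) (hk' : k < i + C.n) (hl : i ≤ l) (hl' : l < i + C.n)
    (h : C.c k = C.c l) : k = l := by
  by_contra hne
  rcases lt_or_gt_of_ne hne with h' | h'
  · exact C.inj k l h' (by omega) h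
  · exact C.inj l k h' (by omega) h.symm

/-- The arc of length `m` from the `k`-th vertex. -/
def arc (k : ℕ) : ∀ m, S.Walk (C.c k) (C.c (k + m))
  | 0 => .nil
  | m + 1 => (arc k m).concat (C.adj (k + m))

theorem mem_support_arc {k m : ℕ} {x : V} :
    x ∈ (C.arc k m).support ↔ ∃ t ≤ m, x = C.c (k + t) := by
  induction m with
  | zero => simp [arc]
  | succ m ih =>
    rw [arc, SimpleGraph.Walk.support_concat, List.mem_append, List.mem_singleton, ih]
    constructor
    · rintro (⟨t, ht, rfl⟩ | rfl)
      · exact ⟨t, by omega, rfl⟩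
      · exact ⟨m + 1, le_rfl, rfl⟩
    · rintro ⟨t, ht, rfl⟩
      rcases Nat.lt_or_ge m t with h | h
      · right; rw [show t = m + 1 by omega]
      · exact Or.inl ⟨t, h, rfl⟩

theorem isPath_arc {k m : ℕ} (hm : m < C.n) : (C.arc k m).IsPath := by
  induction m with
  | zero => simp [arc]
  | succ m ih =>
    rw [arc]
    refine (ih (by omega)).concat ?_ _
    rw [mem_support_arc]
    rintro ⟨t, ht, h⟩
    exact C.inj (k + t) (k + m + 1) (by omega) (by omega) h.symm

variable {N : Type*} [AddCommGroup N] (δ : V → V → N)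

theorem wchain_arc (k m : ℕ) :
    wchain δ (C.arc k m) = ∑ t ∈ Finset.range m, δ (C.c (k + t)) (C.c (k + t + 1)) := by
  induction m with
  | zero => simp [arc]
  | succ m ih => simp [arc, ih, Finset.sum_range_succ]; rfl

theorem wchain_arc_add (k l m : ℕ) :
    wchain δ (C.arc k (l + m)) = wchain δ (C.arc k l) + wchain δ (C.arc (k + l) m) := by
  simp only [wchain_arc, Finset.sum_range_add, add_assoc]

/-- The chain of a cycle. -/
def chain : N := wchain δ (C.arc 0 C.n)

/-- Moving the starting point by one step only moves the first dart to the end of the sum. -/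
theorem chain_eq (k : ℕ) : wchain δ (C.arc k C.n) = C.chain δ := by
  induction k with
  | zero => rfl
  | succ k ih =>
    rw [← ih]
    have h1 := C.wchain_arc_add δ k 1 C.n
    have h2 := C.wchain_arc_add δ k C.n 1
    have h3 : wchain δ (C.arc (k + C.n) 1) = wchain δ (C.arc k 1) := by
      simp [wchain_arc, C.per, show k + C.n + 1 = k + 1 + C.n by ring]
    rw [h3, add_comm C.n 1, h1, add_comm] at h2
    exact add_right_cancel h2

@[simp] theorem _root_.OrientedGraph.wchain_copy {x y x' y' : V} (p : S.Walk x y) (hx : x = x')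
    (hy : y = y') : wchain δ (p.copy hx hy) = wchain δ p := by
  subst hx hy
  rfl

/-- The arc from the `k`-th vertex to the `l`-th vertex `x`. -/
def arcTo (k l : ℕ) {x : V} (h : k ≤ l) (hx : C.c l = x) : S.Walk (C.c k) x :=
  (C.arc k (l - k)).copy rfl (by rw [Nat.add_sub_cancel' h, hx])

theorem mem_support_arcTo {k l : ℕ} {x z : V} {h : k ≤ l} {hx : C.c l = x} :
    z ∈ (C.arcTo k l h hx).support ↔ ∃ t, k ≤ t ∧ t ≤ l ∧ z = C.c t := by
  rw [arcTo, SimpleGraph.Walk.support_copy, mem_support_arc]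
  constructor
  · rintro ⟨t, ht, rfl⟩
    exact ⟨k + t, by omega, by omega, rfl⟩
  · rintro ⟨t, h1, h2, rfl⟩
    exact ⟨t - k, by omega, by rw [Nat.add_sub_cancel' h1]⟩

theorem isPath_arcTo {k l : ℕ} {x : V} (h : k ≤ l) (hx : C.c l = x) (hl : l < k + C.n) :
    (C.arcTo k l h hx).IsPath := by
  rw [arcTo, SimpleGraph.Walk.isPath_copy]
  exact C.isPath_arc (by omega)

theorem length_arcTo {k l : ℕ} {x : V} (h : k ≤ l) (hx : C.c l = x) :
    (C.arcTo k l h hx).length = l - k := by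
  rw [arcTo, SimpleGraph.Walk.length_copy]
  generalize l - k = m
  induction m with
  | zero => rfl
  | succ m ih => rw [arc, SimpleGraph.Walk.length_concat, ih]

theorem edges_arcTo {k l : ℕ} {x : V} (h : k ≤ l) (hx : C.c l = x) :
    ∀ s ∈ (C.arcTo k l h hx).edges, ∃ t, s = s(C.c t, C.c (t + 1)) := by
  rw [arcTo, SimpleGraph.Walk.edges_copy]
  generalize l - k = m
  induction m with
  | zero => simp [arc]
  | succ m ih =>
    intro s hs
    rw [arc, SimpleGraph.Walk.edges_concat, List.concat_eq_append, List.mem_append,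
      List.mem_singleton] at hs
    rcases hs with hs | hs
    · exact ih s hs
    · exact ⟨_, hs⟩

theorem wchain_arcTo_add {k l m : ℕ} {x y : V} (h : k ≤ l) (hx : C.c l = x) (h' : l ≤ m)
    (hy : C.c m = y) : wchain δ (C.arcTo k l h hx) + wchain δ (C.arcTo l m h' hy) =
      wchain δ (C.arcTo k m (h.trans h') hy) := by
  obtain ⟨r, rfl⟩ := Nat.exists_eq_add_of_le h
  simp only [arcTo, wchain_copy]
  rw [wchain_arc, wchain_arc, wchain_arc, Nat.add_sub_cancel_left,
    show m - k = r + (m - (k + r)) by omega, Finset.sum_range_add]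
  simp only [add_assoc]

theorem wchain_arcTo_self {k : ℕ} {x : V} (hx : C.c (k + C.n) = x) :
    wchain δ (C.arcTo k (k + C.n) (by omega) hx) = C.chain δ := by
  rw [← C.chain_eq δ k, arcTo, wchain_copy, wchain_arc, wchain_arc, Nat.add_sub_cancel_left]

/-- The cycle given by two paths without common interior vertices. -/
theorem exists_of_paths {x y : V} (p : S.Walk x y) (q : S.Walk y x) (hp : p.IsPath)
    (hq : q.IsPath) (h : ∀ z ∈ p.support, z ∈ q.support → z = x ∨ z = y) (hxy : x ≠ y)
    (hlen : 3 ≤ p.length + q.length) :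
    ∃ D : Cyc S, D.verts = {z | z ∈ p.support ∨ z ∈ q.support} ∧
      (∀ k, s(D.c k, D.c (k + 1)) ∈ p.edges ∨ s(D.c k, D.c (k + 1)) ∈ q.edges) ∧
      (D.c 0 = x ∧ D.c p.length = y ∧ D.n = p.length + q.length ∧
        (∀ z ∈ p.support, ∃ t ≤ p.length, D.c t = z) ∧
        ∀ z ∈ q.support, ∃ t, p.length ≤ t ∧ t ≤ D.n ∧ D.c t = z) ∧
      ∀ {N : Type _} [AddCommGroup N] (δ : V → V → N),
        D.chain δ = wchain δ p + wchain δ q := by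
  set r := p.append q with hr
  set n := p.length + q.length with hn
  have hrl : r.length = n := by simp [hr, hn]
  have hpl : 0 < p.length := by
    by_contra h0
    exact hxy (SimpleGraph.Walk.eq_of_length_eq_zero (p := p) (by omega))
  have hql : 0 < q.length := by
    by_contra h0
    exact hxy (SimpleGraph.Walk.eq_of_length_eq_zero (p := q) (by omega)).symm
  -- A coincidence between the two paths can only occur at `x` or `y`, and within the first `n`
  -- indices each of these occurs once.
  have hinj : ∀ i < n, ∀ j < n, i < j → r.getVert i ≠ r.getVert j := by
    intro i hi j hj hij heq
    rw [hr, SimpleGraph.Walk.getVert_append, SimpleGraph.Walk.getVert_append] at heq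
    split_ifs at heq with h1 h2 h2
    · exact hij.ne (hp.getVert_injOn (Set.mem_ofPred.mpr h1.le) (Set.mem_ofPred.mpr h2.le) heq)
    · rcases h _ (p.getVert_mem_support i) (heq ▸ q.getVert_mem_support _) with h3 | h3
      · have := (hq.getVert_eq_end_iff (i := j - p.length) (by omega)).mp (heq ▸ h3)
        omega
      · have := (hp.getVert_eq_end_iff (i := i) (by omega)).mp h3
        omega
    · omega
    · have := hq.getVert_injOn (Set.mem_ofPred.mpr (show i - p.length ≤ q.length by omega))
        (Set.mem_ofPred.mpr (show j - p.length ≤ q.length by omega)) heq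
      omega
  have hn0 : 0 < n := by omega
  -- The closed walk `r` returns to its start at index `n`, so reducing indices modulo `n` is
  -- compatible with the successor.
  have hsucc : ∀ k, r.getVert ((k + 1) % n) = r.getVert (k % n + 1) := by
    intro k
    rcases (Nat.succ_le_of_lt (Nat.mod_lt k hn0)).eq_or_lt with h1 | h1
    · have h2 : (k + 1) % n = 0 := by
        rw [Nat.add_mod, Nat.mod_eq_of_lt (show 1 < n by omega)]
        rw [show k % n + 1 = n from h1, Nat.mod_self]
      have h1' : k % n + 1 = r.length := by rw [hrl]; exact h1
      rw [h2, h1', r.getVert_length, r.getVert_zero]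
    · have h2 : (k + 1) % n = k % n + 1 := by
        rw [Nat.add_mod, Nat.mod_eq_of_lt (show 1 < n by omega)]
        exact Nat.mod_eq_of_lt h1
      rw [h2]
  refine ⟨⟨n, hlen, fun k => r.getVert (k % n), fun k => ?_, fun k => by simp, ?_⟩, ?_, ?_,
    ⟨?_, ?_, rfl, ?_, ?_⟩, ?_⟩
  · rw [hsucc]
    exact r.adj_getVert_succ (by rw [hrl]; exact Nat.mod_lt k hn0)
  · intro k l hkl hl heq
    have hne : k % n ≠ l % n := by
      intro h1
      have h2 := (Nat.modEq_iff_dvd' hkl.le).mp h1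
      have := Nat.le_of_dvd (by omega) h2
      omega
    rcases lt_or_gt_of_ne hne with h1 | h1
    · exact hinj _ (Nat.mod_lt k hn0) _ (Nat.mod_lt l hn0) h1 heq
    · exact hinj _ (Nat.mod_lt l hn0) _ (Nat.mod_lt k hn0) h1 heq.symm
  · ext z
    have h1 : z ∈ r.support ↔ z ∈ p.support ∨ z ∈ q.support := by
      simp [hr, SimpleGraph.Walk.mem_support_append_iff]
    rw [Set.mem_ofPred, ← h1, SimpleGraph.Walk.mem_support_iff_exists_getVert]
    constructor
    · rintro ⟨k, rfl⟩
      exact ⟨k % n, rfl, by rw [hrl]; exact (Nat.mod_lt k hn0).le⟩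
    · rintro ⟨k, rfl, hk⟩
      rw [hrl] at hk
      rcases hk.eq_or_lt with rfl | hk
      · exact ⟨0, by simp [← hrl]⟩
      · exact ⟨k, by simp [Nat.mod_eq_of_lt hk]⟩
  · intro k
    have hk : k % n < r.length := by rw [hrl]; exact Nat.mod_lt k hn0
    have h1 : s(r.getVert (k % n), r.getVert (k % n + 1)) ∈ r.edges := by
      rw [← SimpleGraph.Walk.getElem_edges (i := k % n) (by simpa using hk)]
      exact List.getElem_mem _
    rw [hr, SimpleGraph.Walk.edges_append, List.mem_append] at h1
    simpa only [hsucc] using h1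
  · simp
  · change r.getVert (p.length % n) = y
    rw [Nat.mod_eq_of_lt (by omega), hr, SimpleGraph.Walk.getVert_append]
    simp
  · intro z hzp
    obtain ⟨k, rfl, hk⟩ := SimpleGraph.Walk.mem_support_iff_exists_getVert.mp hzp
    refine ⟨k, hk, ?_⟩
    change r.getVert (k % n) = _
    rw [Nat.mod_eq_of_lt (by omega), hr, SimpleGraph.Walk.getVert_append]
    rcases hk.eq_or_lt with rfl | hk
    · simp
    · rw [if_pos hk]
  · intro z hzq
    obtain ⟨k, rfl, hk⟩ := SimpleGraph.Walk.mem_support_iff_exists_getVert.mp hzq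
    refine ⟨p.length + k, by omega, show p.length + k ≤ n by omega, ?_⟩
    change r.getVert ((p.length + k) % n) = _
    rcases hk.eq_or_lt with rfl | hk
    · rw [← hn, Nat.mod_self, r.getVert_zero, q.getVert_length]
    · rw [Nat.mod_eq_of_lt (by omega), hr, SimpleGraph.Walk.getVert_append, if_neg (by omega)]
      simp
  · intro N _ δ
    have hR : Finset.range r.length = Finset.range n := by rw [hrl]
    rw [← wchain_append, ← hr, wchain_eq_sum, chain, wchain_arc, hR]
    refine Finset.sum_congr rfl fun t ht => ?_
    rw [Finset.mem_range] at ht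
    simp only [zero_add]
    rw [hsucc, Nat.mod_eq_of_lt ht]

end Cyc

/-- In a graph without loops and multiple edges a circuit is a cycle. -/
theorem Circuit.exists_cyc {G : OrientedGraph V E} {A : Finset E} (hA : G.SimpleOn A)
    (C : Circuit G) {H : Finset E} (hHA : H ⊆ A) (hC : ∀ i < C.n, C.edge i ∈ H) :
    ∃ D : Cyc (G.sg H), D.chain (G.dart A) = C.chain ∧
      (∀ k, ∃ i < C.n, s(D.c k, D.c (k + 1)) = s(G.src (C.edge i), G.tgt (C.edge i))) ∧
      ∀ k, ∃ i < C.n, D.c k = C.vert i := by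
  -- A circuit of length one is a loop, and one of length two consists of two parallel edges.
  have h3 : 3 ≤ C.n := by
    by_contra h
    have hn := C.pos
    rcases (show C.n = 1 ∨ C.n = 2 by omega) with h1 | h1
    · have h2 := C.joins 0 (by omega)
      have h4 := C.closed
      rw [h1] at h4
      rw [zero_add, h4, Sym2.eq_iff] at h2
      refine hA.ne _ (hHA (hC 0 (by omega))) ?_
      rcases h2 with h2 | h2 <;> rw [h2.1, h2.2]
    · have h2 := C.joins 0 (by omega)
      have h2' := C.joins 1 (by omega)
      have h4 := C.closed
      rw [h1] at h4
      rw [show 1 + 1 = 2 from rfl, h4] at h2'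
      rw [zero_add] at h2
      have := C.edge_inj 0 (by omega) 1 (by omega)
        (hA.eq _ (hHA (hC 0 (by omega))) _ (hHA (hC 1 (by omega)))
          (h2.trans (Sym2.eq_swap.trans h2'.symm)))
      omega
  have hn0 := C.pos
  have hsucc : ∀ k, C.vert ((k + 1) % C.n) = C.vert (k % C.n + 1) := by
    intro k
    rcases (Nat.succ_le_of_lt (Nat.mod_lt k hn0)).eq_or_lt with h1 | h1
    · have h2 : (k + 1) % C.n = 0 := by
        rw [Nat.add_mod, Nat.mod_eq_of_lt (show 1 < C.n by omega)]
        rw [show k % C.n + 1 = C.n from h1, Nat.mod_self]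
      rw [h2, show k % C.n + 1 = C.n from h1, C.closed]
    · have h2 : (k + 1) % C.n = k % C.n + 1 := by
        rw [Nat.add_mod, Nat.mod_eq_of_lt (show 1 < C.n by omega)]
        exact Nat.mod_eq_of_lt h1
      rw [h2]
  have hj : ∀ k, s(G.src (C.edge (k % C.n)), G.tgt (C.edge (k % C.n))) =
      s(C.vert (k % C.n), C.vert ((k + 1) % C.n)) := fun k => by
    rw [hsucc]; exact C.joins _ (Nat.mod_lt k hn0)
  refine ⟨⟨C.n, h3, fun k => C.vert (k % C.n), fun k => ⟨fun h => ?_, C.edge (k % C.n),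
    hC _ (Nat.mod_lt k hn0), hj k⟩, fun k => by simp, ?_⟩, ?_, ?_, ?_⟩
  · have h2 := hj k
    rw [← h, Sym2.eq_iff] at h2
    refine hA.ne _ (hHA (hC _ (Nat.mod_lt k hn0))) ?_
    rcases h2 with h2 | h2 <;> rw [h2.1, h2.2]
  · intro k l hkl hl heq
    have h1 := C.vert_inj _ (Nat.mod_lt k hn0) _ (Nat.mod_lt l hn0) heq
    have h2 := (Nat.modEq_iff_dvd' hkl.le).mp h1
    have := Nat.le_of_dvd (by omega) h2
    omega
  · rw [Cyc.chain, Cyc.wchain_arc, Circuit.chain]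
    refine Finset.sum_congr rfl fun t ht => ?_
    have ht : t < C.n := Finset.mem_range.mp ht
    simp only [zero_add]
    have := hj t
    rw [hA.dart_eq (hHA (hC _ (Nat.mod_lt t hn0))) this, Nat.mod_eq_of_lt ht]
  · intro k
    exact ⟨k % C.n, Nat.mod_lt k hn0, (hj k).symm⟩
  · intro k
    exact ⟨k % C.n, Nat.mod_lt k hn0, rfl⟩

/-- A circuit that avoids a path between the ends of `e`. -/
theorem Circuit.chain_mem_genAt_of_walk [Fintype E] [DecidableEq E] {G : OrientedGraph V E}
    {A : Finset E} {e : E} (he : e ∈ A) (C : Circuit G) (hC : ∀ i < C.n, C.edge i ∈ A)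
    (p : (G.sg (A.erase e)).Walk (G.src e) (G.tgt e))
    (hp : ∀ i < C.n, C.vert i ∉ p.support) : C.chain ∈ G.genAt A e := by
  classical
  by_cases hl : G.src e = G.tgt e
  · let D : Circuit G := ⟨1, fun _ => G.src e, fun _ => e, one_pos, rfl, fun i _ => by rw [← hl],
      fun i hi j hj _ => by omega, fun i hi j hj _ => by omega⟩
    exact C.chain_mem_genAt D (fun i hi j _ h => hp i hi (h ▸ p.start_mem_support)) hC
      (fun _ _ => he) (i := 0) one_pos
  set q := p.bypass with hq
  have hqp : q.IsPath := p.bypass_isPath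
  have hedge : ∀ i, ∃ b, (i < q.length → b ∈ A.erase e ∧
      s(G.src b, G.tgt b) = s(q.getVert i, q.getVert (i + 1))) := by
    intro i
    by_cases hi : i < q.length
    · obtain ⟨b, hb, h⟩ := (q.adj_getVert_succ hi).2
      exact ⟨b, fun _ => ⟨hb, h⟩⟩
    · exact ⟨e, fun h => absurd h hi⟩
  choose ed hed using hedge
  have hinj : ∀ i ≤ q.length, ∀ j ≤ q.length, q.getVert i = q.getVert j → i = j :=
    fun i hi j hj h => hqp.getVert_injOn hi hj h
  -- The path is closed up by `e`, which gets the index `q.length`. The edges of the path lie in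
  -- `A.erase e` and therefore differ from `e`.
  let D : Circuit G :=
    { n := q.length + 1
      vert := fun k => if k ≤ q.length then q.getVert k else G.src e
      edge := fun k => if k < q.length then ed k else e
      pos := by omega
      closed := by simp
      joins := fun i hi => by
        by_cases h1 : i < q.length
        · have h2 : i + 1 ≤ q.length := h1
          simpa [h1, h1.le, h2] using (hed i h1).2
        · have h2 : i = q.length := by omega
          subst h2
          simp [Sym2.eq_swap]
      vert_inj := fun i hi j hj h => by
        have h1 : i ≤ q.length := by omega
        have h2 : j ≤ q.length := by omega
        simp only [h1, h2, if_true] at h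
        exact hinj i h1 j h2 h
      edge_inj := fun i hi j hj h => by
        by_cases h1 : i < q.length <;> by_cases h2 : j < q.length
        · simp only [h1, h2, if_true] at h
          have h3 := (hed i h1).2.symm.trans
            ((congrArg (fun b => s(G.src b, G.tgt b)) h).trans (hed j h2).2)
          rw [Sym2.eq_iff] at h3
          rcases h3 with h3 | h3
          · exact hinj _ (by omega) _ (by omega) h3.1
          · have e1 := hinj _ (by omega) _ (by omega) h3.1
            have e2 := hinj _ (by omega) _ (by omega) h3.2
            omega
        · simp only [h1, h2, if_true, if_false] at h
          exact absurd h (Finset.mem_erase.mp (hed i h1).1).1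
        · simp only [h1, h2, if_true, if_false] at h
          exact absurd h.symm (Finset.mem_erase.mp (hed j h2).1).1
        · omega }
  have := C.chain_mem_genAt D (A := A) (fun i hi j hj h => ?_) hC (fun i hi => ?_)
    (i := q.length) (Nat.lt_succ_self _)
  · simpa [D] using this
  · refine hp i hi (p.support_bypass_subset_support ?_)
    have h2 : j ≤ q.length := by
      have : j < q.length + 1 := hj
      omega
    rw [h]
    simp only [D, h2, if_true]
    exact q.getVert_mem_support j
  · by_cases h1 : i < q.length
    · simpa [D, h1] using Finset.mem_of_mem_erase (hed i h1).1
    · simpa [D, h1] using he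

end Walks

end OrientedGraph

namespace OrientedGraph

section Spiders

variable {V E W F : Type*}

/-! ### The complement of a set of vertices -/

/-- The graph `S` without the edges that meet `X`. -/
def off (S : SimpleGraph V) (X : Set V) : SimpleGraph V where
  Adj x y := S.Adj x y ∧ x ∉ X ∧ y ∉ X
  symm := ⟨fun _ _ h => ⟨h.1.symm, h.2.2, h.2.1⟩⟩
  loopless := ⟨fun _ h => h.1.ne rfl⟩

theorem off_le (S : SimpleGraph V) (X : Set V) : off S X ≤ S := fun _ _ h => h.1

theorem notMem_of_mem_support {S : SimpleGraph V} {X : Set V} {x y : V} (p : (off S X).Walk x y)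
    (hx : x ∉ X) : ∀ z ∈ p.support, z ∉ X := by
  induction p with
  | nil => simpa using hx
  | cons h p ih =>
    intro z hz
    rw [SimpleGraph.Walk.support_cons, List.mem_cons] at hz
    rcases hz with rfl | hz
    · exact hx
    · exact ih h.2.2 z hz

theorem notMem_of_reachable {S : SimpleGraph V} {X : Set V} {x y : V}
    (h : (off S X).Reachable x y) (hx : x ∉ X) : y ∉ X := by
  obtain ⟨p⟩ := h
  exact notMem_of_mem_support p hx y p.end_mem_support

theorem reachable_of_mem_support {T : SimpleGraph V} {x y z : V} (p : T.Walk x y)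
    (hz : z ∈ p.support) : T.Reachable x z := by
  classical exact ⟨p.takeUntil z hz⟩

/-- A path from `x` to the first vertex of `Y` on a walk. -/
theorem exists_path_first {T : SimpleGraph V} {x y : V} (p : T.Walk x y) (Y : Set V) (hy : y ∈ Y) :
    ∃ z ∈ Y, ∃ q : T.Walk x z, q.IsPath ∧ (∀ w ∈ q.support, w ∈ Y → w = z) ∧
      ∀ w ∈ q.support, w ∈ p.support := by
  classical
  induction p with
  | nil => exact ⟨_, hy, .nil, by simp, by simp, by simp⟩
  | @cons a b c h p ih =>
    by_cases ha : a ∈ Y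
    · exact ⟨a, ha, .nil, by simp, by simp, by simp⟩
    · obtain ⟨z, hz, q, -, h2, h3⟩ := ih hy
      refine ⟨z, hz, (q.cons h).bypass, SimpleGraph.Walk.bypass_isPath _, fun w hw hwY => ?_,
        fun w hw => ?_⟩
      · have := SimpleGraph.Walk.support_bypass_subset_support _ hw
        rw [SimpleGraph.Walk.support_cons, List.mem_cons] at this
        rcases this with rfl | this
        · exact absurd hwY ha
        · exact h2 w this hwY
      · have := SimpleGraph.Walk.support_bypass_subset_support _ hw
        rw [SimpleGraph.Walk.support_cons, List.mem_cons] at this ⊢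
        exact this.imp id (h3 w)

theorem isPath_append {T : SimpleGraph V} {x y z : V} {p : T.Walk x y} {q : T.Walk y z}
    (hp : p.IsPath) (hq : q.IsPath) (h : ∀ w ∈ p.support, w ∈ q.support → w = y) :
    (p.append q).IsPath := by
  induction p with
  | nil => simpa using hq
  | cons a p ih =>
    rw [SimpleGraph.Walk.cons_isPath_iff] at hp
    rw [SimpleGraph.Walk.cons_append, SimpleGraph.Walk.cons_isPath_iff]
    refine ⟨ih hp.1 hq fun w hw => h w (by simp [hw]), ?_⟩
    rw [SimpleGraph.Walk.mem_support_append_iff]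
    rintro (h1 | h1)
    · exact hp.2 h1
    · have := h _ (by simp) h1
      exact hp.2 (this ▸ p.end_mem_support)

theorem eq_of_mem_takeUntil_of_mem_dropUntil [DecidableEq V] {T : SimpleGraph V} {x y z w : V}
    {p : T.Walk x y} (hp : p.IsPath) (hz : z ∈ p.support) (h1 : w ∈ (p.takeUntil z hz).support)
    (h2 : w ∈ (p.dropUntil z hz).support) : w = z := by
  have hn := hp.support_nodup
  rw [← p.take_spec hz, SimpleGraph.Walk.support_append] at hn
  rw [SimpleGraph.Walk.mem_support_iff] at h2
  rcases h2 with h2 | h2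
  · exact h2
  · exact absurd h2 (List.disjoint_of_nodup_append hn h1)

/-! ### Spiders -/

/-- Paths from a common center that have only the center in common. -/
structure Spider (T : SimpleGraph V) {m : ℕ} (foot : Fin m → V) where
  center : V
  leg : ∀ i, T.Walk center (foot i)
  isPath : ∀ i, (leg i).IsPath
  meet : ∀ i j, i ≠ j → ∀ x ∈ (leg i).support, x ∈ (leg j).support → x = center

/-- The center is the first vertex at which a walk from `z` meets a path from `x` to `y`. The path
is cut there into two legs. -/
theorem Spider.exists_three {T : SimpleGraph V} {x y z : V} (hxy : T.Reachable x y)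
    (hzx : T.Reachable z x) : Nonempty (Spider T ![z, x, y]) := by
  classical
  obtain ⟨p, hp⟩ := hxy.exists_isPath
  obtain ⟨r⟩ := hzx
  obtain ⟨t, ht, q, hq, h1, -⟩ := exists_path_first r {w | w ∈ p.support} p.start_mem_support
  have ht : t ∈ p.support := ht
  have key : ∀ w, (w ∈ q.support → w ∈ p.support → w = t) := fun w hw hw' => h1 w hw hw'
  refine ⟨⟨t, fun i => match i with
    | 0 => q.reverse
    | 1 => (p.takeUntil t ht).reverse
    | 2 => p.dropUntil t ht, fun i => ?_, fun i j hij w hi hj => ?_⟩⟩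
  · match i with
    | 0 => exact hq.reverse
    | 1 => exact (hp.takeUntil ht).reverse
    | 2 => exact hp.dropUntil ht
  · have hT := fun h => p.support_takeUntil_subset_support ht (a := w) h
    have hD := fun h => p.support_dropUntil_subset_support ht (a := w) h
    have hTD := eq_of_mem_takeUntil_of_mem_dropUntil hp ht (w := w)
    match i, j with
    | 0, 0 => exact absurd rfl hij
    | 1, 1 => exact absurd rfl hij
    | 2, 2 => exact absurd rfl hij
    | 0, 1 => exact key w (by simpa using hi) (hT (by simpa using hj))
    | 1, 0 => exact key w (by simpa using hj) (hT (by simpa using hi))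
    | 0, 2 => exact key w (by simpa using hi) (hD hj)
    | 2, 0 => exact key w (by simpa using hj) (hD hi)
    | 1, 2 => exact hTD (by simpa using hi) hj
    | 2, 1 => exact hTD (by simpa using hj) hi

/-- Either there is a spider with one more foot, or the new foot can be joined to a vertex of
some leg. -/
theorem Spider.exists_four {T : SimpleGraph V} {u x y z : V} (L : Spider T ![x, y, z])
    (hu : T.Reachable u L.center) : Nonempty (Spider T ![u, x, y, z]) ∨
      ∃ i, ∃ s ∈ (L.leg i).support, s ≠ L.center ∧ ∃ q : T.Walk u s, q.IsPath ∧
        ∀ w ∈ q.support, ∀ j, w ∈ (L.leg j).support → w = s := by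
  obtain ⟨r⟩ := hu
  obtain ⟨s, ⟨i, hi⟩, q, hq, h1, -⟩ := exists_path_first r {w | ∃ j, w ∈ (L.leg j).support}
    ⟨0, (L.leg 0).start_mem_support⟩
  have h1 : ∀ w ∈ q.support, ∀ j, w ∈ (L.leg j).support → w = s := fun w hw j hj => h1 w hw ⟨j, hj⟩
  by_cases hs : s = L.center
  · subst hs
    refine Or.inl ⟨⟨L.center, fun i => match i with
      | 0 => q.reverse
      | 1 => L.leg 0
      | 2 => L.leg 1
      | 3 => L.leg 2, fun i => ?_, fun i j hij w hi hj => ?_⟩⟩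
    · match i with
      | 0 => exact hq.reverse
      | 1 => exact L.isPath 0
      | 2 => exact L.isPath 1
      | 3 => exact L.isPath 2
    · match i, j with
      | 0, 0 => exact absurd rfl hij
      | 1, 1 => exact absurd rfl hij
      | 2, 2 => exact absurd rfl hij
      | 3, 3 => exact absurd rfl hij
      | 0, 1 => exact h1 w (by simpa using hi) 0 hj
      | 0, 2 => exact h1 w (by simpa using hi) 1 hj
      | 0, 3 => exact h1 w (by simpa using hi) 2 hj
      | 1, 0 => exact h1 w (by simpa using hj) 0 hi
      | 2, 0 => exact h1 w (by simpa using hj) 1 hi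
      | 3, 0 => exact h1 w (by simpa using hj) 2 hi
      | 1, 2 => exact L.meet 0 1 (by decide) w hi hj
      | 2, 1 => exact L.meet 1 0 (by decide) w hi hj
      | 1, 3 => exact L.meet 0 2 (by decide) w hi hj
      | 3, 1 => exact L.meet 2 0 (by decide) w hi hj
      | 2, 3 => exact L.meet 1 2 (by decide) w hi hj
      | 3, 2 => exact L.meet 2 1 (by decide) w hi hj
  · exact Or.inr ⟨i, s, hi, hs, q, hq, h1⟩

/-- A vertex of `X` adjacent to the component of `x` in the complement of `X`. -/
def Att (S : SimpleGraph V) (X : Set V) (x c : V) : Prop :=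
  c ∈ X ∧ ∃ y, (off S X).Reachable x y ∧ S.Adj y c

/-! ### A cycle and two spiders -/

/-- A path system from disjoint regions that contain the interiors of the paths. -/
def PathSystem.ofRegion {S : SimpleGraph V} {M : OrientedGraph W F} {ρ : Type*} (φ : W → V)
    (path : ∀ h, S.Walk (φ (M.src h)) (φ (M.tgt h))) (isPath : ∀ h, (path h).IsPath)
    (φ_inj : Function.Injective φ) (own : ρ → F) (R : ρ → V → Prop)
    (excl : ∀ r r' x, R r x → R r' x → r = r') (hφ : ∀ r y, ¬ R r (φ y))
    (supp : ∀ h, ∀ x ∈ (path h).support,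
      x = φ (M.src h) ∨ x = φ (M.tgt h) ∨ ∃ r, own r = h ∧ R r x) : PathSystem S M where
  φ := φ
  path := path
  isPath := isPath
  φ_inj := φ_inj
  ends h y hy := by
    rcases supp h _ hy with h1 | h1 | ⟨r, -, h1⟩
    · exact Or.inl (φ_inj h1)
    · exact Or.inr (φ_inj h1)
    · exact absurd h1 (hφ r y)
  meet h h' hh x hx hx' := by
    rcases supp h _ hx with h1 | h1 | ⟨r, rfl, h1⟩
    · exact ⟨_, h1.symm⟩
    · exact ⟨_, h1.symm⟩
    · rcases supp h' _ hx' with h2 | h2 | ⟨r', rfl, h2⟩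
      · exact ⟨_, h2.symm⟩
      · exact ⟨_, h2.symm⟩
      · exact absurd (congrArg own (excl r r' x h1 h2)) hh

/-- A cycle with two spiders in different components of the complement. -/
structure Wheel (S : SimpleGraph V) {a b m : ℕ} (f : Fin a → V) (f' : Fin b → V)
    (lo hi : Fin m → ℕ) where
  C : Cyc S
  L : Spider (off S C.verts) f
  R : Spider (off S C.verts) f'
  hL : L.center ∉ C.verts
  hR : R.center ∉ C.verts
  hLR : ¬ (off S C.verts).Reachable L.center R.center
  -- The `t`-th arc runs from index `lo t` to index `hi t`. All arcs lie in one period that starts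
  -- at `base`, and they do not overlap.
  base : ℕ
  base_le : ∀ t, base ≤ lo t
  le_base : ∀ t, hi t ≤ base + C.n
  sep : ∀ t t', t ≠ t' → hi t ≤ lo t' ∨ hi t' ≤ lo t

namespace Wheel

variable {S : SimpleGraph V} {a b m : ℕ} {f : Fin a → V} {f' : Fin b → V} {lo hi : Fin m → ℕ}
  (w : Wheel S f f' lo hi)

/-- The interiors of the legs and the arcs. -/
def region : Fin a ⊕ Fin b ⊕ Fin m → V → Prop
  | .inl i, x => x ∈ (w.L.leg i).support ∧ x ≠ w.L.center
  | .inr (.inl i), x => x ∈ (w.R.leg i).support ∧ x ≠ w.R.center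
  | .inr (.inr t), x => ∃ s, lo t < s ∧ s < hi t ∧ x = w.C.c s

theorem reachable_of_leg {i x} (h : x ∈ (w.L.leg i).support) :
    (off S w.C.verts).Reachable w.L.center x := reachable_of_mem_support _ h

theorem reachable_of_leg' {i x} (h : x ∈ (w.R.leg i).support) :
    (off S w.C.verts).Reachable w.R.center x := reachable_of_mem_support _ h

theorem notMem_of_leg {i x} (h : x ∈ (w.L.leg i).support) : x ∉ w.C.verts :=
  notMem_of_reachable (w.reachable_of_leg h) w.hL

theorem notMem_of_leg' {i x} (h : x ∈ (w.R.leg i).support) : x ∉ w.C.verts :=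
  notMem_of_reachable (w.reachable_of_leg' h) w.hR

theorem ne_of_leg {i j x} (h : x ∈ (w.L.leg i).support) (h' : x ∈ (w.R.leg j).support) : False :=
  w.hLR ((w.reachable_of_leg h).trans (w.reachable_of_leg' h').symm)

/-- The legs of one spider meet only in its center, the two spiders lie in different components off
the cycle, and the arcs are non-overlapping pieces of one period of the cycle. -/
theorem region_excl (r r' x) (h : w.region r x) (h' : w.region r' x) : r = r' := by
  rcases r with i | i | t <;> rcases r' with j | j | t'
  · by_contra hne
    exact h.2 (w.L.meet i j (fun h => hne (by rw [h])) x h.1 h'.1)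
  · exact (w.ne_of_leg h.1 h'.1).elim
  · obtain ⟨s, -, -, rfl⟩ := h'
    exact absurd (w.C.mem_verts s) (w.notMem_of_leg h.1)
  · exact (w.ne_of_leg h'.1 h.1).elim
  · by_contra hne
    exact h.2 (w.R.meet i j (fun h => hne (by rw [h])) x h.1 h'.1)
  · obtain ⟨s, -, -, rfl⟩ := h'
    exact absurd (w.C.mem_verts s) (w.notMem_of_leg' h.1)
  · obtain ⟨s, -, -, rfl⟩ := h
    exact absurd (w.C.mem_verts s) (w.notMem_of_leg h'.1)
  · obtain ⟨s, -, -, rfl⟩ := h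
    exact absurd (w.C.mem_verts s) (w.notMem_of_leg' h'.1)
  · obtain ⟨s, h1, h2, rfl⟩ := h
    obtain ⟨s', h1', h2', h3⟩ := h'
    by_contra hne
    have e1 := w.base_le t
    have e2 := w.base_le t'
    have e3 := w.le_base t
    have e4 := w.le_base t'
    have := w.C.eq_of_c_eq (i := w.base) (by omega) (by omega) (by omega) (by omega) h3
    rcases w.sep t t' (fun h => hne (by rw [h])) with h | h <;> omega

theorem center_notMem_region (r) : ¬ w.region r w.L.center := by
  rcases r with i | i | t
  · exact fun h => h.2 rfl
  · exact fun h => w.hLR (w.reachable_of_leg' h.1).symm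
  · rintro ⟨s, -, -, h⟩
    exact w.hL (h ▸ w.C.mem_verts s)

theorem center_notMem_region' (r) : ¬ w.region r w.R.center := by
  rcases r with i | i | t
  · exact fun h => w.hLR (w.reachable_of_leg h.1)
  · exact fun h => h.2 rfl
  · rintro ⟨s, -, -, h⟩
    exact w.hR (h ▸ w.C.mem_verts s)

theorem node_notMem_region {k : ℕ} (hk : w.base ≤ k) (hk' : k < w.base + w.C.n)
    (h : ∀ t, k ≤ lo t ∨ hi t ≤ k) (r) : ¬ w.region r (w.C.c k) := by
  rcases r with i | i | t
  · exact fun h => w.notMem_of_leg h.1 (w.C.mem_verts k)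
  · exact fun h => w.notMem_of_leg' h.1 (w.C.mem_verts k)
  · rintro ⟨s, h1, h2, h3⟩
    have e1 := w.base_le t
    have e3 := w.le_base t
    have := w.C.eq_of_c_eq (i := w.base) (by omega) (by omega) (by omega) (by omega) h3
    rcases h t with h | h <;> omega

end Wheel

variable {G : OrientedGraph V E} {A : Finset E} {e : E} {u v : V}

theorem sg_erase_le [DecidableEq E] : G.sg (A.erase e) ≤ G.sg A :=
  sg_mono G (Finset.erase_subset e A)

theorem adj_sg (hA : G.SimpleOn A) (he : e ∈ A) (huv : s(G.src e, G.tgt e) = s(u, v)) :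
    (G.sg A).Adj u v := by
  refine ⟨fun h => hA.ne e he ?_, e, he, huv⟩
  subst h
  rw [Sym2.eq_iff] at huv
  rcases huv with h | h <;> rw [h.1, h.2]

namespace Wheel

variable [DecidableEq E] {a b m : ℕ} {f : Fin a → V} {f' : Fin b → V} {lo hi : Fin m → ℕ}
  (w : Wheel (G.sg (A.erase e)) f f' lo hi)

/-- This is the path through `e` that joins the two centers: a leg to one end of `e`, the edge `e`
itself, and a leg of the other spider traversed backwards. -/
theorem exists_central (hA : G.SimpleOn A) (he : e ∈ A) (i : Fin a) (j : Fin b)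
    (huv : s(G.src e, G.tgt e) = s(f i, f' j)) :
    ∃ p : (G.sg A).Walk w.L.center w.R.center, p.IsPath ∧ s(G.src e, G.tgt e) ∈ p.edges ∧
      ∀ x ∈ p.support, x = w.L.center ∨ x = w.R.center ∨ w.region (.inl i) x ∨
        w.region (.inr (.inl j)) x := by
  have hle : off (G.sg (A.erase e)) w.C.verts ≤ G.sg A := (off_le _ _).trans sg_erase_le
  refine ⟨((w.L.leg i).mapLe hle).append (.cons (adj_sg hA he huv)
    ((w.R.leg j).mapLe hle).reverse), ?_, ?_, ?_⟩
  · refine isPath_append ((w.L.isPath i).mapLe hle) ?_ ?_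
    · rw [SimpleGraph.Walk.cons_isPath_iff]
      refine ⟨((w.R.isPath j).mapLe hle).reverse, fun h => ?_⟩
      exact w.ne_of_leg (w.L.leg i).end_mem_support (by simpa using h)
    · intro x hx hx'
      rw [SimpleGraph.Walk.support_cons, List.mem_cons] at hx'
      rcases hx' with h | h
      · exact h
      · exact (w.ne_of_leg (by simpa using hx) (by simpa using h)).elim
  · rw [SimpleGraph.Walk.edges_append, List.mem_append, SimpleGraph.Walk.edges_cons, huv]
    exact Or.inr (by simp)
  · intro x hx
    rw [SimpleGraph.Walk.mem_support_append_iff, SimpleGraph.Walk.support_cons, List.mem_cons] at hx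
    have key : x ∈ (w.L.leg i).support ∨ x ∈ (w.R.leg j).support := by
      rcases hx with h | rfl | h
      · exact Or.inl (by simpa using h)
      · exact Or.inl (w.L.leg i).end_mem_support
      · exact Or.inr (by simpa using h)
    by_cases h1 : x = w.L.center
    · exact Or.inl h1
    by_cases h2 : x = w.R.center
    · exact Or.inr (Or.inl h2)
    rcases key with h | h
    · exact Or.inr (Or.inr (Or.inl ⟨h, h1⟩))
    · exact Or.inr (Or.inr (Or.inr ⟨h, h2⟩))

/-- A leg prolonged by the edge from its foot to the cycle. Since the leg avoids the cycle, the
result is a path whose interior lies in the region of that leg. -/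
theorem exists_leg (i : Fin a) {c : V} (hc : c ∈ w.C.verts)
    (h : (G.sg (A.erase e)).Adj (f i) c) :
    ∃ p : (G.sg A).Walk w.L.center c, p.IsPath ∧
      ∀ x ∈ p.support, x = w.L.center ∨ x = c ∨ w.region (.inl i) x := by
  have hle : off (G.sg (A.erase e)) w.C.verts ≤ G.sg A := (off_le _ _).trans sg_erase_le
  refine ⟨((w.L.leg i).mapLe hle).concat (sg_erase_le h),
    ((w.L.isPath i).mapLe hle).concat ?_ _, fun x hx => ?_⟩
  · intro h'
    exact w.notMem_of_leg (i := i) (by simpa using h') hc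
  · rw [SimpleGraph.Walk.support_concat, List.mem_append, List.mem_singleton] at hx
    rcases hx with hx | hx
    · by_cases h1 : x = w.L.center
      · exact Or.inl h1
      · exact Or.inr (Or.inr ⟨by simpa using hx, h1⟩)
    · exact Or.inr (Or.inl hx)

/-- The mirror image. -/
def swap : Wheel (G.sg (A.erase e)) f' f lo hi :=
  ⟨w.C, w.R, w.L, w.hR, w.hL, fun h => w.hLR h.symm, w.base, w.base_le, w.le_base, w.sep⟩

theorem exists_leg' (i : Fin b) {c : V} (hc : c ∈ w.C.verts)
    (h : (G.sg (A.erase e)).Adj (f' i) c) :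
    ∃ p : (G.sg A).Walk w.R.center c, p.IsPath ∧
      ∀ x ∈ p.support, x = w.R.center ∨ x = c ∨ w.region (.inr (.inl i)) x :=
  w.swap.exists_leg i hc h

theorem exists_arc (t : Fin m) {k l : ℕ} {c : V} (hk : lo t = k) (hl : hi t = l) (hkl : k ≤ l)
    (hlk : l < k + w.C.n) (hc : w.C.c l = c) :
    ∃ p : (G.sg A).Walk (w.C.c k) c, p.IsPath ∧
      (∀ x ∈ p.support, x = w.C.c k ∨ x = c ∨ w.region (.inr (.inr t)) x) ∧
      wchain (G.dart A) p = wchain (G.dart A) (w.C.arcTo k l hkl hc) := by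
  refine ⟨(w.C.arcTo k l hkl hc).mapLe sg_erase_le, (w.C.isPath_arcTo hkl hc hlk).mapLe _, ?_,
    wchain_mapLe _ _ _⟩
  intro x hx
  rw [SimpleGraph.Walk.support_mapLe_eq_support, Cyc.mem_support_arcTo] at hx
  obtain ⟨s, h1, h2, rfl⟩ := hx
  rcases h1.eq_or_lt with rfl | h1
  · exact Or.inl rfl
  rcases h2.eq_or_lt with rfl | h2
  · exact Or.inr (Or.inl hc)
  · exact Or.inr (Or.inr ⟨s, by omega, by omega, rfl⟩)

end Wheel

end Spiders

end OrientedGraph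

namespace OrientedGraph

section Kuratowski

variable {V E W F : Type*}

/-! ### The symmetric cycles of the Kuratowski graphs -/

/-- With integral values the conditions become finite decidable statements, so that for the
Kuratowski graphs they can be checked by evaluation. -/
theorem isWuCycle_of_int [Fintype F] [DecidableEq W] {M : OrientedGraph W F} (w : F → F → ℤ)
    (symm : ∀ h h', w h h' = w h' h)
    (disj : ∀ h h', w h h' ≠ 0 → M.src h ≠ M.src h' ∧ M.src h ≠ M.tgt h' ∧ M.tgt h ≠ M.src h' ∧
      M.tgt h ≠ M.tgt h')
    (flow : ∀ h x, ∑ h', w h h' * ((if M.tgt h' = x then 1 else 0) -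
      (if M.src h' = x then 1 else 0)) = 0) : M.IsWuCycle fun h h' => (w h h' : ℚ) where
  symm h h' := by rw [symm]
  disj h h' hne := disj h h' fun h0 => hne (by rw [h0, Int.cast_zero])
  flow h := by
    ext x
    have := congrArg (Int.cast : ℤ → ℚ) (flow h x)
    push_cast at this
    rw [bdry_apply]
    convert this using 3
    · unfold inc
      congr
    · rfl

/-- The symmetric cycle of `K₃,₃`. -/
def kuratowskiThreeThree (h h' : Fin 3 × Fin 3) : ℤ :=
  ![0, 1, -1] (h'.1 - h.1) * ![0, 1, -1] (h'.2 - h.2)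

theorem kuratowskiThreeThree_isWuCycle :
    completeThreeThree.IsWuCycle fun h h' => (kuratowskiThreeThree h h' : ℚ) :=
  isWuCycle_of_int _ (by decide) (by unfold completeThreeThree; decide)
    (by unfold completeThreeThree; decide)

/-- The sign of the difference of two numbers. -/
def sgnLt (a b : Fin 5) : ℤ := if a < b then 1 else if b < a then -1 else 0

/-- The symmetric cycle of `K₅`: the sign of the permutation that consists of the ends of the two
edges and of the fifth vertex. -/
def kuratowskiFive (h h' : {p : Fin 5 × Fin 5 // p.1 < p.2}) : ℤ :=
  let f := 0 - h.1.1 - h.1.2 - h'.1.1 - h'.1.2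
  sgnLt h.1.1 h'.1.1 * sgnLt h.1.1 h'.1.2 * sgnLt h.1.2 h'.1.1 * sgnLt h.1.2 h'.1.2 *
    (sgnLt h.1.1 f * sgnLt h.1.2 f * sgnLt h'.1.1 f * sgnLt h'.1.2 f)

set_option maxRecDepth 10000 in
theorem kuratowskiFive_isWuCycle :
    completeFive.IsWuCycle fun h h' => (kuratowskiFive h h' : ℚ) :=
  isWuCycle_of_int _ (by decide +kernel) (by unfold completeFive; decide +kernel)
    (by unfold completeFive; decide +kernel)

/-- The edges of `K₃,₃` disjoint from a given edge form a quadrilateral, and the signs orient it as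
a cycle. -/
theorem sum_kuratowskiThreeThree {N : Type*} [AddCommGroup N] [Module ℚ N]
    (f : Fin 3 × Fin 3 → N) : ∑ h, (kuratowskiThreeThree (0, 0) h : ℚ) • f h =
      f (1, 1) - f (1, 2) - f (2, 1) + f (2, 2) := by
  have h1 : ∀ h, kuratowskiThreeThree (0, 0) h = if h = (1, 1) ∨ h = (2, 2) then 1 else
      if h = (1, 2) ∨ h = (2, 1) then -1 else 0 := by decide
  simp only [h1, Fintype.sum_prod_type, Fin.sum_univ_three]
  simp
  abel

/-- The edges of `K₅` disjoint from the edge `01` form the triangle `2 → 3 → 4 → 2`. -/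
theorem sum_kuratowskiFive {N : Type*} [AddCommGroup N] [Module ℚ N]
    (f : {p : Fin 5 × Fin 5 // p.1 < p.2} → N) :
    ∑ h, (kuratowskiFive ⟨(0, 1), by decide⟩ h : ℚ) • f h =
      f ⟨(2, 3), by decide⟩ + f ⟨(3, 4), by decide⟩ - f ⟨(2, 4), by decide⟩ := by
  have h1 : ∀ h, kuratowskiFive ⟨(0, 1), by decide⟩ h =
      if h = ⟨(2, 3), by decide⟩ then 1 else if h = ⟨(3, 4), by decide⟩ then 1 else
        if h = ⟨(2, 4), by decide⟩ then -1 else 0 := by decide +kernel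
  have h2 : ∀ h, (kuratowskiFive ⟨(0, 1), by decide⟩ h : ℚ) • f h =
      (if h = ⟨(2, 3), by decide⟩ then f h else 0) + (if h = ⟨(3, 4), by decide⟩ then f h else 0) -
        (if h = ⟨(2, 4), by decide⟩ then f h else 0) := by
    intro h
    rw [h1]
    by_cases e1 : h = ⟨(2, 3), by decide⟩
    · subst e1; simp
    by_cases e2 : h = ⟨(3, 4), by decide⟩
    · subst e2; simp
    by_cases e3 : h = ⟨(2, 4), by decide⟩
    · subst e3; simp
    simp [e1, e2, e3]
  simp only [h2, Finset.sum_sub_distrib, Finset.sum_add_distrib]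
  simp

/-- The edges of `K₅`, one by one. -/
def fiveElim {motive : {p : Fin 5 × Fin 5 // p.1 < p.2} → Sort*}
    (h01 : motive ⟨(0, 1), by decide⟩) (h02 : motive ⟨(0, 2), by decide⟩)
    (h03 : motive ⟨(0, 3), by decide⟩) (h04 : motive ⟨(0, 4), by decide⟩)
    (h12 : motive ⟨(1, 2), by decide⟩) (h13 : motive ⟨(1, 3), by decide⟩)
    (h14 : motive ⟨(1, 4), by decide⟩) (h23 : motive ⟨(2, 3), by decide⟩)
    (h24 : motive ⟨(2, 4), by decide⟩) (h34 : motive ⟨(3, 4), by decide⟩) : ∀ h, motive h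
  | ⟨(0, 0), h⟩ => absurd h (by decide)
  | ⟨(0, 1), _⟩ => h01
  | ⟨(0, 2), _⟩ => h02
  | ⟨(0, 3), _⟩ => h03
  | ⟨(0, 4), _⟩ => h04
  | ⟨(1, 0), h⟩ => absurd h (by decide)
  | ⟨(1, 1), h⟩ => absurd h (by decide)
  | ⟨(1, 2), _⟩ => h12
  | ⟨(1, 3), _⟩ => h13
  | ⟨(1, 4), _⟩ => h14
  | ⟨(2, 0), h⟩ => absurd h (by decide)
  | ⟨(2, 1), h⟩ => absurd h (by decide)
  | ⟨(2, 2), h⟩ => absurd h (by decide)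
  | ⟨(2, 3), _⟩ => h23
  | ⟨(2, 4), _⟩ => h24
  | ⟨(3, 0), h⟩ => absurd h (by decide)
  | ⟨(3, 1), h⟩ => absurd h (by decide)
  | ⟨(3, 2), h⟩ => absurd h (by decide)
  | ⟨(3, 3), h⟩ => absurd h (by decide)
  | ⟨(3, 4), _⟩ => h34
  | ⟨(4, 0), h⟩ => absurd h (by decide)
  | ⟨(4, 1), h⟩ => absurd h (by decide)
  | ⟨(4, 2), h⟩ => absurd h (by decide)
  | ⟨(4, 3), h⟩ => absurd h (by decide)
  | ⟨(4, 4), h⟩ => absurd h (by decide)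

/-- The edges of `K₃,₃`, one by one. -/
def threeElim {motive : Fin 3 × Fin 3 → Sort*} (h00 : motive (0, 0)) (h01 : motive (0, 1))
    (h02 : motive (0, 2)) (h10 : motive (1, 0)) (h11 : motive (1, 1)) (h12 : motive (1, 2))
    (h20 : motive (2, 0)) (h21 : motive (2, 1)) (h22 : motive (2, 2)) : ∀ h, motive h
  | (0, 0) => h00
  | (0, 1) => h01
  | (0, 2) => h02
  | (1, 0) => h10
  | (1, 1) => h11
  | (1, 2) => h12
  | (2, 0) => h20
  | (2, 1) => h21
  | (2, 2) => h22

theorem injective_five {p q a b c : V} (hpq : p ≠ q) (hpa : p ≠ a) (hpb : p ≠ b) (hpc : p ≠ c)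
    (hqa : q ≠ a) (hqb : q ≠ b) (hqc : q ≠ c) (hab : a ≠ b) (hac : a ≠ c) (hbc : b ≠ c) :
    Function.Injective ![p, q, a, b, c] := by
  rw [← List.nodup_ofFn]
  simp [*]

theorem injective_elim {p q a b c d : V} (hpq : p ≠ q) (hpa : p ≠ a) (hpb : p ≠ b) (hpc : p ≠ c)
    (hpd : p ≠ d) (hqa : q ≠ a) (hqb : q ≠ b) (hqc : q ≠ c) (hqd : q ≠ d) (hab : a ≠ b)
    (hac : a ≠ c) (had : a ≠ d) (hbc : b ≠ c) (hbd : b ≠ d) (hcd : c ≠ d) :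
    Function.Injective (Sum.elim ![p, b, d] ![q, a, c]) := by
  refine Function.Injective.sumElim ?_ ?_ ?_
  · rw [← List.nodup_ofFn]
    simp [*]
  · rw [← List.nodup_ofFn]
    simp [*]
  · intro x y
    fin_cases x <;> fin_cases y <;> simp [*, Ne.symm, hab.symm, hqb.symm, hqd.symm,
      had.symm, hcd.symm]

/-! ### Subdivisions of `K₃,₃` and `K₅` with a path through `e` -/

variable [Fintype E] [DecidableEq E] {G : OrientedGraph V E} {A : Finset E} {e : E} {u v : V}

/-- A cycle on which vertices adjacent to the components of the two ends of `e` alternate. -/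
theorem mem_genAt_of_spiders (hA : G.SimpleOn A) (he : e ∈ A) (huv : s(G.src e, G.tgt e) = s(u, v))
    (C : Cyc (G.sg (A.erase e))) (hu : u ∉ C.verts) (hv : v ∉ C.verts)
    (hne : ¬ (off (G.sg (A.erase e)) C.verts).Reachable u v)
    {i j k l : ℕ} (hij : i < j) (hjk : j < k) (hkl : k < l) (hli : l < i + C.n)
    {y₁ y₂ z₁ z₂ : V} (hy₁ : (G.sg (A.erase e)).Adj y₁ (C.c i))
    (hz₁ : (G.sg (A.erase e)).Adj z₁ (C.c j)) (hy₂ : (G.sg (A.erase e)).Adj y₂ (C.c k))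
    (hz₂ : (G.sg (A.erase e)).Adj z₂ (C.c l))
    (L : Spider (off (G.sg (A.erase e)) C.verts) ![u, y₁, y₂])
    (R : Spider (off (G.sg (A.erase e)) C.verts) ![v, z₁, z₂]) :
    C.chain (G.dart A) ∈ G.genAt A e := by
  have hL : (off (G.sg (A.erase e)) C.verts).Reachable L.center u := ⟨L.leg 0⟩
  have hR : (off (G.sg (A.erase e)) C.verts).Reachable R.center v := ⟨R.leg 0⟩
  let w : Wheel (G.sg (A.erase e)) ![u, y₁, y₂] ![v, z₁, z₂] ![i, j, k, l] ![j, k, l, i + C.n] :=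
    ⟨C, L, R, notMem_of_reachable hL.symm hu, notMem_of_reachable hR.symm hv,
      fun h => hne (hL.symm.trans (h.trans hR)), i,
      by intro t; fin_cases t <;> simp <;> omega,
      by intro t; fin_cases t <;> simp <;> omega,
      by intro t t'; fin_cases t <;> fin_cases t' <;> simp <;> omega⟩
  have hn := C.three_le
  obtain ⟨p00, i00, e00, s00⟩ := w.exists_central hA he 0 0 huv
  obtain ⟨p01, i01, s01⟩ := w.exists_leg 1 (C.mem_verts i) hy₁
  obtain ⟨p02, i02, s02⟩ := w.exists_leg 2 (C.mem_verts k) hy₂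
  obtain ⟨p10, i10, s10⟩ := w.exists_leg' 1 (C.mem_verts j) hz₁
  obtain ⟨p20, i20, s20⟩ := w.exists_leg' 2 (C.mem_verts l) hz₂
  obtain ⟨p11, i11, s11, c11⟩ := w.exists_arc (c := C.c j) 0 rfl rfl hij.le
    (by change j < i + C.n; omega) rfl
  obtain ⟨p12, i12, s12, c12⟩ := w.exists_arc (c := C.c k) 1 rfl rfl hjk.le
    (by change k < j + C.n; omega) rfl
  obtain ⟨p22, i22, s22, c22⟩ := w.exists_arc (c := C.c l) 2 rfl rfl hkl.le
    (by change l < k + C.n; omega) rfl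
  obtain ⟨p21, i21, s21, c21⟩ := w.exists_arc (c := C.c i) 3 rfl rfl hli.le
    (by change i + C.n < l + C.n; omega) (C.per i)
  -- The center on the side of `u` is grouped with the attachments `C.c j`, `C.c l` of `v`, and the
  -- center on the side of `v` with the attachments `C.c i`, `C.c k` of `u`. Since the attachments
  -- alternate, the four arcs also join the two classes, and the nine paths make a `K₃,₃`.
  let φ : Fin 3 ⊕ Fin 3 → V :=
    Sum.elim ![L.center, C.c j, C.c l] ![R.center, C.c i, C.c k]
  let P : PathSystem (G.sg A) completeThreeThree := PathSystem.ofRegion φ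
    (threeElim (motive := fun h =>
        (G.sg A).Walk (φ (completeThreeThree.src h)) (φ (completeThreeThree.tgt h)))
      p00 p01 p02 p10.reverse p11.reverse p12 p20.reverse p21 p22.reverse)
    (threeElim i00 i01 i02 i10.reverse i11.reverse i12 i20.reverse i21 i22.reverse)
    (by
      have hc : ∀ s t, i ≤ s → s < i + C.n → i ≤ t → t < i + C.n → s ≠ t → C.c s ≠ C.c t :=
        fun s t h1 h2 h3 h4 hst h => hst (C.eq_of_c_eq h1 h2 h3 h4 h)
      have hLc : ∀ s, L.center ≠ C.c s := fun s h => w.hL (by rw [show w.L.center = C.c s from h]; exact C.mem_verts s)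
      have hRc : ∀ s, R.center ≠ C.c s := fun s h => w.hR (by rw [show w.R.center = C.c s from h]; exact C.mem_verts s)
      have hLR : L.center ≠ R.center := fun h => w.hLR (by
        rw [show w.L.center = w.R.center from h])
      exact injective_elim hLR (hLc i) (hLc j) (hLc k) (hLc l) (hRc i) (hRc j) (hRc k) (hRc l)
        (hc i j (by omega) (by omega) (by omega) (by omega) (by omega))
        (hc i k (by omega) (by omega) (by omega) (by omega) (by omega))
        (hc i l (by omega) (by omega) (by omega) (by omega) (by omega))
        (hc j k (by omega) (by omega) (by omega) (by omega) (by omega))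
        (hc j l (by omega) (by omega) (by omega) (by omega) (by omega))
        (hc k l (by omega) (by omega) (by omega) (by omega) (by omega)))
    -- To each region the edge of `K₃,₃` whose path contains it. The legs number `0` of both spiders
    -- belong to the central path through `e`.
    (Sum.elim ![(0, 0), (0, 1), (0, 2)] (Sum.elim ![(0, 0), (1, 0), (2, 0)]
      ![(1, 1), (1, 2), (2, 2), (2, 1)]))
    w.region w.region_excl
    (by
      have hnode : ∀ s, (s = i ∨ s = j ∨ s = k ∨ s = l) → ∀ r, ¬ w.region r (C.c s) := by
        intro s hs
        refine w.node_notMem_region (k := s) (by change i ≤ s; omega)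
          (by change s < i + C.n; omega) ?_
        intro t; fin_cases t <;> simp <;> omega
      intro r y
      match y with
      | .inl 0 => exact w.center_notMem_region r
      | .inl 1 => exact hnode j (by omega) r
      | .inl 2 => exact hnode l (by omega) r
      | .inr 0 => exact w.center_notMem_region' r
      | .inr 1 => exact hnode i (by omega) r
      | .inr 2 => exact hnode k (by omega) r)
    (by
      refine threeElim (fun x hx => ?_)
        (fun x hx => (s01 x hx).imp id (Or.imp id fun h => ⟨_, rfl, h⟩))
        (fun x hx => (s02 x hx).imp id (Or.imp id fun h => ⟨_, rfl, h⟩))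
        (fun x hx => or_left_comm.mp ((s10 x ?_).imp id (Or.imp id fun h => ⟨_, rfl, h⟩)))
        (fun x hx => or_left_comm.mp ((s11 x ?_).imp id (Or.imp id fun h => ⟨_, rfl, h⟩)))
        (fun x hx => (s12 x hx).imp id (Or.imp id fun h => ⟨_, rfl, h⟩))
        (fun x hx => or_left_comm.mp ((s20 x ?_).imp id (Or.imp id fun h => ⟨_, rfl, h⟩)))
        (fun x hx => (s21 x hx).imp id (Or.imp id fun h => ⟨_, rfl, h⟩))
        (fun x hx => or_left_comm.mp ((s22 x ?_).imp id (Or.imp id fun h => ⟨_, rfl, h⟩)))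
      · rcases s00 x hx with h | h | h | h
        · exact Or.inl h
        · exact Or.inr (Or.inl h)
        · exact Or.inr (Or.inr ⟨.inl 0, rfl, h⟩)
        · exact Or.inr (Or.inr ⟨.inr (.inl 0), rfl, h⟩)
      all_goals
        rw [← List.mem_reverse, ← SimpleGraph.Walk.support_reverse]
        exact hx)
  have e00' : s(G.src e, G.tgt e) ∈ (P.path (0, 0)).edges := e00
  have h1 := P.sum_wchain_mem_genAt hA (by unfold completeThreeThree; decide)
    (by unfold completeThreeThree; decide) kuratowskiThreeThree_isWuCycle
    (Or.inr (Or.inr (P.model _ _).isSubdivisionOf)) he (0, 0) e00'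
  rw [sum_kuratowskiThreeThree] at h1
  have r11 : wchain (G.dart A) p11.reverse = - wchain (G.dart A) p11 :=
    wchain_reverse _ (fun x y => hA.dart_swap) p11
  have r22 : wchain (G.dart A) p22.reverse = - wchain (G.dart A) p22 :=
    wchain_reverse _ (fun x y => hA.dart_swap) p22
  have q11 : wchain (G.dart A) (P.path (1, 1)) = - wchain (G.dart A) p11 := r11
  have q22 : wchain (G.dart A) (P.path (2, 2)) = - wchain (G.dart A) p22 := r22
  have q12 : wchain (G.dart A) (P.path (1, 2)) = wchain (G.dart A) p12 := rfl
  have q21 : wchain (G.dart A) (P.path (2, 1)) = wchain (G.dart A) p21 := rfl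
  rw [q11, q12, q21, q22, c11, c12, c21, c22] at h1
  have h2 : C.chain (G.dart A) = wchain (G.dart A) (C.arcTo i j hij.le rfl) +
      wchain (G.dart A) (C.arcTo j k hjk.le rfl) + wchain (G.dart A) (C.arcTo k l hkl.le rfl) +
      wchain (G.dart A) (C.arcTo l (i + C.n) hli.le (C.per i)) := by
    rw [Cyc.wchain_arcTo_add, Cyc.wchain_arcTo_add, Cyc.wchain_arcTo_add, Cyc.wchain_arcTo_self]
  -- With the chosen labels the quadrilateral opposite to `(0, 0)` runs around `C` in the negative
  -- direction.
  rw [h2, ← neg_mem_iff]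
  convert h1 using 1
  change _ = - wchain (G.dart A) (C.arcTo i j hij.le rfl) - wchain (G.dart A) (C.arcTo j k hjk.le rfl)
    - wchain (G.dart A) (C.arcTo l (i + C.n) hli.le (C.per i))
    + - wchain (G.dart A) (C.arcTo k l hkl.le rfl)
  abel

/-- A triangle on a cycle, and the ends of `e` joined to its three vertices. -/
theorem mem_genAt_of_four_legs (hA : G.SimpleOn A) (he : e ∈ A)
    (huv : s(G.src e, G.tgt e) = s(u, v))
    (C : Cyc (G.sg (A.erase e))) (hu : u ∉ C.verts) (hv : v ∉ C.verts)
    (hne : ¬ (off (G.sg (A.erase e)) C.verts).Reachable u v)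
    {i j k : ℕ} (hij : i < j) (hjk : j < k) (hki : k < i + C.n)
    {y₁ y₂ y₃ z₁ z₂ z₃ : V} (hy₁ : (G.sg (A.erase e)).Adj y₁ (C.c i))
    (hy₂ : (G.sg (A.erase e)).Adj y₂ (C.c j)) (hy₃ : (G.sg (A.erase e)).Adj y₃ (C.c k))
    (hz₁ : (G.sg (A.erase e)).Adj z₁ (C.c i)) (hz₂ : (G.sg (A.erase e)).Adj z₂ (C.c j))
    (hz₃ : (G.sg (A.erase e)).Adj z₃ (C.c k))
    (L : Spider (off (G.sg (A.erase e)) C.verts) ![u, y₁, y₂, y₃])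
    (R : Spider (off (G.sg (A.erase e)) C.verts) ![v, z₁, z₂, z₃]) :
    C.chain (G.dart A) ∈ G.genAt A e := by
  have hL : (off (G.sg (A.erase e)) C.verts).Reachable L.center u := ⟨L.leg 0⟩
  have hR : (off (G.sg (A.erase e)) C.verts).Reachable R.center v := ⟨R.leg 0⟩
  let w : Wheel (G.sg (A.erase e)) ![u, y₁, y₂, y₃] ![v, z₁, z₂, z₃] ![i, j, k]
      ![j, k, i + C.n] :=
    ⟨C, L, R, notMem_of_reachable hL.symm hu, notMem_of_reachable hR.symm hv,
      fun h => hne (hL.symm.trans (h.trans hR)), i,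
      by intro t; fin_cases t <;> simp <;> omega,
      by intro t; fin_cases t <;> simp <;> omega,
      by intro t t'; fin_cases t <;> fin_cases t' <;> simp <;> omega⟩
  have hn := C.three_le
  obtain ⟨p01, i01, e01, s01⟩ := w.exists_central hA he 0 0 huv
  obtain ⟨p02, i02, s02⟩ := w.exists_leg 1 (C.mem_verts i) hy₁
  obtain ⟨p03, i03, s03⟩ := w.exists_leg 2 (C.mem_verts j) hy₂
  obtain ⟨p04, i04, s04⟩ := w.exists_leg 3 (C.mem_verts k) hy₃
  obtain ⟨p12, i12, s12⟩ := w.exists_leg' 1 (C.mem_verts i) hz₁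
  obtain ⟨p13, i13, s13⟩ := w.exists_leg' 2 (C.mem_verts j) hz₂
  obtain ⟨p14, i14, s14⟩ := w.exists_leg' 3 (C.mem_verts k) hz₃
  obtain ⟨p23, i23, s23, c23⟩ := w.exists_arc (c := C.c j) 0 rfl rfl hij.le
    (by change j < i + C.n; omega) rfl
  obtain ⟨p34, i34, s34, c34⟩ := w.exists_arc (c := C.c k) 1 rfl rfl hjk.le
    (by change k < j + C.n; omega) rfl
  obtain ⟨p42, i42, s42, c42⟩ := w.exists_arc (c := C.c i) 2 rfl rfl hki.le
    (by change i + C.n < k + C.n; omega) (C.per i)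
  -- The vertices `0` and `1` of `K₅` are the two centers and `2`, `3`, `4` the common attachments,
  -- so the triangle opposite to the edge `01` is `C`. The last arc is reversed because the edges of
  -- `K₅` point to the larger number.
  let φ : Fin 5 → V := ![L.center, R.center, C.c i, C.c j, C.c k]
  let P : PathSystem (G.sg A) completeFive := PathSystem.ofRegion φ
    (fiveElim (motive := fun h => (G.sg A).Walk (φ (completeFive.src h)) (φ (completeFive.tgt h)))
      p01 p02 p03 p04 p12 p13 p14 p23 p42.reverse p34)
    (fiveElim i01 i02 i03 i04 i12 i13 i14 i23 i42.reverse i34)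
    (by
      have hc : ∀ s t, i ≤ s → s < i + C.n → i ≤ t → t < i + C.n → s ≠ t → C.c s ≠ C.c t :=
        fun s t h1 h2 h3 h4 hst h => hst (C.eq_of_c_eq h1 h2 h3 h4 h)
      have hLc : ∀ s, L.center ≠ C.c s := fun s h => w.hL (by
        rw [show w.L.center = C.c s from h]; exact C.mem_verts s)
      have hRc : ∀ s, R.center ≠ C.c s := fun s h => w.hR (by
        rw [show w.R.center = C.c s from h]; exact C.mem_verts s)
      have hLR : L.center ≠ R.center := fun h => w.hLR (by
        rw [show w.L.center = w.R.center from h])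
      exact injective_five hLR (hLc i) (hLc j) (hLc k) (hRc i) (hRc j) (hRc k)
        (hc i j (by omega) (by omega) (by omega) (by omega) (by omega))
        (hc i k (by omega) (by omega) (by omega) (by omega) (by omega))
        (hc j k (by omega) (by omega) (by omega) (by omega) (by omega)))
    (Sum.elim ![⟨(0, 1), by decide⟩, ⟨(0, 2), by decide⟩, ⟨(0, 3), by decide⟩, ⟨(0, 4), by decide⟩]
      (Sum.elim ![⟨(0, 1), by decide⟩, ⟨(1, 2), by decide⟩, ⟨(1, 3), by decide⟩,
        ⟨(1, 4), by decide⟩]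
      ![⟨(2, 3), by decide⟩, ⟨(3, 4), by decide⟩, ⟨(2, 4), by decide⟩]))
    w.region w.region_excl
    (by
      have hnode : ∀ s, (s = i ∨ s = j ∨ s = k) → ∀ r, ¬ w.region r (C.c s) := by
        intro s hs
        refine w.node_notMem_region (k := s) (by change i ≤ s; omega)
          (by change s < i + C.n; omega) ?_
        intro t; fin_cases t <;> simp <;> omega
      intro r y
      match y with
      | 0 => exact w.center_notMem_region r
      | 1 => exact w.center_notMem_region' r
      | 2 => exact hnode i (by omega) r
      | 3 => exact hnode j (by omega) r
      | 4 => exact hnode k (by omega) r)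
    (by
      refine fiveElim (fun x hx => ?_)
        (fun x hx => (s02 x hx).imp id (Or.imp id fun h => ⟨_, rfl, h⟩))
        (fun x hx => (s03 x hx).imp id (Or.imp id fun h => ⟨_, rfl, h⟩))
        (fun x hx => (s04 x hx).imp id (Or.imp id fun h => ⟨_, rfl, h⟩))
        (fun x hx => (s12 x hx).imp id (Or.imp id fun h => ⟨_, rfl, h⟩))
        (fun x hx => (s13 x hx).imp id (Or.imp id fun h => ⟨_, rfl, h⟩))
        (fun x hx => (s14 x hx).imp id (Or.imp id fun h => ⟨_, rfl, h⟩))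
        (fun x hx => (s23 x hx).imp id (Or.imp id fun h => ⟨_, rfl, h⟩))
        (fun x hx => or_left_comm.mp ((s42 x ?_).imp id (Or.imp id fun h => ⟨_, rfl, h⟩)))
        (fun x hx => (s34 x hx).imp id (Or.imp id fun h => ⟨_, rfl, h⟩))
      · rcases s01 x hx with h | h | h | h
        · exact Or.inl h
        · exact Or.inr (Or.inl h)
        · exact Or.inr (Or.inr ⟨.inl 0, rfl, h⟩)
        · exact Or.inr (Or.inr ⟨.inr (.inl 0), rfl, h⟩)
      · rw [← List.mem_reverse, ← SimpleGraph.Walk.support_reverse]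
        exact hx)
  have e01' : s(G.src e, G.tgt e) ∈ (P.path ⟨(0, 1), by decide⟩).edges := e01
  have h1 := P.sum_wchain_mem_genAt hA (by unfold completeFive; decide)
    (by unfold completeFive; decide) kuratowskiFive_isWuCycle
    (Or.inr (Or.inl (P.model _ _).isSubdivisionOf)) he ⟨(0, 1), by decide⟩ e01'
  have r42 : wchain (G.dart A) p42.reverse = - wchain (G.dart A) p42 :=
    wchain_reverse _ (fun x y => hA.dart_swap) p42
  rw [sum_kuratowskiFive] at h1
  have q42 : wchain (G.dart A) (P.path ⟨(2, 4), by decide⟩) = - wchain (G.dart A) p42 := r42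
  have q23 : wchain (G.dart A) (P.path ⟨(2, 3), by decide⟩) = wchain (G.dart A) p23 := rfl
  have q34 : wchain (G.dart A) (P.path ⟨(3, 4), by decide⟩) = wchain (G.dart A) p34 := rfl
  rw [q42, q23, q34, c42, c23, c34, sub_neg_eq_add] at h1
  have h2 : C.chain (G.dart A) = wchain (G.dart A) (C.arcTo i j hij.le rfl) +
      wchain (G.dart A) (C.arcTo j k hjk.le rfl) +
      wchain (G.dart A) (C.arcTo k (i + C.n) hki.le (C.per i)) := by
    rw [Cyc.wchain_arcTo_add, Cyc.wchain_arcTo_add, Cyc.wchain_arcTo_self]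
  rw [h2]
  exact h1

end Kuratowski

end OrientedGraph

namespace OrientedGraph

/-! ### Attachments to a cycle, and paths across a separation -/

section Ends

variable {V E : Type*}

theorem reachable_off {S : SimpleGraph V} {X : Set V} {x y : V} (p : S.Walk x y)
    (h : ∀ z ∈ p.support, z ∉ X) : (off S X).Reachable x y := by
  induction p with
  | nil => rfl
  | cons a p ih =>
    have h1 : (off S X).Adj _ _ := ⟨a, h _ (by simp), h _ (by simp)⟩
    exact h1.reachable.trans (ih fun z hz => h z (by simp [hz]))

theorem Att.exists_walk {S : SimpleGraph V} {X : Set V} {x c : V} (h : Att S X x c) :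
    ∃ p : S.Walk x c, ∀ z ∈ p.support, (off S X).Reachable x z ∨ z = c := by
  obtain ⟨-, y, ⟨p⟩, hy⟩ := h
  refine ⟨(p.mapLe (off_le S X)).concat hy, fun z hz => ?_⟩
  rw [SimpleGraph.Walk.support_concat, List.mem_append, List.mem_singleton] at hz
  exact hz.imp (fun h => reachable_of_mem_support p (by simpa using h)) id

/-- The edges of a cycle. -/
def Cyc.edges {G : OrientedGraph V E} {H : Finset E} (C : Cyc (G.sg H)) : Set E :=
  {b | b ∈ H ∧ ∃ k, s(G.src b, G.tgt b) = s(C.c k, C.c (k + 1))}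

theorem Cyc.exists_edge {G : OrientedGraph V E} {H : Finset E} (C : Cyc (G.sg H)) (k : ℕ) :
    ∃ b ∈ H, s(G.src b, G.tgt b) = s(C.c k, C.c (k + 1)) := (C.adj k).2

/-- No separation of order two of the ends `u` and `v` splits the cycle. -/
def Unsplit [DecidableEq E] [Fintype E] [Fintype V] (G : OrientedGraph V E) (H : Finset E) (u v : V)
    (C : Cyc (G.sg H)) : Prop :=
  ∀ F, IsSep G H u v F → (∀ b ∈ F, b ∉ C.edges) ∨ ∀ b ∈ C.edges, b ∈ F

theorem Unsplit.swap [DecidableEq E] [Fintype E] [Fintype V] {G : OrientedGraph V E} {H : Finset E} {u v : V}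
    {C : Cyc (G.sg H)} (h : Unsplit G H u v C) : Unsplit G H v u C := by
  intro F hF
  have hsub := hF.sub
  rcases h _ hF.swap with h1 | h1
  · right
    intro b hb
    by_contra hbF
    exact h1 b (Finset.mem_sdiff.mpr ⟨hb.1, hbF⟩) hb
  · left
    intro b hb hbC
    exact (Finset.mem_sdiff.mp (h1 b hbC)).2 hb

section Crossing

variable [DecidableEq E] [Fintype E] [Fintype V] {G : OrientedGraph V E} {H F : Finset E}

theorem isEnd_left {b : E} {x y : V} (h : s(G.src b, G.tgt b) = s(x, y)) : G.IsEnd b x :=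
  (isEnd_iff_of_joins h x).mpr (Or.inl rfl)

theorem isEnd_right {b : E} {x y : V} (h : s(G.src b, G.tgt b) = s(x, y)) : G.IsEnd b y :=
  (isEnd_iff_of_joins h y).mpr (Or.inr rfl)

/-- The first step of the walk that uses an edge of `F` starts at a vertex that also meets an edge
outside `F`. If there is no such step, the end of the walk serves. -/
theorem exists_mem_sepBdry {x y : V} (p : (G.sg H).Walk x y)
    (hx : ∃ b ∈ H, b ∉ F ∧ G.IsEnd b x) (hy : ∃ b ∈ F, G.IsEnd b y) :
    ∃ z ∈ p.support, z ∈ G.sepBdry H F := by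
  induction p with
  | nil => exact ⟨_, by simp, mem_sepBdry.mpr ⟨hy, hx⟩⟩
  | cons h p ih =>
    obtain ⟨-, b, hb, hxy⟩ := h
    by_cases hbF : b ∈ F
    · exact ⟨_, by simp, mem_sepBdry.mpr ⟨⟨b, hbF, isEnd_left hxy⟩, hx⟩⟩
    · obtain ⟨z, hz, hz'⟩ := ih ⟨b, hb, hbF, isEnd_right hxy⟩ hy
      exact ⟨z, List.mem_cons_of_mem _ hz, hz'⟩

theorem exists_mem_sepBdry_of_forall {x y : V} (p : (G.sg H).Walk x y)
    (hx : ∀ b ∈ F, ¬ G.IsEnd b x) (hy : ∃ b ∈ F, G.IsEnd b y) :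
    ∃ z ∈ p.support, z ∈ G.sepBdry H F := by
  refine exists_mem_sepBdry p ?_ hy
  cases p with
  | nil =>
    obtain ⟨b, hb, h⟩ := hy
    exact absurd h (hx b hb)
  | cons h p =>
    obtain ⟨-, b, hb, hxy⟩ := h
    exact ⟨b, hb, fun hbF => hx b hbF (isEnd_left hxy), isEnd_left hxy⟩

/-- If a path with both ends on a side of a separation does not stay there, it contains the
vertices of the separation. -/
theorem mem_support_of_mem_sepBdry {x y : V} (p : (G.sg H).Walk x y) (hp : p.IsPath)
    (hx : ∃ b ∈ F, G.IsEnd b x) (hy : ∃ b ∈ F, G.IsEnd b y) {b : E} (hb : b ∈ H) (hbF : b ∉ F)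
    (hbp : s(G.src b, G.tgt b) ∈ p.edges) (hcard : (G.sepBdry H F).card ≤ 2) :
    ∀ z ∈ G.sepBdry H F, z ∈ p.support := by
  classical
  obtain ⟨i, hi, h1⟩ : ∃ i, ∃ hi : i < p.length,
      s(G.src b, G.tgt b) = s(p.getVert i, p.getVert (i + 1)) := by
    obtain ⟨i, hi, h1⟩ := List.getElem_of_mem hbp
    refine ⟨i, by simpa using hi, ?_⟩
    rw [← h1, SimpleGraph.Walk.getElem_edges]
  -- The edge `b` lies outside `F`, so both pieces into which it cuts the path meet the boundary.
  -- The two vertices found are different because `p` is a path, and by cardinality they exhaust the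
  -- boundary.
  obtain ⟨z₁, hz₁, hb₁⟩ := exists_mem_sepBdry (p.take i).reverse ⟨b, hb, hbF, isEnd_left h1⟩ hx
  obtain ⟨z₂, hz₂, hb₂⟩ := exists_mem_sepBdry (p.drop (i + 1)) ⟨b, hb, hbF, isEnd_right h1⟩ hy
  rw [SimpleGraph.Walk.support_reverse, List.mem_reverse,
    SimpleGraph.Walk.mem_support_iff_exists_getVert] at hz₁
  rw [SimpleGraph.Walk.mem_support_iff_exists_getVert] at hz₂
  obtain ⟨s, rfl, hs⟩ := hz₁
  obtain ⟨t, rfl, ht⟩ := hz₂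
  rw [SimpleGraph.Walk.take_length] at hs
  rw [SimpleGraph.Walk.drop_length] at ht
  rw [SimpleGraph.Walk.take_getVert] at hb₁
  rw [SimpleGraph.Walk.drop_getVert] at hb₂
  have hne : p.getVert (i ⊓ s) ≠ p.getVert (i + 1 + t) := by
    intro h
    have := hp.getVert_injOn (show i ⊓ s ≤ p.length by omega)
      (show i + 1 + t ≤ p.length by omega) h
    omega
  intro z hz
  by_contra hzp
  have h3 : ({z, p.getVert (i ⊓ s), p.getVert (i + 1 + t)} : Finset V) ⊆ G.sepBdry H F := by
    intro w hw
    simp only [Finset.mem_insert, Finset.mem_singleton] at hw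
    rcases hw with rfl | rfl | rfl <;> assumption
  have h4 := (Finset.card_le_card h3).trans hcard
  have n₁ : z ≠ p.getVert (i ⊓ s) := fun h => hzp (by rw [h]; exact p.getVert_mem_support _)
  have n₂ : z ≠ p.getVert (i + 1 + t) := fun h => hzp (by rw [h]; exact p.getVert_mem_support _)
  rw [Finset.card_eq_three.mpr ⟨_, _, _, n₁, n₂, hne, rfl⟩] at h4
  omega

end Crossing

/-! ### Unsplit cycles that avoid the ends of `e` -/

/-- A set of edges without loops and multiple edges, and one of them with ends `u` and `v`. -/
structure Ends (G : OrientedGraph V E) (A : Finset E) (e : E) (u v : V) : Prop where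
  simple : G.SimpleOn A
  mem : e ∈ A
  joins : s(G.src e, G.tgt e) = s(u, v)

namespace Ends

variable [DecidableEq E] {G : OrientedGraph V E} {A : Finset E} {e : E} {u v : V}

theorem swap (h : G.Ends A e u v) : G.Ends A e v u := ⟨h.simple, h.mem, h.joins.trans Sym2.eq_swap⟩

variable [Fintype E]

/-- A path from `u` to `v` off `C`, closed up by `e`, is a circuit disjoint from `C`: this is the
case of `2K₃`. -/
theorem mem_of_reachable (h : G.Ends A e u v) (C : Cyc (G.sg (A.erase e))) (hu : u ∉ C.verts)
    (huv : (off (G.sg (A.erase e)) C.verts).Reachable u v) :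
    C.chain (G.dart A) ∈ G.genAt A e := by
  classical
  have hn := C.three_le
  choose b hb hbe using C.exists_edge
  let D : Circuit G := ⟨C.n, C.c, b, by omega, by simpa using C.per 0, fun i _ => hbe i,
    fun i hi j hj hij => C.eq_of_c_eq (i := 0) (by omega) (by omega) (by omega) (by omega) hij,
    fun i hi j hj hij => by
      have h1 := (hbe i).symm.trans (hij ▸ hbe j)
      rw [Sym2.eq_iff] at h1
      rcases h1 with h1 | h1
      · exact C.eq_of_c_eq (i := 0) (by omega) (by omega) (by omega) (by omega) h1.1
      · by_contra hne
        have key : ∀ r s, r < s → s < C.n → C.c r = C.c (s + 1) → C.c (r + 1) = C.c s → False := by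
          intro r s hrs hs e1 e2
          have := C.eq_of_c_eq (i := 0) (by omega) (by omega) (by omega) (by omega) e2
          subst this
          exact C.inj r (r + 1 + 1) (by omega) (by omega) e1
        rcases lt_or_gt_of_ne hne with h2 | h2
        · exact key i j h2 hj h1.1 h1.2
        · exact key j i h2 hi h1.2.symm h1.1.symm⟩
  have hD : D.chain = C.chain (G.dart A) := by
    rw [Circuit.chain, Cyc.chain, Cyc.wchain_arc]
    refine Finset.sum_congr rfl fun i _ => ?_
    rw [zero_add, h.simple.dart_eq (Finset.mem_of_mem_erase (hb i)) (hbe i)]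
  rw [← hD]
  obtain ⟨p⟩ := huv
  have hp := notMem_of_mem_support p hu
  have hj := h.joins
  rw [Sym2.eq_iff] at hj
  rcases hj with ⟨h1, h2⟩ | ⟨h1, h2⟩
  · subst h1 h2
    refine D.chain_mem_genAt_of_walk h.mem (fun i _ => Finset.mem_of_mem_erase (hb i))
      (p.mapLe (off_le _ _)) fun i _ h' => hp _ (by simpa using h') (C.mem_verts i)
  · subst h1 h2
    refine D.chain_mem_genAt_of_walk h.mem (fun i _ => Finset.mem_of_mem_erase (hb i))
      (p.mapLe (off_le _ _)).reverse fun i _ h' => hp _ (by simpa using h') (C.mem_verts i)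

/-- If `u` and `v` are not connected off `C`, each of them spans a spider with its two attachments
inside its own component, and the alternation makes a `K₃,₃`. -/
theorem mem_of_alternate (h : G.Ends A e u v) (C : Cyc (G.sg (A.erase e))) (hu : u ∉ C.verts)
    (hv : v ∉ C.verts) {i j k l : ℕ} (hij : i < j) (hjk : j < k) (hkl : k < l) (hli : l < i + C.n)
    (hi : Att (G.sg (A.erase e)) C.verts u (C.c i)) (hj : Att (G.sg (A.erase e)) C.verts v (C.c j))
    (hk : Att (G.sg (A.erase e)) C.verts u (C.c k))
    (hl : Att (G.sg (A.erase e)) C.verts v (C.c l)) : C.chain (G.dart A) ∈ G.genAt A e := by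
  by_cases huv : (off (G.sg (A.erase e)) C.verts).Reachable u v
  · exact h.mem_of_reachable C hu huv
  obtain ⟨-, y₁, hy₁, ha₁⟩ := hi
  obtain ⟨-, y₂, hy₂, ha₂⟩ := hk
  obtain ⟨-, z₁, hz₁, hb₁⟩ := hj
  obtain ⟨-, z₂, hz₂, hb₂⟩ := hl
  obtain ⟨L⟩ := Spider.exists_three (hy₁.symm.trans hy₂) hy₁
  obtain ⟨R⟩ := Spider.exists_three (hz₁.symm.trans hz₂) hz₁
  exact mem_genAt_of_spiders h.simple h.mem h.joins C hu hv huv hij hjk hkl hli ha₁ hb₁ ha₂ hb₂ L R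

variable [Fintype V]

/-- The component of `u` is adjacent to at least two vertices of an unsplit cycle. -/
theorem exists_att_ne (C : Cyc (G.sg (A.erase e))) (hu : u ∉ C.verts) (hv : v ∉ C.verts)
    (huv : ¬ (off (G.sg (A.erase e)) C.verts).Reachable u v)
    (hC : Unsplit G (A.erase e) u v C) (k : ℕ) :
    ∃ c, c ≠ C.c k ∧ Att (G.sg (A.erase e)) C.verts u c := by
  classical
  by_contra! hcon
  generalize A.erase e = H at *
  have hn := C.three_le
  obtain ⟨b₀, hb₀, hj₀⟩ := C.exists_edge k
  obtain ⟨b₁, hb₁, hj₁⟩ := C.exists_edge (k + 1)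
  -- the edges that meet the component of `u`
  let X : V → Prop := fun x => (off (G.sg H) C.verts).Reachable u x
  have hX : ∀ x, X x → x ∉ C.verts := fun x hx => notMem_of_reachable hx hu
  -- If `C.c k` were the only possible attachment, the edges that meet the component of `u` would
  -- leave it only there. The cycle edge `b₀` is added so that this separation, whose boundary is
  -- contained in the two ends of `b₀`, splits `C`: it contains `b₀` but not the next edge `b₁`.
  let F : Finset E := {b ∈ H | b = b₀ ∨ ∃ x, G.IsEnd b x ∧ X x}
  have hF : ∀ b, b ∈ F ↔ b ∈ H ∧ (b = b₀ ∨ ∃ x, G.IsEnd b x ∧ X x) := fun b => by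
    simp [F]
  have hcyc : ∀ b t, s(G.src b, G.tgt b) = s(C.c t, C.c (t + 1)) → ¬ ∃ x, G.IsEnd b x ∧ X x := by
    rintro b t ht ⟨x, hx, hx'⟩
    rcases (isEnd_iff_of_joins ht x).mp hx with rfl | rfl <;> exact hX _ hx' (C.mem_verts _)
  have hout : ∀ b ∈ H, ∀ x y, s(G.src b, G.tgt b) = s(x, y) → X x → X y ∨ y = C.c k := by
    intro b hb x y hxy hx
    by_cases hyC : y ∈ C.verts
    · right
      by_contra hne
      by_cases hxy' : x = y
      · exact hX x hx (hxy' ▸ hyC)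
      · exact hcon y hne ⟨hyC, x, hx, hxy', b, hb, hxy⟩
    · left
      by_cases hxy' : x = y
      · exact hxy' ▸ hx
      · have : (off (G.sg H) C.verts).Adj x y := ⟨⟨hxy', b, hb, hxy⟩, hX x hx, hyC⟩
        exact hx.trans this.reachable
  have hend : ∀ b ∈ H, (∃ x, G.IsEnd b x ∧ X x) → ∀ y, G.IsEnd b y → X y ∨ y = C.c k := by
    rintro b hb ⟨x, hx, hx'⟩ y hy
    obtain ⟨z, hz⟩ := exists_joins hx
    rcases (isEnd_iff_of_joins hz y).mp hy with rfl | rfl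
    · exact Or.inl hx'
    · exact hout b hb x y hz hx'
  have hsep : IsSep G H u v F := by
    refine ⟨Finset.filter_subset _ _, fun b hb hbF hbu => ?_, fun b hb hbv => ?_, ?_⟩
    · exact hbF ((hF b).mpr ⟨hb, Or.inr ⟨u, hbu, .rfl⟩⟩)
    · rcases ((hF b).mp hb).2 with rfl | h1
      · rcases (isEnd_iff_of_joins hj₀ v).mp hbv with rfl | rfl <;> exact hv (C.mem_verts _)
      · rcases hend b ((hF b).mp hb).1 h1 v hbv with h2 | rfl
        · exact huv h2
        · exact hv (C.mem_verts _)
    · refine (Finset.card_le_card (t := {C.c k, C.c (k + 1)}) ?_).trans Finset.card_le_two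
      intro x hx
      obtain ⟨⟨b, hb, hbx⟩, c, hc, hcF, hcx⟩ := mem_sepBdry.mp hx
      rw [Finset.mem_insert, Finset.mem_singleton]
      rcases ((hF b).mp hb).2 with rfl | h1
      · exact (isEnd_iff_of_joins hj₀ x).mp hbx
      · rcases hend b ((hF b).mp hb).1 h1 x hbx with h2 | h2
        · exact absurd ((hF c).mpr ⟨hc, Or.inr ⟨x, hcx, h2⟩⟩) hcF
        · exact Or.inl h2
  rcases hC F hsep with h1 | h1
  · exact h1 b₀ ((hF b₀).mpr ⟨hb₀, Or.inl rfl⟩) ⟨hb₀, k, hj₀⟩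
  · rcases ((hF b₁).mp (h1 b₁ ⟨hb₁, k + 1, hj₁⟩)).2 with h2 | h2
    · rw [h2, hj₀, Sym2.eq_iff] at hj₁
      rcases hj₁ with h3 | h3
      · exact C.inj k (k + 1) (by omega) (by omega) h3.1
      · exact C.inj k (k + 1 + 1) (by omega) (by omega) h3.1
    · exact hcyc b₁ (k + 1) hj₁ h2

/-- A path that divides an unsplit cycle between vertices adjacent to the component of `u`. -/
theorem mem_of_path (h : G.Ends A e u v) (C : Cyc (G.sg (A.erase e))) (hu : u ∉ C.verts)
    (hv : v ∉ C.verts) (huv : ¬ (off (G.sg (A.erase e)) C.verts).Reachable u v)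
    (hC : Unsplit G (A.erase e) u v C)
    (ih : ∀ D : Cyc (G.sg (A.erase e)), u ∉ D.verts → v ∉ D.verts →
      Unsplit G (A.erase e) u v D → {x | (off (G.sg (A.erase e)) C.verts).Reachable u x} <
        {x | (off (G.sg (A.erase e)) D.verts).Reachable u x} → D.chain (G.dart A) ∈ G.genAt A e)
    {k i l j : ℕ} (hki : k < i) (hil : i < l) (hlj : l < j) (hjk : j < k + C.n)
    (hi : Att (G.sg (A.erase e)) C.verts u (C.c i)) (hj : Att (G.sg (A.erase e)) C.verts u (C.c j))
    (p : (G.sg (A.erase e)).Walk (C.c k) (C.c l)) (hp : p.IsPath)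
    (hpC : ∀ x ∈ p.support, x ∈ C.verts → x = C.c k ∨ x = C.c l)
    (hpu : ∀ x ∈ p.support, ¬ (off (G.sg (A.erase e)) C.verts).Reachable u x)
    (hpv : ∀ x ∈ p.support, ¬ (off (G.sg (A.erase e)) C.verts).Reachable v x) :
    C.chain (G.dart A) ∈ G.genAt A e := by
  classical
  by_contra hcon
  -- If the cycle lies in `F` and `p` does not, then `p` passes through all vertices of the boundary
  -- of `F`. A walk from `v'` to an attachment `c` inside its component crosses this boundary. As
  -- the component avoids `p`, the crossing is `c` itself, which lies on both `p` and `C`.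
  have core : ∀ (u' v' : V) (F : Finset E), IsSep G (A.erase e) u' v' F → (∀ b ∈ C.edges, b ∈ F) →
      (∀ x ∈ p.support, ¬ (off (G.sg (A.erase e)) C.verts).Reachable v' x) →
      (∃ b ∈ (A.erase e), b ∉ F ∧ s(G.src b, G.tgt b) ∈ p.edges) →
      ∀ c, Att (G.sg (A.erase e)) C.verts v' c → c = C.c k ∨ c = C.c l := by
    rintro u' v' F hF hCF hpv' ⟨b, hb, hbF, hbp⟩ c hc
    have htouch : ∀ t, ∃ b ∈ F, G.IsEnd b (C.c t) := fun t => by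
      obtain ⟨b, hb, hj⟩ := C.exists_edge t
      exact ⟨b, hCF b ⟨hb, t, hj⟩, isEnd_left hj⟩
    obtain ⟨t, rfl⟩ := hc.1
    obtain ⟨q, hq⟩ := hc.exists_walk
    obtain ⟨z, hz, hz'⟩ := exists_mem_sepBdry_of_forall q hF.right (htouch t)
    have hzp := mem_support_of_mem_sepBdry p hp (htouch k) (htouch l) hb hbF hbp hF.card z hz'
    rcases hq z hz with h1 | rfl
    · exact absurd h1 (hpv' z hzp)
    · exact hpC _ hzp (C.mem_verts t)
  -- The induction hypothesis applies to each of the two cycles into which `p` divides `C`. From `u`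
  -- every vertex remains reachable, and the attachment `c` that the new cycle misses is gained.
  have half : ∀ D : Cyc (G.sg (A.erase e)), (∀ x ∈ D.verts, x ∈ C.verts ∨ x ∈ p.support) →
      (∀ r, s(D.c r, D.c (r + 1)) ∈ p.edges ∨ ∃ t, s(D.c r, D.c (r + 1)) = s(C.c t, C.c (t + 1))) →
      (∃ c, c ∉ D.verts ∧ Att (G.sg (A.erase e)) C.verts u c) → D.chain (G.dart A) ∈ G.genAt A e := by
    rintro D hDv hDe ⟨c, hcD, hc⟩
    have huD : u ∉ D.verts := fun h1 => (hDv u h1).elim hu fun h2 => hpu u h2 .rfl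
    have hvD : v ∉ D.verts := fun h1 => (hDv v h1).elim hv fun h2 => hpv v h2 .rfl
    have hreach : ∀ x, (off (G.sg (A.erase e)) C.verts).Reachable u x →
        (off (G.sg (A.erase e)) D.verts).Reachable u x := by
      rintro x ⟨q⟩
      refine reachable_off (q.mapLe (off_le _ _)) fun z hz hzD => ?_
      have hz : z ∈ q.support := by simpa using hz
      rcases hDv z hzD with h1 | h1
      · exact notMem_of_mem_support q hu z hz h1
      · exact hpu z h1 (reachable_of_mem_support q hz)
    refine ih D huD hvD ?_ ((Set.ssubset_iff_of_subset fun x hx => hreach x hx).mpr ⟨c, ?_, ?_⟩)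
    · have hDC : ∀ b ∈ D.edges, s(G.src b, G.tgt b) ∈ p.edges ∨ b ∈ C.edges := by
        rintro b ⟨hb, r, hr⟩
        rcases hDe r with h1 | ⟨t, h1⟩
        · exact Or.inl (hr ▸ h1)
        · exact Or.inr ⟨hb, t, hr.trans h1⟩
      intro F hF
      by_contra! hsplit
      obtain ⟨⟨b₁, hb₁, hb₁D⟩, b₂, hb₂D, hb₂⟩ := hsplit
      -- If `C` avoids `F`, the complement of `F` confines the attachments of `u` to the ends of
      -- `p`, contrary to `hi`. If `C` lies in `F`, those of `v` are confined to the ends of `p`.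
      -- Having at least two attachments, `v` has both, and they alternate with `C.c i` and `C.c j`.
      rcases hC F hF with h1 | h1
      · have h2 := core v u ((A.erase e) \ F) hF.swap
          (fun b hb => Finset.mem_sdiff.mpr ⟨hb.1, fun hbF => h1 b hbF hb⟩) hpu
          ⟨b₁, hb₁D.1, fun h => (Finset.mem_sdiff.mp h).2 hb₁, (hDC b₁ hb₁D).resolve_right (h1 b₁ hb₁)⟩
          _ hi
        rcases h2 with h2 | h2
        · exact C.inj k i hki (by omega) h2.symm
        · exact C.inj i l hil (by omega) h2
      · have h2 := core u v F hF h1 hpv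
          ⟨b₂, hb₂D.1, hb₂, (hDC b₂ hb₂D).resolve_right fun h => hb₂ (h1 b₂ h)⟩
        have h3 := exists_att_ne C hv hu (fun h => huv h.symm) hC.swap
        obtain ⟨x, hx, hx'⟩ := h3 k
        obtain ⟨y, hy, hy'⟩ := h3 l
        rw [(h2 x hx').resolve_left hx] at hx'
        rw [(h2 y hy').resolve_right hy, ← C.per] at hy'
        exact hcon (h.mem_of_alternate C hu hv hil hlj hjk (by omega) hi hx' hj hy')
    · obtain ⟨hcC, y, hy, hyc⟩ := hc
      have : (off (G.sg (A.erase e)) D.verts).Adj y c := ⟨hyc, notMem_of_reachable (hreach y hy) huD, hcD⟩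
      exact (hreach y hy).trans this.reachable
    · exact fun h1 => notMem_of_reachable h1 hu hc.1
  have hn := C.three_le
  have hper : C.c (k + C.n) = C.c k := C.per k
  have hkl : C.c k ≠ C.c l := C.inj k l (by omega) (by omega)
  have hplen : 0 < p.length := by
    by_contra h0
    exact hkl (SimpleGraph.Walk.eq_of_length_eq_zero (p := p) (by omega))
  set q₁ := C.arcTo k l (by omega) rfl with hq₁
  set q₂ := C.arcTo l (k + C.n) (by omega) hper with hq₂
  have s₁ : ∀ x, x ∈ q₁.support ↔ ∃ t, k ≤ t ∧ t ≤ l ∧ x = C.c t := fun x => C.mem_support_arcTo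
  have s₂ : ∀ x, x ∈ q₂.support ↔ ∃ t, l ≤ t ∧ t ≤ k + C.n ∧ x = C.c t :=
    fun x => C.mem_support_arcTo
  have hv₁ : ∀ x ∈ q₁.support, x ∈ C.verts := fun x hx => by
    obtain ⟨t, -, -, rfl⟩ := (s₁ x).mp hx
    exact C.mem_verts t
  have hv₂ : ∀ x ∈ q₂.support, x ∈ C.verts := fun x hx => by
    obtain ⟨t, -, -, rfl⟩ := (s₂ x).mp hx
    exact C.mem_verts t
  -- `D₁` misses the attachment `C.c i` and `D₂` misses `C.c j`. Their chains add up to that of `C`,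
  -- since `p` is traversed once in each direction.
  obtain ⟨D₁, hD₁v, hD₁e, -, hD₁⟩ := Cyc.exists_of_paths p q₂ hp
    (C.isPath_arcTo _ _ (by omega)) (fun z hz hz' => hpC z hz (hv₂ z hz')) hkl
    (by rw [C.length_arcTo]; omega)
  obtain ⟨D₂, hD₂v, hD₂e, -, hD₂⟩ := Cyc.exists_of_paths q₁ p.reverse
    (C.isPath_arcTo _ _ (by omega)) hp.reverse
    (fun z hz hz' => hpC z (by simpa using hz') (hv₁ z hz)) hkl
    (by rw [C.length_arcTo, SimpleGraph.Walk.length_reverse]; omega)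
  have g₁ := half D₁ (fun x hx => by
    rw [hD₁v] at hx
    exact hx.symm.imp (hv₂ x) id) (fun r => (hD₁e r).imp id (C.edges_arcTo _ _ _))
    ⟨C.c i, fun hx => by
      rw [hD₁v] at hx
      rcases hx with hx | hx
      · rcases hpC _ hx (C.mem_verts i) with h1 | h1
        · exact C.inj k i hki (by omega) h1.symm
        · exact C.inj i l hil (by omega) h1
      · obtain ⟨t, h1, h2, h3⟩ := (s₂ _).mp hx
        exact C.inj i t (by omega) (by omega) h3, hi⟩
  have g₂ := half D₂ (fun x hx => by
    rw [hD₂v] at hx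
    exact hx.imp (hv₁ x) (fun h => by simpa using h))
    (fun r => (hD₂e r).symm.imp (fun h => by simpa using h) (C.edges_arcTo _ _ _))
    ⟨C.c j, fun hx => by
      rw [hD₂v] at hx
      rcases hx with hx | hx
      · obtain ⟨t, h1, h2, h3⟩ := (s₁ _).mp hx
        exact C.inj t j (by omega) (by omega) h3.symm
      · rcases hpC _ (by simpa using hx) (C.mem_verts j) with h1 | h1
        · exact C.inj k j (by omega) (by omega) h1.symm
        · exact C.inj l j (by omega) (by omega) h1.symm, hj⟩
  refine hcon ?_
  have hdart : ∀ x y, (G.sg (A.erase e)).Adj x y → G.dart A y x = - G.dart A x y :=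
    fun x y hxy => h.simple.dart_swap (sg_erase_le hxy)
  have : C.chain (G.dart A) = D₁.chain (G.dart A) + D₂.chain (G.dart A) := by
    rw [hD₁, hD₂, wchain_reverse _ hdart, ← C.wchain_arcTo_self (G.dart A) hper,
      ← C.wchain_arcTo_add (G.dart A) (show k ≤ l by omega) rfl (show l ≤ k + C.n by omega) hper]
    abel
  rw [this]
  exact add_mem g₁ g₂

end Ends

end Ends

end OrientedGraph

namespace OrientedGraph

section Consecutive

variable {V E : Type*}

/-! ### Order of the attachments -/

/-- The gap of `p` around `t₀`, obtained from the nearest places on either side where `p` holds. The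
assumption `n ≤ t₀` keeps the subtraction of natural numbers honest, and `two` excludes that the gap
is a whole period. -/
theorem exists_nearest {p : ℕ → Prop} {n : ℕ} (hp : ∀ t, p (t + n) ↔ p t)
    (two : ∀ k, ∃ t, k < t ∧ t < k + n ∧ p t) {t₀ : ℕ} (h₀ : n ≤ t₀) (hn : ¬ p t₀) :
    ∃ i j, i < t₀ ∧ t₀ < j ∧ j < i + n ∧ p i ∧ p j ∧ ∀ t, i < t → t < j → ¬ p t := by
  classical
  have hex : ∃ j, t₀ < j ∧ p j := by
    obtain ⟨t, h1, -, h2⟩ := two t₀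
    exact ⟨t, h1, h2⟩
  have hex' : ∃ d, p (t₀ - d) ∧ d < n := by
    obtain ⟨t, h1, h3, h2⟩ := two (t₀ - n)
    exact ⟨t₀ - t, by rwa [Nat.sub_sub_self (by omega)], by omega⟩
  have hd := Nat.find_spec hex'
  have hdm := fun m (h : m < Nat.find hex') => Nat.find_min hex' h
  set d := Nat.find hex'
  have hj := Nat.find_spec hex
  have hjm := fun m (h : m < Nat.find hex) => Nat.find_min hex h
  have hjmin := fun m => Nat.find_min' hex (m := m)
  set j := Nat.find hex
  have hd0 : 0 < d := by
    rcases Nat.eq_zero_or_pos d with h | h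
    · rw [h, Nat.sub_zero] at hd
      exact absurd hd.1 hn
    · exact h
  have hno : ∀ t, t₀ - d < t → t < j → ¬ p t := by
    intro t h1 h2 h3
    rcases lt_trichotomy t t₀ with h | h | h
    · exact hdm (t₀ - t) (by omega) ⟨by rwa [Nat.sub_sub_self (by omega)], by omega⟩
    · exact hn (h ▸ h3)
    · exact hjm t h2 ⟨h, h3⟩
  refine ⟨t₀ - d, j, by omega, hj.1, ?_, hd.1, hj.2, hno⟩
  -- The place `t₀ - d + n` satisfies `p` and comes after `t₀`, hence `j` is not beyond it. If they
  -- were equal, the further place that `two` provides would lie in the gap.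
  have h1 := hjmin (t₀ - d + n) ⟨by omega, (hp _).mpr hd.1⟩
  obtain ⟨t, h2, h3, h4⟩ := two (t₀ - d)
  rcases h1.eq_or_lt with h | h
  · exact absurd h4 (hno t h2 (by omega))
  · exact h

/-- Two non-alternating sets on a circle. If some point of `b` is not in `a`, the gap of `a` around
it contains all points of `b` up to its ends, by non-alternation. If some point of `a` is not in
`b`, the roles are exchanged, and the complementary arc is used, whose ends lie in `a` because `b`
is contained in `a`. If the sets agree, they consist of two points or contain three. -/
theorem exists_consecutive {a b : ℕ → Prop} {n : ℕ} (ha : ∀ t, a (t + n) ↔ a t)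
    (hb : ∀ t, b (t + n) ↔ b t) (two_a : ∀ k, ∃ t, k < t ∧ t < k + n ∧ a t)
    (two_b : ∀ k, ∃ t, k < t ∧ t < k + n ∧ b t)
    (hab : ∀ i j k l, i < j → j < k → k < l → l < i + n → a i → b j → a k → b l → False) :
    (∃ i j, i < j ∧ j < i + n ∧ a i ∧ a j ∧ (∀ t, i < t → t < j → ¬ a t) ∧
      ∀ t, j < t → t < i + n → ¬ b t) ∨
    ∃ i j k, i < j ∧ j < k ∧ k < i + n ∧ a i ∧ a j ∧ a k ∧ b i ∧ b j ∧ b k := by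
  by_cases h1 : ∀ t, b t → a t
  · by_cases h2 : ∀ t, a t → b t
    · obtain ⟨i, -, -, hi⟩ := two_a 0
      classical
      have hex : ∃ j, i < j ∧ a j := by
        obtain ⟨t, h1, -, h2⟩ := two_a i
        exact ⟨t, h1, h2⟩
      obtain ⟨t, ht, ht', hat⟩ := two_a i
      have hj := Nat.find_spec hex
      have hjm := fun m (h : m < Nat.find hex) => Nat.find_min hex h
      have hjt : Nat.find hex ≤ t := Nat.find_min' hex ⟨ht, hat⟩
      set j := Nat.find hex
      by_cases h3 : ∃ k, j < k ∧ k < i + n ∧ a k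
      · obtain ⟨k, hjk, hk, hak⟩ := h3
        exact Or.inr ⟨i, j, k, hj.1, hjk, hk, hi, hj.2, hak, h2 _ hi, h2 _ hj.2, h2 _ hak⟩
      · push Not at h3
        exact Or.inl ⟨i, j, hj.1, by omega, hi, hj.2, fun t h h' hat => hjm t h' ⟨h, hat⟩,
          fun t h h' hbt => h3 t h h' (h1 t hbt)⟩
    · push Not at h2
      obtain ⟨t₀, h3, h4⟩ := h2
      obtain ⟨i, j, hi, hj, hji, hbi, hbj, hno⟩ := exists_nearest hb two_b (t₀ := t₀ + n)
        (by omega) (fun h => h4 ((hb _).mp h))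
      refine Or.inl ⟨j, i + n, by omega, by omega, h1 _ hbj, h1 _ ((hb i).mpr hbi), ?_, ?_⟩
      · intro s h h' has
        exact hab (t₀ + n) j s (i + n) hj h h' (by omega) ((ha _).mpr h3) hbj has ((hb i).mpr hbi)
      · intro s h h' hbs
        refine hno (s - n) (by omega) (by omega) ((hb _).mp ?_)
        rwa [Nat.sub_add_cancel (by omega)]
  · push Not at h1
    obtain ⟨t₀, h3, h4⟩ := h1
    obtain ⟨i, j, hi, hj, hji, hai, haj, hno⟩ := exists_nearest ha two_a (t₀ := t₀ + n)
      (by omega) (fun h => h4 ((ha _).mp h))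
    exact Or.inl ⟨i, j, by omega, hji, hai, haj, hno, fun s h h' hbs =>
      hab i (t₀ + n) j s hi hj h h' hai ((hb _).mpr h3) haj hbs⟩

/-- Between consecutive vertices adjacent to the component of `u` there is a separation. -/
theorem false_of_consecutive [DecidableEq E] [Fintype E] [Fintype V] {G : OrientedGraph V E}
    {H : Finset E} {u v : V} (C : Cyc (G.sg H)) (hu : u ∉ C.verts) (hv : v ∉ C.verts)
    (huv : ¬ (off (G.sg H) C.verts).Reachable u v) (hC : Unsplit G H u v C)
    (hD : ∀ {k i l j : ℕ}, k < i → i < l → l < j → j < k + C.n →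
      Att (G.sg H) C.verts u (C.c i) → Att (G.sg H) C.verts u (C.c j) →
      ∀ p : (G.sg H).Walk (C.c k) (C.c l), p.IsPath →
        (∀ x ∈ p.support, x ∈ C.verts → x = C.c k ∨ x = C.c l) →
        (∀ x ∈ p.support, ¬ (off (G.sg H) C.verts).Reachable u x) →
        (∀ x ∈ p.support, ¬ (off (G.sg H) C.verts).Reachable v x) → False)
    {i j : ℕ} (hij : i < j) (hji : j < i + C.n) (hi : Att (G.sg H) C.verts u (C.c i))
    (hj : Att (G.sg H) C.verts u (C.c j))
    (hno : ∀ t, i < t → t < j → ¬ Att (G.sg H) C.verts u (C.c t))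
    (hno' : ∀ t, j < t → t < i + C.n → ¬ Att (G.sg H) C.verts v (C.c t)) : False := by
  classical
  have hn := C.three_le
  have hi' : Att (G.sg H) C.verts u (C.c (i + C.n)) := by rwa [C.per]
  -- The side of `v`: the open arc from `i` to `j`, the component of `v`, and everything off the
  -- cycle that is attached to the open arc.
  let W : V → Prop := fun x => (∃ t, i < t ∧ t < j ∧ x = C.c t) ∨
    (off (G.sg H) C.verts).Reachable v x ∨
    (x ∉ C.verts ∧ ∃ t, i < t ∧ t < j ∧ Att (G.sg H) C.verts x (C.c t))
  have hWC : ∀ t, i ≤ t → t < i + C.n → W (C.c t) → i < t ∧ t < j := by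
    rintro t h1 h2 (⟨s, h3, h4, h5⟩ | h3 | h3)
    · have := C.eq_of_c_eq (i := i) h1 h2 (by omega) (by omega) h5
      omega
    · exact absurd (C.mem_verts t) (notMem_of_reachable h3 hv)
    · exact absurd (C.mem_verts t) h3.1
  -- Leaving `W` other than through `C.c i` or `C.c j` means reaching the opposite open arc. From
  -- the component of `v` this is excluded by `hno'`. Otherwise there is a chord, or a path through
  -- another component, between the two open arcs; it avoids the components of `u` and `v`, and `hD`
  -- forbids it.
  have hWadj : ∀ y x, W y → (G.sg H).Adj y x → ¬ W x → x = C.c i ∨ x = C.c j := by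
    intro y x hy hyx hx
    by_cases hxC : x ∈ C.verts
    · obtain ⟨s, h1, h2, rfl⟩ := C.exists_ge hxC i
      by_contra! hne
      have hsi : s ≠ i := fun h => hne.1 (by rw [h])
      have hsj : s ≠ j := fun h => hne.2 (by rw [h])
      have hs : j < s := by
        by_contra hs
        exact hx (Or.inl ⟨s, by omega, by omega, rfl⟩)
      rcases hy with ⟨t, h3, h4, rfl⟩ | hy | ⟨hyC, t, h3, h4, -, y', ⟨hyy', hy't⟩⟩
      · refine hD h4 hs h2 (by omega) hj hi' (.cons hyx .nil) ?_ ?_ ?_ ?_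
        · simp [hyx.ne]
        · intro x hx _; simpa using hx
        · intro x hx h
          have hx : x = C.c t ∨ x = C.c s := by simpa using hx
          rcases hx with rfl | rfl <;> exact notMem_of_reachable h hu (C.mem_verts _)
        · intro x hx h
          have hx : x = C.c t ∨ x = C.c s := by simpa using hx
          rcases hx with rfl | rfl <;> exact notMem_of_reachable h hv (C.mem_verts _)
      · exact hno' s hs h2 ⟨hxC, y, hy, hyx⟩
      · obtain ⟨q, hq⟩ := hyy'.symm.exists_isPath
        have hy'C := notMem_of_reachable hyy' hyC
        have hqC : ∀ z ∈ (q.mapLe (off_le _ _)).support, z ∉ C.verts := fun z hz =>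
          notMem_of_mem_support q hy'C z (by simpa using hz)
        have hqr : ∀ z ∈ (q.mapLe (off_le _ _)).support, (off (G.sg H) C.verts).Reachable y z :=
          fun z hz => hyy'.trans (reachable_of_mem_support q (by simpa using hz))
        have hts : C.c t ≠ C.c s := C.inj t s (by omega) (by omega)
        have hsup : ∀ x ∈ (SimpleGraph.Walk.cons hy't.symm
            ((q.mapLe (off_le _ _)).concat hyx)).support,
            x = C.c t ∨ x ∈ (q.mapLe (off_le _ _)).support ∨ x = C.c s := by
          intro x hx
          rw [SimpleGraph.Walk.support_cons, List.mem_cons, SimpleGraph.Walk.support_concat,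
            List.mem_append, List.mem_singleton] at hx
          exact hx
        refine hD h4 hs h2 (by omega) hj hi'
          (.cons hy't.symm ((q.mapLe (off_le _ _)).concat hyx)) ?_ ?_ ?_ ?_
        · rw [SimpleGraph.Walk.cons_isPath_iff]
          refine ⟨(hq.mapLe _).concat (fun h => hqC _ h hxC) _, fun h => ?_⟩
          rw [SimpleGraph.Walk.support_concat, List.mem_append, List.mem_singleton] at h
          rcases h with h | h
          · exact hqC _ h (C.mem_verts t)
          · exact hts h
        · intro x hx hxC
          rcases hsup x hx with h | h | h
          · exact Or.inl h
          · exact absurd hxC (hqC x h)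
          · exact Or.inr h
        · intro x hx h
          rcases hsup x hx with rfl | h' | rfl
          · exact notMem_of_reachable h hu (C.mem_verts _)
          · exact hno t h3 h4 ⟨C.mem_verts t, y', (h.trans (hqr x h').symm).trans hyy', hy't⟩
          · exact notMem_of_reachable h hu (C.mem_verts _)
        · intro x hx h
          rcases hsup x hx with rfl | h' | rfl
          · exact notMem_of_reachable h hv (C.mem_verts _)
          · exact hno' s hs h2 ⟨C.mem_verts s, y, h.trans (hqr x h').symm, hyx⟩
          · exact notMem_of_reachable h hv (C.mem_verts _)
    · exfalso
      rcases hy with ⟨t, h3, h4, rfl⟩ | hy | ⟨hyC, t, h3, h4, -, y', ⟨hyy', hy't⟩⟩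
      · exact hx (Or.inr (Or.inr ⟨hxC, t, h3, h4, C.mem_verts t, x, .rfl, hyx.symm⟩))
      · have : (off (G.sg H) C.verts).Adj y x := ⟨hyx, notMem_of_reachable hy hv, hxC⟩
        exact hx (Or.inr (Or.inl (hy.trans this.reachable)))
      · have : (off (G.sg H) C.verts).Adj x y := ⟨hyx.symm, hxC, hyC⟩
        exact hx (Or.inr (Or.inr ⟨hxC, t, h3, h4, C.mem_verts t, y', this.reachable.trans hyy',
          hy't⟩))
  have hWu : ¬ W u := by
    rintro (⟨t, -, -, rfl⟩ | h | ⟨-, t, h1, h2, h3⟩)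
    · exact hu (C.mem_verts t)
    · exact huv h.symm
    · exact hno t h1 h2 h3
  obtain ⟨b₀, hb₀, hj₀⟩ := C.exists_edge i
  obtain ⟨b₁, hb₁, hj₁⟩ := C.exists_edge j
  -- The edge `b₀` is added because the open arc may be empty: `F` then still contains an edge of
  -- the cycle. It does not contain `b₁`, so the separation, whose boundary lies in `{C.c i, C.c
  -- j}`, splits `C`.
  let F : Finset E := {b ∈ H | b = b₀ ∨ ∃ x, G.IsEnd b x ∧ W x}
  have hF : ∀ b, b ∈ F ↔ b ∈ H ∧ (b = b₀ ∨ ∃ x, G.IsEnd b x ∧ W x) := fun b => by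
    simp [F]
  have hend : ∀ b ∈ H, (∃ x, G.IsEnd b x ∧ W x) → ∀ y, G.IsEnd b y → ¬ W y →
      y = C.c i ∨ y = C.c j := by
    rintro b hb ⟨x, hx, hx'⟩ y hy hyW
    obtain ⟨z, hz⟩ := exists_joins hx
    rcases (isEnd_iff_of_joins hz y).mp hy with rfl | rfl
    · exact absurd hx' hyW
    · exact hWadj x y hx' ⟨fun h => hyW (h ▸ hx'), b, hb, hz⟩ hyW
  have hsep : IsSep G H v u F := by
    refine ⟨Finset.filter_subset _ _, fun b hb hbF hbv => ?_, fun b hb hbu => ?_, ?_⟩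
    · exact hbF ((hF b).mpr ⟨hb, Or.inr ⟨v, hbv, Or.inr (Or.inl .rfl)⟩⟩)
    · rcases ((hF b).mp hb).2 with rfl | h1
      · rcases (isEnd_iff_of_joins hj₀ u).mp hbu with rfl | rfl <;> exact hu (C.mem_verts _)
      · rcases hend b ((hF b).mp hb).1 h1 u hbu hWu with rfl | rfl <;> exact hu (C.mem_verts _)
    · refine (Finset.card_le_card (t := {C.c i, C.c j}) ?_).trans Finset.card_le_two
      intro x hx
      obtain ⟨⟨b, hb, hbx⟩, c, hc, hcF, hcx⟩ := mem_sepBdry.mp hx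
      have hxW : ¬ W x := fun h => hcF ((hF c).mpr ⟨hc, Or.inr ⟨x, hcx, h⟩⟩)
      rw [Finset.mem_insert, Finset.mem_singleton]
      rcases ((hF b).mp hb).2 with rfl | h1
      · rcases (isEnd_iff_of_joins hj₀ x).mp hbx with rfl | rfl
        · exact Or.inl rfl
        · by_cases h2 : i + 1 = j
          · exact Or.inr (by rw [h2])
          · exact absurd (Or.inl ⟨i + 1, by omega, by omega, rfl⟩) hxW
      · exact hend b ((hF b).mp hb).1 h1 x hbx hxW
  rcases hC.swap F hsep with h1 | h1
  · exact h1 b₀ ((hF b₀).mpr ⟨hb₀, Or.inl rfl⟩) ⟨hb₀, i, hj₀⟩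
  · rcases ((hF b₁).mp (h1 b₁ ⟨hb₁, j, hj₁⟩)).2 with h2 | ⟨x, hx, hx'⟩
    · rw [h2, hj₀, Sym2.eq_iff] at hj₁
      rcases hj₁ with h3 | h3
      · exact C.inj i j hij hji h3.1
      · by_cases h4 : i + 1 = j
        · subst h4
          exact C.inj i (i + 1 + 1) (by omega) (by omega) h3.1
        · exact C.inj (i + 1) j (by omega) (by omega) h3.2
    · rcases (isEnd_iff_of_joins hj₁ x).mp hx with rfl | rfl
      · have := hWC j (by omega) hji hx'
        omega
      · rcases (show j + 1 ≤ i + C.n from hji).eq_or_lt with h3 | h3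
        · rw [h3, C.per] at hx'
          have := hWC i le_rfl (by omega) hx'
          omega
        · have := hWC (j + 1) (by omega) h3 hx'
          omega

/-! ### Three common attachments -/

namespace Ends

variable [DecidableEq E] [Fintype E] {G : OrientedGraph V E} {A : Finset E} {e : E} {u v : V}

/-- The component of `u` contains a path between two vertices of the cycle and, disjoint from it, a
path from `u` to a third one. -/
theorem mem_of_two_paths (h : G.Ends A e u v) (C : Cyc (G.sg (A.erase e))) (hu : u ∉ C.verts)
    (hv : v ∉ C.verts) (huv : ¬ (off (G.sg (A.erase e)) C.verts).Reachable u v)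
    {i j k : ℕ} (hij : i < j) (hjk : j < k) (hki : k < i + C.n) {t s y₁ y₂ y₃ : V}
    (hy₁ : (G.sg (A.erase e)).Adj y₁ (C.c i)) (hy₂ : (G.sg (A.erase e)).Adj y₂ (C.c j))
    (hy₃ : (G.sg (A.erase e)).Adj y₃ (C.c k))
    (l₁ : (off (G.sg (A.erase e)) C.verts).Walk t y₁) (hl₁ : l₁.IsPath)
    (l₂ : (off (G.sg (A.erase e)) C.verts).Walk t y₂) (hl₂ : l₂.IsPath)
    (l₃ : (off (G.sg (A.erase e)) C.verts).Walk t y₃) (hl₃ : l₃.IsPath)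
    (h₁₂ : ∀ x ∈ l₁.support, x ∈ l₂.support → x = t)
    (h₃₁ : ∀ x ∈ l₃.support, x ∈ l₁.support → x = t)
    (h₃₂ : ∀ x ∈ l₃.support, x ∈ l₂.support → x = t)
    (hs : s ∈ l₃.support) (hst : s ≠ t) (q : (off (G.sg (A.erase e)) C.verts).Walk u s)
    (hq₁ : ∀ w ∈ q.support, w ∈ l₁.support → w = s) (hq₂ : ∀ w ∈ q.support, w ∈ l₂.support → w = s)
    (hvi : Att (G.sg (A.erase e)) C.verts v (C.c i))
    (hvj : Att (G.sg (A.erase e)) C.verts v (C.c j))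
    (hvk : Att (G.sg (A.erase e)) C.verts v (C.c k)) : C.chain (G.dart A) ∈ G.genAt A e := by
  classical
  have hn := C.three_le
  have hle : off (G.sg (A.erase e)) C.verts ≤ G.sg (A.erase e) := off_le _ _
  -- Joined to the cycle, `m` becomes a path from `C.c i` to `C.c j` through `t`. It divides `C`
  -- into `D₁`, which misses `C.c k`, and `D₂`, which contains it.
  set m := l₁.reverse.append l₂ with hm
  have hmp : m.IsPath := isPath_append hl₁.reverse hl₂ fun w hw hw' => h₁₂ w (by simpa using hw) hw'
  have hms : ∀ w, w ∈ m.support → w ∈ l₁.support ∨ w ∈ l₂.support := fun w hw => by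
    rw [hm, SimpleGraph.Walk.mem_support_append_iff] at hw
    simpa using hw
  have hut : (off (G.sg (A.erase e)) C.verts).Reachable u t :=
    (SimpleGraph.Walk.reachable q).trans (reachable_of_mem_support l₃ hs).symm
  have hmu : ∀ w ∈ m.support, (off (G.sg (A.erase e)) C.verts).Reachable u w := fun w hw =>
    hut.trans ((hms w hw).elim (reachable_of_mem_support _) (reachable_of_mem_support _))
  have hmC : ∀ w ∈ m.support, w ∉ C.verts := fun w hw => notMem_of_reachable (hmu w hw) hu
  have htm : t ∈ m.support := by simp [hm]
  -- the vertices off the path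
  have hl₃m : ∀ w ∈ l₃.support, w ≠ t → w ∉ m.support := fun w hw hwt hwm =>
    hwt ((hms w hwm).elim (h₃₁ w hw) (h₃₂ w hw))
  have hqm : ∀ w ∈ q.support, w ∉ m.support := fun w hw hwm => by
    have : w = s := (hms w hwm).elim (hq₁ w hw) (hq₂ w hw)
    subst this
    exact hl₃m w hs hst hwm
  have hvm : ∀ w, (off (G.sg (A.erase e)) C.verts).Reachable v w → w ∉ m.support :=
    fun w hw hwm => huv ((hmu w hwm).trans hw.symm)
  have hsy : ∀ w ∈ (l₃.dropUntil s hs).support, w ∉ m.support := fun w hw =>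
    hl₃m w (l₃.support_dropUntil_subset_support hs hw) fun hwt => by
      subst hwt
      exact hst (eq_of_mem_takeUntil_of_mem_dropUntil hl₃ hs
        (SimpleGraph.Walk.start_mem_support _) hw).symm
  -- reachability off cycles in the union of the cycle and the path
  have hoff : ∀ (Y : Set V), (∀ w ∈ Y, w ∈ C.verts ∨ w ∈ m.support) → ∀ {x y : V}
      (r : (off (G.sg (A.erase e)) C.verts).Walk x y), (∀ w ∈ r.support, w ∉ C.verts) →
      (∀ w ∈ r.support, w ∉ m.support) → (off (G.sg (A.erase e)) Y).Reachable x y :=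
    fun Y hY x y r h1 h2 => reachable_off (r.mapLe hle) fun z hz hzY => by
      have hz : z ∈ r.support := by simpa using hz
      exact (hY z hzY).elim (h1 z hz) (h2 z hz)
  have huy : ∀ (Y : Set V), (∀ w ∈ Y, w ∈ C.verts ∨ w ∈ m.support) →
      (off (G.sg (A.erase e)) Y).Reachable u s ∧ (off (G.sg (A.erase e)) Y).Reachable s y₃ :=
    fun Y hY => ⟨hoff Y hY q (notMem_of_mem_support q hu) hqm,
      hoff Y hY (l₃.dropUntil s hs) (notMem_of_mem_support _
        (notMem_of_reachable ⟨q⟩ hu)) hsy⟩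
  have hvz : ∀ (Y : Set V), (∀ w ∈ Y, w ∈ C.verts ∨ w ∈ m.support) → ∀ z,
      (off (G.sg (A.erase e)) C.verts).Reachable v z →
      (off (G.sg (A.erase e)) Y).Reachable v z := by
    rintro Y hY z ⟨r⟩
    exact hoff Y hY r (notMem_of_mem_support r hv)
      fun w hw => hvm w (reachable_of_mem_support r hw)
  -- the path between vertices of the cycle
  have hij' : C.c i ≠ C.c j := C.inj i j hij (by omega)
  set p : (G.sg (A.erase e)).Walk (C.c i) (C.c j) := .cons hy₁.symm ((m.mapLe hle).concat hy₂)
    with hp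
  have hpm : ∀ x, x ∈ p.support ↔ x = C.c i ∨ x ∈ m.support ∨ x = C.c j := by
    intro x
    rw [hp, SimpleGraph.Walk.support_cons, List.mem_cons, SimpleGraph.Walk.support_concat,
      List.mem_append, List.mem_singleton, SimpleGraph.Walk.support_mapLe_eq_support]
  have hpp : p.IsPath := by
    rw [hp, SimpleGraph.Walk.cons_isPath_iff]
    refine ⟨(hmp.mapLe _).concat (fun h => hmC _ (by simpa using h) (C.mem_verts j)) _, fun h => ?_⟩
    rw [SimpleGraph.Walk.support_concat, List.mem_append, List.mem_singleton] at h
    rcases h with h | h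
    · exact hmC _ (by simpa using h) (C.mem_verts i)
    · exact hij' h
  have hpC : ∀ x ∈ p.support, x ∈ C.verts → x = C.c i ∨ x = C.c j := fun x hx hxC => by
    rcases (hpm x).mp hx with h | h | h
    · exact Or.inl h
    · exact absurd hxC (hmC x h)
    · exact Or.inr h
  have hplen : 2 ≤ p.length := by simp [hp]
  have hper : C.c (i + C.n) = C.c i := C.per i
  set q₁ := C.arcTo i j (by omega) rfl with hq₁'
  set q₂ := C.arcTo j (i + C.n) (by omega) hper with hq₂'
  have s₁ : ∀ x, x ∈ q₁.support ↔ ∃ t, i ≤ t ∧ t ≤ j ∧ x = C.c t := fun x => C.mem_support_arcTo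
  have s₂ : ∀ x, x ∈ q₂.support ↔ ∃ t, j ≤ t ∧ t ≤ i + C.n ∧ x = C.c t :=
    fun x => C.mem_support_arcTo
  have hv₁ : ∀ x ∈ q₁.support, x ∈ C.verts := fun x hx => by
    obtain ⟨t, -, -, rfl⟩ := (s₁ x).mp hx
    exact C.mem_verts t
  have hv₂ : ∀ x ∈ q₂.support, x ∈ C.verts := fun x hx => by
    obtain ⟨t, -, -, rfl⟩ := (s₂ x).mp hx
    exact C.mem_verts t
  have hpY : ∀ x ∈ p.support, x ∈ C.verts ∨ x ∈ m.support := fun x hx => by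
    rcases (hpm x).mp hx with rfl | h | rfl
    · exact Or.inl (C.mem_verts _)
    · exact Or.inr h
    · exact Or.inl (C.mem_verts _)
  obtain ⟨D₁, hD₁v, -, -, hD₁⟩ := Cyc.exists_of_paths q₁ p.reverse
    (C.isPath_arcTo _ _ (by omega)) hpp.reverse
    (fun z hz hz' => hpC z (by simpa using hz') (hv₁ z hz)) hij'
    (by rw [C.length_arcTo, SimpleGraph.Walk.length_reverse]; omega)
  obtain ⟨D₂, hD₂v, -, ⟨hD₂0, hD₂l, hD₂n, hD₂p, hD₂q⟩, hD₂⟩ := Cyc.exists_of_paths q₂ p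
    (C.isPath_arcTo _ _ (by omega)) hpp (fun z hz hz' => (hpC z hz' (hv₂ z hz)).symm) hij'.symm
    (by rw [C.length_arcTo]; omega)
  have hq₂l : q₂.length = i + C.n - j := C.length_arcTo _ _
  have hY₁ : ∀ w ∈ D₁.verts, w ∈ C.verts ∨ w ∈ m.support := fun w hw => by
    rw [hD₁v] at hw
    exact hw.elim (fun h => Or.inl (hv₁ w h)) fun h => hpY w (by simpa using h)
  have hY₂ : ∀ w ∈ D₂.verts, w ∈ C.verts ∨ w ∈ m.support := fun w hw => by
    rw [hD₂v] at hw
    exact hw.elim (fun h => Or.inl (hv₂ w h)) (hpY w)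
  have hu_of : ∀ Y : Set V, (∀ w ∈ Y, w ∈ C.verts ∨ w ∈ m.support) → u ∉ Y := fun Y hY h =>
    (hY u h).elim hu (hqm u q.start_mem_support)
  have hv_of : ∀ Y : Set V, (∀ w ∈ Y, w ∈ C.verts ∨ w ∈ m.support) → v ∉ Y := fun Y hY h =>
    (hY v h).elim hv (hvm v .rfl)
  have hkp : C.c k ∉ p.support := fun hx => by
    rcases hpC _ hx (C.mem_verts k) with h1 | h1
    · exact C.inj i k (by omega) hki h1.symm
    · exact C.inj j k hjk (by omega) h1.symm
  -- Off `D₁` there is a connection from `u` along `q` to `s`, along `l₃` to `y₃`, through `C.c k`,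
  -- and on to `v`.
  have g₁ : D₁.chain (G.dart A) ∈ G.genAt A e := by
    refine h.mem_of_reachable D₁ (hu_of _ hY₁) ?_
    obtain ⟨-, z, hz, hzk⟩ := hvk
    have hk : C.c k ∉ D₁.verts := by
      rw [hD₁v]
      rintro (hx | hx)
      · obtain ⟨r, h1, h2, h3⟩ := (s₁ _).mp hx
        exact C.inj r k (by omega) (by omega) h3.symm
      · exact hkp (by simpa using hx)
    obtain ⟨r1, r2⟩ := huy _ hY₁
    have r3 := hvz _ hY₁ z hz
    have a1 : (off (G.sg (A.erase e)) D₁.verts).Adj y₃ (C.c k) :=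
      ⟨hy₃, notMem_of_reachable (r1.trans r2) (hu_of _ hY₁), hk⟩
    have a2 : (off (G.sg (A.erase e)) D₁.verts).Adj z (C.c k) :=
      ⟨hzk, notMem_of_reachable r3 (hv_of _ hY₁), hk⟩
    exact (r1.trans r2).trans ((a1.reachable.trans a2.reachable.symm).trans r3.symm)
  -- On `D₂` the attachments alternate: `C.c k` for `u`, `C.c i` for `v`, `t` for `u` and `C.c j`
  -- for `v`. The vertex `t` is reached from `u` along `q` and the part of `l₃` between `s` and `t`.
  have g₂ : D₂.chain (G.dart A) ∈ G.genAt A e := by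
    have hkq : C.c k ∈ q₂.support := (s₂ _).mpr ⟨k, by omega, by omega, rfl⟩
    obtain ⟨τ, hτ, hτk⟩ := hD₂p _ hkq
    obtain ⟨ρ, hρ, hρn, hρt⟩ := hD₂q t ((hpm t).mpr (Or.inr (Or.inl htm)))
    have hτ0 : τ ≠ 0 := by
      rintro rfl
      rw [hD₂0] at hτk
      exact C.inj j k hjk (by omega) hτk
    have hτl : τ ≠ q₂.length := by
      rintro rfl
      rw [hD₂l] at hτk
      exact C.inj i k (by omega) hki hτk
    have hρl : ρ ≠ q₂.length := by
      rintro rfl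
      rw [hD₂l] at hρt
      exact hmC t htm (hρt ▸ C.mem_verts i)
    have hD₂n' : D₂.c D₂.n = C.c j := by
      have := D₂.per 0
      rwa [Nat.zero_add, hD₂0] at this
    have hρn' : ρ ≠ D₂.n := by
      rintro rfl
      rw [hD₂n'] at hρt
      exact hmC t htm (hρt ▸ C.mem_verts j)
    obtain ⟨r1, r2⟩ := huy _ hY₂
    refine h.mem_of_alternate D₂ (hu_of _ hY₂) (hv_of _ hY₂) (i := τ) (j := q₂.length) (k := ρ)
      (l := D₂.n) (by omega) (by omega) (by omega) (by omega) ?_ ?_ ?_ ?_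
    · exact ⟨D₂.mem_verts _, y₃, r1.trans r2, hτk ▸ hy₃⟩
    · obtain ⟨-, z, hz, hzk⟩ := hvi
      exact ⟨D₂.mem_verts _, z, hvz _ hY₂ z hz, hD₂l.symm ▸ hzk⟩
    · refine ⟨D₂.mem_verts _, ?_⟩
      rw [hρt]
      -- the last vertex before `t` on the way from `s` to `t`
      have htake := hl₃.takeUntil hs
      have hsub : ∀ w ∈ (l₃.takeUntil s hs).support, w ∈ l₃.support :=
        fun w hw => l₃.support_takeUntil_subset_support hs hw
      generalize l₃.takeUntil s hs = r at htake hsub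
      cases r with
      | nil => exact absurd rfl hst
      | @cons _ x _ a r =>
        rw [SimpleGraph.Walk.cons_isPath_iff] at htake
        refine ⟨x, r1.trans (hoff _ hY₂ r ?_ ?_).symm, a.1.symm⟩
        · exact notMem_of_mem_support r a.2.2
        · exact fun w hw => hl₃m w (hsub w (by simp [hw])) fun hwt => htake.2 (hwt ▸ hw)
    · obtain ⟨-, z, hz, hzk⟩ := hvj
      exact ⟨D₂.mem_verts _, z, hvz _ hY₂ z hz, hD₂n' ▸ hzk⟩
  have hdart : ∀ x y, (G.sg (A.erase e)).Adj x y → G.dart A y x = - G.dart A x y :=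
    fun x y hxy => h.simple.dart_swap (sg_erase_le hxy)
  have : C.chain (G.dart A) = D₁.chain (G.dart A) + D₂.chain (G.dart A) := by
    rw [hD₁, hD₂, wchain_reverse _ hdart, ← C.wchain_arcTo_self (G.dart A) hper,
      ← C.wchain_arcTo_add (G.dart A) (show i ≤ j by omega) rfl (show j ≤ i + C.n by omega) hper]
    abel
  rw [this]
  exact add_mem g₁ g₂

/-- Either the center of a spider has a fourth leg to `u` or the cycle is generated. -/
theorem exists_four_legs (h : G.Ends A e u v) (C : Cyc (G.sg (A.erase e))) (hu : u ∉ C.verts)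
    (hv : v ∉ C.verts) (huv : ¬ (off (G.sg (A.erase e)) C.verts).Reachable u v)
    {i j k : ℕ} (hij : i < j) (hjk : j < k) (hki : k < i + C.n) {y₁ y₂ y₃ : V}
    (hy₁ : (G.sg (A.erase e)).Adj y₁ (C.c i)) (hy₂ : (G.sg (A.erase e)).Adj y₂ (C.c j))
    (hy₃ : (G.sg (A.erase e)).Adj y₃ (C.c k))
    (hr₁ : (off (G.sg (A.erase e)) C.verts).Reachable u y₁)
    (hr₂ : (off (G.sg (A.erase e)) C.verts).Reachable u y₂)
    (hr₃ : (off (G.sg (A.erase e)) C.verts).Reachable u y₃)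
    (hvi : Att (G.sg (A.erase e)) C.verts v (C.c i))
    (hvj : Att (G.sg (A.erase e)) C.verts v (C.c j))
    (hvk : Att (G.sg (A.erase e)) C.verts v (C.c k)) :
    Nonempty (Spider (off (G.sg (A.erase e)) C.verts) ![u, y₁, y₂, y₃]) ∨
      C.chain (G.dart A) ∈ G.genAt A e := by
  obtain ⟨L⟩ := Spider.exists_three (hr₂.symm.trans hr₃) (hr₁.symm.trans hr₂)
  have hn := C.three_le
  have hL0 : (off (G.sg (A.erase e)) C.verts).Reachable L.center y₁ := ⟨L.leg 0⟩
  rcases L.exists_four (hr₁.trans hL0.symm) with h1 | ⟨r, s, hs, hst, q, hq, hq'⟩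
  · exact Or.inl h1
  right
  have m01 := L.meet 0 1 (by decide)
  have m10 := L.meet 1 0 (by decide)
  have m02 := L.meet 0 2 (by decide)
  have m20 := L.meet 2 0 (by decide)
  have m12 := L.meet 1 2 (by decide)
  have m21 := L.meet 2 1 (by decide)
  have hpi := C.per i
  have hpj := C.per j
  -- The leg that the path from `u` hits plays the part of `l₃`. The three attachments are rotated
  -- accordingly, with indices raised by `C.n` to keep them increasing.
  match r with
  | 0 =>
    exact h.mem_of_two_paths C hu hv huv (i := j) (j := k) (k := i + C.n) hjk hki (by omega)
      hy₂ hy₃ (hpi ▸ hy₁) (L.leg 1) (L.isPath 1) (L.leg 2) (L.isPath 2) (L.leg 0) (L.isPath 0)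
      m12 m01 m02 hs hst q (fun w hw => hq' w hw 1) (fun w hw => hq' w hw 2) hvj hvk (hpi ▸ hvi)
  | 1 =>
    exact h.mem_of_two_paths C hu hv huv (i := k) (j := i + C.n) (k := j + C.n) hki (by omega)
      (by omega) hy₃ (hpi ▸ hy₁) (hpj ▸ hy₂) (L.leg 2) (L.isPath 2) (L.leg 0) (L.isPath 0)
      (L.leg 1) (L.isPath 1)
      m20 m12 m10 hs hst q (fun w hw => hq' w hw 2) (fun w hw => hq' w hw 0) hvk (hpi ▸ hvi)
      (hpj ▸ hvj)
  | 2 =>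
    exact h.mem_of_two_paths C hu hv huv hij hjk hki
      hy₁ hy₂ hy₃ (L.leg 0) (L.isPath 0) (L.leg 1) (L.isPath 1) (L.leg 2) (L.isPath 2)
      m01 m20 m21 hs hst q (fun w hw => hq' w hw 0) (fun w hw => hq' w hw 1) hvi hvj hvk

/-- If the three legs in each component extend to a spider with a fourth leg to the end of `e`, they
form a `K₅` with the cycle. If not, `exists_four_legs` already decomposes the cycle. -/
theorem mem_of_three (h : G.Ends A e u v) (C : Cyc (G.sg (A.erase e))) (hu : u ∉ C.verts)
    (hv : v ∉ C.verts) (huv : ¬ (off (G.sg (A.erase e)) C.verts).Reachable u v)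
    {i j k : ℕ} (hij : i < j) (hjk : j < k) (hki : k < i + C.n)
    (hui : Att (G.sg (A.erase e)) C.verts u (C.c i))
    (huj : Att (G.sg (A.erase e)) C.verts u (C.c j))
    (huk : Att (G.sg (A.erase e)) C.verts u (C.c k))
    (hvi : Att (G.sg (A.erase e)) C.verts v (C.c i))
    (hvj : Att (G.sg (A.erase e)) C.verts v (C.c j))
    (hvk : Att (G.sg (A.erase e)) C.verts v (C.c k)) : C.chain (G.dart A) ∈ G.genAt A e := by
  have hui' := hui
  have huj' := huj
  have huk' := huk
  have hvi' := hvi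
  have hvj' := hvj
  have hvk' := hvk
  obtain ⟨-, y₁, r₁, a₁⟩ := hui'
  obtain ⟨-, y₂, r₂, a₂⟩ := huj'
  obtain ⟨-, y₃, r₃, a₃⟩ := huk'
  obtain ⟨-, z₁, s₁, b₁⟩ := hvi'
  obtain ⟨-, z₂, s₂, b₂⟩ := hvj'
  obtain ⟨-, z₃, s₃, b₃⟩ := hvk'
  rcases h.exists_four_legs C hu hv huv hij hjk hki a₁ a₂ a₃ r₁ r₂ r₃ hvi hvj hvk with ⟨⟨L⟩⟩ | h1
  · rcases h.swap.exists_four_legs C hv hu (fun h => huv h.symm) hij hjk hki b₁ b₂ b₃ s₁ s₂ s₃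
      hui huj huk with ⟨⟨R⟩⟩ | h1
    · exact mem_genAt_of_four_legs h.simple h.mem h.joins C hu hv huv hij hjk hki a₁ a₂ a₃ b₁ b₂ b₃
        L R
    · exact h1
  · exact h1

/-- Cycles that are not split by a separation of order two. -/
theorem mem_of_unsplit [Fintype V] (h : G.Ends A e u v) (C : Cyc (G.sg (A.erase e)))
    (hu : u ∉ C.verts) (hv : v ∉ C.verts) (hC : Unsplit G (A.erase e) u v C) :
    C.chain (G.dart A) ∈ G.genAt A e := by
  -- The induction is downward in the set of vertices reachable from `u` off the cycle, which is
  -- possible since there are finitely many vertices.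
  induction hX : {x | (off (G.sg (A.erase e)) C.verts).Reachable u x} using
    WellFoundedGT.induction generalizing C with
  | ind X ih =>
  subst hX
  by_cases huv : (off (G.sg (A.erase e)) C.verts).Reachable u v
  · exact h.mem_of_reachable C hu huv
  by_contra hcon
  have two : ∀ u' v', u' ∉ C.verts → v' ∉ C.verts →
      ¬ (off (G.sg (A.erase e)) C.verts).Reachable u' v' → Unsplit G (A.erase e) u' v' C →
      ∀ k, ∃ t, k < t ∧ t < k + C.n ∧ Att (G.sg (A.erase e)) C.verts u' (C.c t) := by
    intro u' v' hu' hv' huv' hC' k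
    obtain ⟨c, hc, hc'⟩ := exists_att_ne C hu' hv' huv' hC' k
    obtain ⟨t, h1, h2, rfl⟩ := C.exists_ge hc'.1 k
    exact ⟨t, lt_of_le_of_ne h1 fun h => hc (by rw [h]), h2, hc'⟩
  -- Alternation is excluded by the `K₃,₃` case. In the first outcome every path that could obstruct
  -- the separation is excluded by `mem_of_path`; the second outcome is that of three common
  -- attachments.
  rcases exists_consecutive (a := fun t => Att (G.sg (A.erase e)) C.verts u (C.c t))
    (b := fun t => Att (G.sg (A.erase e)) C.verts v (C.c t)) (n := C.n)
    (fun t => by rw [C.per]) (fun t => by rw [C.per]) (two u v hu hv huv hC)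
    (two v u hv hu (fun h => huv h.symm) hC.swap)
    (fun i j k l h1 h2 h3 h4 a1 b1 a2 b2 =>
      hcon (h.mem_of_alternate C hu hv h1 h2 h3 h4 a1 b1 a2 b2)) with
    ⟨i, j, hij, hji, hi, hj, h1, h2⟩ | ⟨i, j, k, hij, hjk, hki, h1, h2, h3, h4, h5, h6⟩
  · refine false_of_consecutive C hu hv huv hC ?_ hij hji hi hj h1 h2
    intro k i l j hki hil hlj hjk hi hj p hp hpC hpu hpv
    exact hcon (h.mem_of_path C hu hv huv hC
      (fun D hDu hDv hD hlt => ih _ hlt D hDu hDv hD rfl) hki hil hlj hjk hi hj p hp hpC hpu hpv)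
  · exact hcon (h.mem_of_three C hu hv huv hij hjk hki h1 h2 h3 h4 h5 h6)

end Ends

end Consecutive

end OrientedGraph

namespace OrientedGraph

/-! ### Generation of the Wu cycles -/

section Generation

variable {V E : Type*} [Fintype E] [Fintype V] [DecidableEq E] {G : OrientedGraph V E}
  {A : Finset E} {e : E}

theorem Circuit.isEnd_vert (C : Circuit G) {i : ℕ} (hi : i < C.n) :
    G.IsEnd (C.edge i) (C.vert i) :=
  isEnd_left (C.joins i hi)

theorem Disj.not_isEnd {b : E} (h : G.Disj e b) {x : V} (hx : G.IsEnd b x) :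
    x ≠ G.src e ∧ x ≠ G.tgt e := by
  rcases hx with rfl | rfl
  · exact ⟨h.1.symm, h.2.2.1.symm⟩
  · exact ⟨h.2.1.symm, h.2.2.2.symm⟩

/-- The support of `w e` avoids the ends of `e`, so every circuit in it is disjoint from a walk that
visits only these ends. This settles loops and edges with a parallel edge. -/
theorem IsWuCycle.mem_genAt_of_walk {w : E → E → ℚ} (hw : G.IsWuCycle w)
    (hA : ∀ b c, w b c ≠ 0 → b ∈ A) (he : e ∈ A)
    (p : (G.sg (A.erase e)).Walk (G.src e) (G.tgt e))
    (hp : ∀ x ∈ p.support, x = G.src e ∨ x = G.tgt e) : w e ∈ G.genAt A e := by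
  refine mem_of_forall_circuit _ _ (hw.flow e) fun C hC =>
    C.chain_mem_genAt_of_walk he (fun i hi => hA _ e (by rw [hw.symm]; exact hC i hi)) p
      fun i hi h => ?_
  have := (hw.disj _ _ (hC i hi)).not_isEnd (C.isEnd_vert hi)
  exact (hp _ h).elim this.1 this.2

/-- Splitting `w e` along all separations of order at most two leaves flows whose supports are not
split, and then no circuit in such a support is split either, so that `mem_of_unsplit` applies to
each circuit. -/
theorem SimpleOn.mem_genAt (hS : G.SimpleOn A) {w : E → E → ℚ} (hw : G.IsWuCycle w)
    (hA : ∀ b c, w b c ≠ 0 → b ∈ A) (he : e ∈ A) : w e ∈ G.genAt A e := by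
  have hA' : ∀ b c, w b c ≠ 0 → c ∈ A := fun b c h => hA c b (by rwa [hw.symm])
  have hee : ∀ c, w e c ≠ 0 → c ∈ A.erase e ∧ ¬ G.IsEnd c (G.src e) ∧ ¬ G.IsEnd c (G.tgt e) := by
    intro c hc
    have hd := hw.disj _ _ hc
    refine ⟨Finset.mem_erase.mpr ⟨?_, hA' _ _ hc⟩, fun h => (hd.not_isEnd h).1 rfl,
      fun h => (hd.not_isEnd h).2 rfl⟩
    rintro rfl
    exact hd.1 rfl
  refine mem_of_forall_sep (H := A.erase e) _ (fun z hz hzH hsplit => ?_) _ (hw.flow e) hee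
    fun F hF => hw.restr_isFlow (Finset.notMem_erase e A) (hS.ne e he) (fun b c h => ?_) hF
  · refine mem_of_forall_circuit _ _ hz fun C hC => ?_
    obtain ⟨D, hD, hDe, hDv⟩ := C.exists_cyc hS (Finset.erase_subset e A) fun i hi =>
      (hzH _ (hC i hi)).1
    rw [← hD]
    have hoff : ∀ x, (∀ b, z b ≠ 0 → ¬ G.IsEnd b x) → x ∉ D.verts := by
      rintro x hx ⟨k, rfl⟩
      obtain ⟨i, hi, h⟩ := hDv k
      exact hx _ (hC i hi) (h ▸ C.isEnd_vert hi)
    refine (Ends.mk hS he rfl).mem_of_unsplit D (hoff _ fun b hb => (hzH b hb).2.1)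
      (hoff _ fun b hb => (hzH b hb).2.2) fun F hF => ?_
    have hDz : ∀ b ∈ D.edges, z b ≠ 0 := by
      rintro b ⟨hb, k, hk⟩
      obtain ⟨i, hi, h⟩ := hDe k
      rw [hS.eq b (Finset.mem_of_mem_erase hb) _ (Finset.mem_of_mem_erase (hzH _ (hC i hi)).1)
        (hk.trans h)]
      exact hC i hi
    rcases hsplit F hF with h | h
    · exact Or.inr fun b hb => h b (hDz b hb)
    · exact Or.inl fun b hb hbD => h b (hDz b hbD) hb
  · by_cases hb : b = e
    · exact Or.inl hb
    · exact Or.inr (Finset.mem_erase.mpr ⟨hb, hA b c h⟩)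

/-- The symmetric cycles of the deleted product are generated by those of the subgraphs
homeomorphic to `2K₃`, `K₅` or `K₃,₃`. -/
theorem IsWuCycle.mem_gen {w : E → E → ℚ} (hw : G.IsWuCycle w) : w ∈ G.gen Finset.univ := by
  refine mem_gen_of_forall G (fun A hne => ?_) _ w hw fun _ _ _ => Finset.mem_univ _
  -- The edge to be removed is a loop if there is one, otherwise one of two parallel edges, and
  -- otherwise arbitrary.
  by_cases hl : ∃ e ∈ A, G.src e = G.tgt e
  · obtain ⟨e, he, hl⟩ := hl
    exact ⟨e, he, fun w hw hA => hw.mem_genAt_of_walk hA he (SimpleGraph.Walk.nil.copy rfl hl)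
      fun x hx => Or.inl (by simpa using hx)⟩
  push Not at hl
  by_cases hp : ∃ e ∈ A, ∃ b ∈ A, b ≠ e ∧ s(G.src b, G.tgt b) = s(G.src e, G.tgt e)
  · obtain ⟨e, he, b, hb, hbe, h⟩ := hp
    have hadj : (G.sg (A.erase e)).Adj (G.src e) (G.tgt e) :=
      ⟨hl e he, b, Finset.mem_erase.mpr ⟨hbe, hb⟩, h⟩
    exact ⟨e, he, fun w hw hA => hw.mem_genAt_of_walk hA he (.cons hadj .nil)
      fun x hx => by simpa using hx⟩
  push Not at hp
  obtain ⟨e, he⟩ := hne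
  refine ⟨e, he, fun w hw hA => SimpleOn.mem_genAt ⟨hl, fun b hb c hc h => ?_⟩ hw hA he⟩
  by_contra hne
  exact hp c hc b hb hne h

end Generation

end OrientedGraph

/-! ### The Gauss kernel -/

section GaussKernel

theorem tripleProduct_eq (u w d : Space3) : tripleProduct u w d =
    u 0 * w 1 * d 2 - u 0 * w 2 * d 1 - u 1 * w 0 * d 2 + u 1 * w 2 * d 0 + u 2 * w 0 * d 1 -
      u 2 * w 1 * d 0 := by
  simp [tripleProduct, Matrix.det_fin_three]

theorem normSq_eq (x : Space3) : ‖x‖ ^ 2 = x 0 ^ 2 + x 1 ^ 2 + x 2 ^ 2 := by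
  simp [EuclideanSpace.norm_sq_eq, Fin.sum_univ_three]

theorem inner_eq (x y : Space3) : inner ℝ x y = x 0 * y 0 + x 1 * y 1 + x 2 * y 2 := by
  simp [PiLp.inner_apply, Fin.sum_univ_three]
  ring

theorem continuous_tripleProduct {α : Type*} [TopologicalSpace α] {x a b : α → Space3}
    (hx : Continuous x) (ha : Continuous a) (hb : Continuous b) :
    Continuous fun p => tripleProduct (x p) (a p) (b p) := by
  simp only [tripleProduct_eq]
  fun_prop

theorem measurable_tripleProduct {α : Type*} [MeasurableSpace α] {x a b : α → Space3}
    (hx : Measurable x) (ha : Measurable a) (hb : Measurable b) :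
    Measurable fun p => tripleProduct (x p) (a p) (b p) := by
  simp only [tripleProduct_eq]
  fun_prop

theorem hasDerivAt_tripleProduct {x a b : ℝ → Space3} {x' a' b' : Space3} {s : ℝ}
    (hx : HasDerivAt x x' s) (ha : HasDerivAt a a' s) (hb : HasDerivAt b b' s) :
    HasDerivAt (fun s => tripleProduct (x s) (a s) (b s))
      (tripleProduct x' (a s) (b s) + tripleProduct (x s) a' (b s) + tripleProduct (x s) (a s) b')
      s := by
  have h : ∀ {y : ℝ → Space3} {y' : Space3}, HasDerivAt y y' s → ∀ i,
      HasDerivAt (fun s => y s i) (y' i) s := fun hy i =>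
    (EuclideanSpace.proj i : Space3 →L[ℝ] ℝ).hasFDerivAt.comp_hasDerivAt s hy
  have hx := h hx
  have ha := h ha
  have hb := h hb
  simp only [tripleProduct_eq]
  have m := fun i j k => ((hx i).mul (ha j)).mul (hb k)
  refine HasDerivAt.congr_deriv ((((((m 0 1 2).sub (m 0 2 1)).sub (m 1 0 2)).add (m 1 2 0)).add
    (m 2 0 1)).sub (m 2 1 0)) ?_
  simp only [Pi.mul_apply]
  ring

/-- The integrand of the Gauss integral. -/
noncomputable def gaussKernel (x a b : Space3) : ℝ :=
  tripleProduct x a b * (‖x‖ ^ 2) ^ (-(3 / 2) : ℝ)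

/-- The derivative of the Gauss kernel. -/
noncomputable def gaussKernelDeriv (x a b x' a' b' : Space3) : ℝ :=
  (tripleProduct x' a b + tripleProduct x a' b + tripleProduct x a b') *
    (‖x‖ ^ 2) ^ (-(3 / 2) : ℝ) -
  3 * inner ℝ x x' * tripleProduct x a b * (‖x‖ ^ 2) ^ (-(5 / 2) : ℝ)

theorem hasDerivAt_gaussKernel {x a b : ℝ → Space3} {x' a' b' : Space3} {s : ℝ}
    (hx : HasDerivAt x x' s) (ha : HasDerivAt a a' s) (hb : HasDerivAt b b' s) (h0 : x s ≠ 0) :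
    HasDerivAt (fun s => gaussKernel (x s) (a s) (b s))
      (gaussKernelDeriv (x s) (a s) (b s) x' a' b') s := by
  have h1 : ‖x s‖ ^ 2 ≠ 0 := by simpa using h0
  have h2 := (hx.norm_sq).rpow_const (p := (-(3 / 2) : ℝ)) (Or.inl h1)
  refine ((hasDerivAt_tripleProduct hx ha hb).mul h2).congr_deriv ?_
  rw [gaussKernelDeriv, show (-(3 / 2) - 1 : ℝ) = -(5 / 2) by norm_num]
  ring

/-- The solid angle form is closed. -/
theorem gaussKernelDeriv_sum (x p q r m n : Space3) (h0 : x ≠ 0) :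
    gaussKernelDeriv x q r p 0 m + gaussKernelDeriv x r p q n 0 +
      gaussKernelDeriv x p q r m n = 0 := by
  have h1 : 0 < ‖x‖ ^ 2 := by positivity
  -- With the power `-5/2` of `‖x‖ ^ 2` taken out, the closedness of the form becomes a polynomial
  -- identity in the coordinates.
  have h2 : (‖x‖ ^ 2) ^ (-(3 / 2) : ℝ) = ‖x‖ ^ 2 * (‖x‖ ^ 2) ^ (-(5 / 2) : ℝ) := by
    rw [show (-(3 / 2) : ℝ) = 1 + -(5 / 2) by norm_num, Real.rpow_add h1, Real.rpow_one]
  simp only [gaussKernelDeriv]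
  rw [h2]
  generalize (‖x‖ ^ 2) ^ (-(5 / 2) : ℝ) = ρ
  rw [normSq_eq]
  simp only [tripleProduct_eq, inner_eq, PiLp.zero_apply]
  ring

theorem continuousAt_gaussKernel {α : Type*} [TopologicalSpace α] {x a b : α → Space3} {p : α}
    (hx : ContinuousAt x p) (ha : ContinuousAt a p) (hb : ContinuousAt b p) (h0 : x p ≠ 0) :
    ContinuousAt (fun p => gaussKernel (x p) (a p) (b p)) p := by
  have h1 : ‖x p‖ ^ 2 ≠ 0 := by simpa using h0
  have h2 : Continuous fun y : Space3 × Space3 × Space3 => tripleProduct y.1 y.2.1 y.2.2 :=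
    continuous_tripleProduct (by fun_prop) (by fun_prop) (by fun_prop)
  exact (h2.continuousAt.comp (hx.prodMk (ha.prodMk hb))).mul
    ((hx.norm.pow 2).rpow_const (Or.inl h1))

theorem measurable_gaussKernel {α : Type*} [MeasurableSpace α] {x a b : α → Space3}
    (hx : Measurable x) (ha : Measurable a) (hb : Measurable b) :
    Measurable fun p => gaussKernel (x p) (a p) (b p) :=
  (measurable_tripleProduct hx ha hb).mul ((hx.norm.pow_const 2).pow_const _)

theorem measurable_gaussKernelDeriv {α : Type*} [MeasurableSpace α] {x a b x' a' b' : α → Space3}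
    (hx : Measurable x) (ha : Measurable a) (hb : Measurable b)
    (hx' : Measurable x') (ha' : Measurable a') (hb' : Measurable b') :
    Measurable fun p => gaussKernelDeriv (x p) (a p) (b p) (x' p) (a' p) (b' p) :=
  ((((measurable_tripleProduct hx' ha hb).add (measurable_tripleProduct hx ha' hb)).add
    (measurable_tripleProduct hx ha hb')).mul ((hx.norm.pow_const 2).pow_const _)).sub
    ((((measurable_const.mul (hx.inner hx')).mul (measurable_tripleProduct hx ha hb))).mul
      ((hx.norm.pow_const 2).pow_const _))

theorem abs_apply_le_norm (x : Space3) (i : Fin 3) : |x i| ≤ ‖x‖ := by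
  simpa using PiLp.norm_apply_le x i

theorem abs_tripleProduct_le (u w d : Space3) :
    |tripleProduct u w d| ≤ 6 * (‖u‖ * ‖w‖ * ‖d‖) := by
  have h : ∀ i j k, |u i * w j * d k| ≤ ‖u‖ * ‖w‖ * ‖d‖ := fun i j k => by
    rw [abs_mul, abs_mul]
    gcongr <;> exact abs_apply_le_norm _ _
  rw [tripleProduct_eq]
  have h1 := abs_le.mp (h 0 1 2)
  have h2 := abs_le.mp (h 0 2 1)
  have h3 := abs_le.mp (h 1 0 2)
  have h4 := abs_le.mp (h 1 2 0)
  have h5 := abs_le.mp (h 2 0 1)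
  have h6 := abs_le.mp (h 2 1 0)
  rw [abs_le]
  constructor <;> linarith

/-! ### Bounded functions -/

/-- A function is bounded on a set. -/
def BddOnSet {α N : Type*} [Norm N] (Z : Set α) (f : α → N) : Prop := ∃ M, ∀ p ∈ Z, ‖f p‖ ≤ M

section BddOnSet

variable {α N : Type*} {Z : Set α}

theorem BddOnSet.nonneg [Norm N] {f : α → N} (h : BddOnSet Z f) :
    ∃ M, 0 ≤ M ∧ ∀ p ∈ Z, ‖f p‖ ≤ M := by
  obtain ⟨M, h⟩ := h
  exact ⟨max M 0, le_max_right _ _, fun p hp => (h p hp).trans (le_max_left _ _)⟩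

theorem BddOnSet.add [SeminormedAddCommGroup N] {f g : α → N} (hf : BddOnSet Z f)
    (hg : BddOnSet Z g) : BddOnSet Z fun p => f p + g p := by
  obtain ⟨M, hf⟩ := hf
  obtain ⟨M', hg⟩ := hg
  exact ⟨M + M', fun p hp => (norm_add_le _ _).trans (add_le_add (hf p hp) (hg p hp))⟩

theorem BddOnSet.neg [SeminormedAddCommGroup N] {f : α → N} (hf : BddOnSet Z f) :
    BddOnSet Z fun p => - f p := by
  obtain ⟨M, hf⟩ := hf
  exact ⟨M, fun p hp => by rw [norm_neg]; exact hf p hp⟩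

theorem BddOnSet.sub [SeminormedAddCommGroup N] {f g : α → N} (hf : BddOnSet Z f)
    (hg : BddOnSet Z g) : BddOnSet Z fun p => f p - g p := by
  simpa only [sub_eq_add_neg] using hf.add hg.neg

theorem BddOnSet.mul {f g : α → ℝ} (hf : BddOnSet Z f) (hg : BddOnSet Z g) :
    BddOnSet Z fun p => f p * g p := by
  obtain ⟨M, h0, hf⟩ := hf.nonneg
  obtain ⟨M', -, hg⟩ := hg.nonneg
  exact ⟨M * M', fun p hp => by rw [norm_mul]; gcongr; exacts [hf p hp, hg p hp]⟩

theorem BddOnSet.smul [SeminormedAddCommGroup N] [NormedSpace ℝ N] {c : α → ℝ} {f : α → N}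
    (hc : BddOnSet Z c) (hf : BddOnSet Z f) : BddOnSet Z fun p => c p • f p := by
  obtain ⟨M, h0, hc⟩ := hc.nonneg
  obtain ⟨M', -, hf⟩ := hf.nonneg
  exact ⟨M * M', fun p hp => by rw [norm_smul]; gcongr; exacts [hc p hp, hf p hp]⟩

theorem BddOnSet.const [Norm N] (c : N) : BddOnSet Z fun _ : α => c := ⟨_, fun _ _ => le_rfl⟩

theorem BddOnSet.tripleProduct {x a b : α → Space3} (hx : BddOnSet Z x) (ha : BddOnSet Z a)
    (hb : BddOnSet Z b) : BddOnSet Z fun p => tripleProduct (x p) (a p) (b p) := by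
  obtain ⟨M₁, h₁, hx⟩ := hx.nonneg
  obtain ⟨M₂, h₂, ha⟩ := ha.nonneg
  obtain ⟨M₃, h₃, hb⟩ := hb.nonneg
  refine ⟨6 * (M₁ * M₂ * M₃), fun p hp => (abs_tripleProduct_le _ _ _).trans ?_⟩
  gcongr
  exacts [hx p hp, ha p hp, hb p hp]

theorem BddOnSet.rpow_normSq {x : α → Space3} {δ : ℝ} (hδ : 0 < δ) (h : ∀ p ∈ Z, δ ≤ ‖x p‖)
    {r : ℝ} (hr : r ≤ 0) : BddOnSet Z fun p => (‖x p‖ ^ 2) ^ r := by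
  refine ⟨(δ ^ 2) ^ r, fun p hp => ?_⟩
  rw [Real.norm_of_nonneg (by positivity)]
  exact Real.rpow_le_rpow_of_nonpos (by positivity) (by gcongr; exact h p hp) hr

theorem BddOnSet.gaussKernel {x a b : α → Space3} (hx : BddOnSet Z x) (ha : BddOnSet Z a)
    (hb : BddOnSet Z b) {δ : ℝ} (hδ : 0 < δ) (h : ∀ p ∈ Z, δ ≤ ‖x p‖) :
    BddOnSet Z fun p => gaussKernel (x p) (a p) (b p) :=
  (hx.tripleProduct ha hb).mul (rpow_normSq hδ h (by norm_num))

theorem BddOnSet.gaussKernelDeriv {x a b x' a' b' : α → Space3} (hx : BddOnSet Z x)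
    (ha : BddOnSet Z a) (hb : BddOnSet Z b) (hx' : BddOnSet Z x') (ha' : BddOnSet Z a')
    (hb' : BddOnSet Z b') {δ : ℝ} (hδ : 0 < δ) (h : ∀ p ∈ Z, δ ≤ ‖x p‖) :
    BddOnSet Z fun p => gaussKernelDeriv (x p) (a p) (b p) (x' p) (a' p) (b' p) := by
  have hin : BddOnSet Z fun p => inner ℝ (x p) (x' p) := by
    obtain ⟨M₁, h₁, hx⟩ := hx.nonneg
    obtain ⟨M₂, h₂, hx'⟩ := hx'.nonneg
    refine ⟨M₁ * M₂, fun p hp => (norm_inner_le_norm _ _).trans ?_⟩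
    gcongr
    exacts [hx p hp, hx' p hp]
  exact ((((hx'.tripleProduct ha hb).add (hx.tripleProduct ha' hb)).add
    (hx.tripleProduct ha hb')).mul (rpow_normSq hδ h (by norm_num))).sub
    ((((const 3).mul hin).mul (hx.tripleProduct ha hb)).mul (rpow_normSq hδ h (by norm_num)))

end BddOnSet

end GaussKernel

/-! ### The Gauss integral of two curves -/

section GaussIntegral

open MeasureTheory

/-- Lebesgue measure on the unit interval. -/
noncomputable abbrev unitMeasure : Measure ℝ := volume.restrict (Set.Ioc 0 1)

theorem ae_mem_unit : ∀ᵐ s ∂unitMeasure, s ∈ I := by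
  filter_upwards [ae_restrict_mem measurableSet_Ioc] with s hs
  exact Set.Ioc_subset_Icc_self hs

theorem ae_mem_square : ∀ᵐ p ∂(unitMeasure.prod unitMeasure), p ∈ I ×ˢ I := by
  rw [Measure.prod_restrict]
  filter_upwards [ae_restrict_mem (measurableSet_Ioc.prod measurableSet_Ioc)] with p hp
  exact ⟨Set.Ioc_subset_Icc_self hp.1, Set.Ioc_subset_Icc_self hp.2⟩

theorem ae_mem_cube : ∀ᵐ p ∂(unitMeasure.prod (unitMeasure.prod unitMeasure)),
    p ∈ I ×ˢ I ×ˢ I := by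
  rw [Measure.prod_restrict, Measure.prod_restrict]
  filter_upwards [ae_restrict_mem
    (measurableSet_Ioc.prod (measurableSet_Ioc.prod measurableSet_Ioc))] with p hp
  exact ⟨Set.Ioc_subset_Icc_self hp.1, Set.Ioc_subset_Icc_self hp.2.1,
    Set.Ioc_subset_Icc_self hp.2.2⟩

theorem integrable_of_bddOnSet {α : Type*} [MeasurableSpace α] {ν : Measure α} [IsFiniteMeasure ν]
    {Z : Set α} (hZ : ∀ᵐ p ∂ν, p ∈ Z) {f : α → ℝ} (hf : Measurable f) (hb : BddOnSet Z f) :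
    Integrable f ν := by
  obtain ⟨M, hM⟩ := hb
  exact Integrable.of_bound hf.aestronglyMeasurable M (hZ.mono hM)

/-- The exceptional countable set accommodates the times at which a polygonal curve turns. -/
theorem integral_unit_of_hasDerivAt {f f' : ℝ → ℝ} {S : Set ℝ} (hS : S.Countable)
    (hc : ContinuousOn f I) (hd : ∀ x ∈ I, x ∉ S → HasDerivAt f (f' x) x)
    (hm : Measurable f') (hb : BddOnSet I f') : ∫ s, f' s ∂unitMeasure = f 1 - f 0 := by
  have hi : IntervalIntegrable f' volume 0 1 := by
    rw [intervalIntegrable_iff_integrableOn_Ioc_of_le zero_le_one]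
    exact integrable_of_bddOnSet ae_mem_unit hm hb
  rw [← integral_eq_of_hasDerivAt_off_countable_of_le f f' zero_le_one hS hc
    (fun x hx => hd x (Set.Ioo_subset_Icc_self hx.1) hx.2) hi,
    intervalIntegral.integral_of_le zero_le_one]

/-- Integration of a divergence over the unit cube. -/
theorem integral_faces_eq_zero {A B C : ℝ × ℝ × ℝ → ℝ} (mA : Measurable A) (mB : Measurable B)
    (mC : Measurable C) (bA : BddOnSet (I ×ˢ I ×ˢ I) A) (bB : BddOnSet (I ×ˢ I ×ˢ I) B)
    (bC : BddOnSet (I ×ˢ I ×ˢ I) C) (hsum : ∀ p ∈ I ×ˢ I ×ˢ I, A p + B p + C p = 0)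
    {a b c : ℝ × ℝ → ℝ}
    (hb : Integrable b (unitMeasure.prod unitMeasure))
    (hc : Integrable c (unitMeasure.prod unitMeasure))
    (hA : ∀ t ∈ I, ∀ τ ∈ I, ∫ s, A (s, t, τ) ∂unitMeasure = a (t, τ))
    (hB : ∀ s ∈ I, ∀ τ ∈ I, ∫ t, B (s, t, τ) ∂unitMeasure = b (s, τ))
    (hC : ∀ s ∈ I, ∀ t ∈ I, ∫ τ, C (s, t, τ) ∂unitMeasure = c (s, t)) :
    ∫ q, a q ∂(unitMeasure.prod unitMeasure) + ∫ q, b q ∂(unitMeasure.prod unitMeasure) +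
      ∫ q, c q ∂(unitMeasure.prod unitMeasure) = 0 := by
  have iA := integrable_of_bddOnSet ae_mem_cube mA bA
  have iB := integrable_of_bddOnSet ae_mem_cube mB bB
  have iC := integrable_of_bddOnSet ae_mem_cube mC bC
  have slice : ∀ {f : ℝ × ℝ × ℝ → ℝ}, Measurable f → BddOnSet (I ×ˢ I ×ˢ I) f → ∀ s ∈ I,
      Integrable (fun q => f (s, q)) (unitMeasure.prod unitMeasure) := fun mf ⟨M, hM⟩ s hs =>
    integrable_of_bddOnSet ae_mem_square (mf.comp measurable_prodMk_left)
      ⟨M, fun q hq => hM (s, q) ⟨hs, hq⟩⟩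
  have eA : ∫ p, A p ∂(unitMeasure.prod (unitMeasure.prod unitMeasure)) =
      ∫ q, a q ∂(unitMeasure.prod unitMeasure) := by
    rw [integral_prod_symm _ iA]
    refine integral_congr_ae (ae_mem_square.mono fun q hq => ?_)
    exact hA q.1 hq.1 q.2 hq.2
  have eB : ∫ p, B p ∂(unitMeasure.prod (unitMeasure.prod unitMeasure)) =
      ∫ q, b q ∂(unitMeasure.prod unitMeasure) := by
    rw [integral_prod _ iB, integral_prod _ hb]
    refine integral_congr_ae (ae_mem_unit.mono fun s hs => ?_)
    change ∫ q, B (s, q) ∂_ = _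
    rw [integral_prod_symm _ (slice mB bB s hs)]
    exact integral_congr_ae (ae_mem_unit.mono fun τ hτ => hB s hs τ hτ)
  have eC : ∫ p, C p ∂(unitMeasure.prod (unitMeasure.prod unitMeasure)) =
      ∫ q, c q ∂(unitMeasure.prod unitMeasure) := by
    rw [integral_prod _ iC, integral_prod _ hc]
    refine integral_congr_ae (ae_mem_unit.mono fun s hs => ?_)
    change ∫ q, C (s, q) ∂_ = _
    rw [integral_prod _ (slice mC bC s hs)]
    exact integral_congr_ae (ae_mem_unit.mono fun t ht => hC s hs t ht)
  have e1 := integral_add iA iB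
  have e2 := integral_add (iA.add iB) iC
  simp only [Pi.add_apply] at e2
  rw [← eA, ← eB, ← eC, ← e1, ← e2]
  exact integral_eq_zero_of_ae (ae_mem_cube.mono fun p hp => hsum p hp)

/-- A curve in space that is differentiable outside of a countable set, with bounded derivative. -/
structure Curve3 where
  X : ℝ → Space3
  X' : ℝ → Space3
  cont : Continuous X
  meas : Measurable X'
  bdd : ∃ M, ∀ s, ‖X' s‖ ≤ M
  deriv : ∃ S : Set ℝ, S.Countable ∧ ∀ s, s ∉ S → HasDerivAt X (X' s) s

namespace Curve3

/-- The Gauss integral of two curves. -/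
noncomputable def gauss (X Y : Curve3) : ℝ :=
  ∫ p, gaussKernel (X.X p.1 - Y.X p.2) (X.X' p.1) (Y.X' p.2) ∂(unitMeasure.prod unitMeasure)

/-- The contribution to the homotopy formula of an end point of the first curve. -/
noncomputable def faceLeft (x₀ x₁ : Space3) (Y₀ Y₁ : Curve3) : ℝ :=
  ∫ p, gaussKernel ((1 - p.2) • (x₀ - Y₀.X p.1) + p.2 • (x₁ - Y₁.X p.1))
    (-((1 - p.2) • Y₀.X' p.1 + p.2 • Y₁.X' p.1)) ((x₁ - Y₁.X p.1) - (x₀ - Y₀.X p.1))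
    ∂(unitMeasure.prod unitMeasure)

/-- The contribution to the homotopy formula of an end point of the second curve. -/
noncomputable def faceRight (X₀ X₁ : Curve3) (y₀ y₁ : Space3) : ℝ :=
  ∫ p, gaussKernel ((1 - p.2) • (X₀.X p.1 - y₀) + p.2 • (X₁.X p.1 - y₁))
    ((X₁.X p.1 - y₁) - (X₀.X p.1 - y₀)) ((1 - p.2) • X₀.X' p.1 + p.2 • X₁.X' p.1)
    ∂(unitMeasure.prod unitMeasure)

theorem gaussKernel_neg_right (x a b : Space3) : gaussKernel x a (-b) = - gaussKernel x a b := by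
  simp only [gaussKernel, tripleProduct_eq, PiLp.neg_apply]
  ring

/-- The homotopy formula for the Gauss integral. -/
theorem gauss_sub_gauss (X₀ X₁ Y₀ Y₁ : Curve3)
    (h : ∀ s ∈ I, ∀ t ∈ I, ∀ τ ∈ I, (1 - τ) • (X₀.X s - Y₀.X t) + τ • (X₁.X s - Y₁.X t) ≠ 0) :
    gauss X₁ Y₁ - gauss X₀ Y₀ =
      (faceLeft (X₀.X 1) (X₁.X 1) Y₀ Y₁ - faceLeft (X₀.X 0) (X₁.X 0) Y₀ Y₁) +
      (faceRight X₀ X₁ (Y₀.X 1) (Y₁.X 1) - faceRight X₀ X₁ (Y₀.X 0) (Y₁.X 0)) := by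
  have h01 : (0 : ℝ) ∈ I ∧ (1 : ℝ) ∈ I := ⟨⟨le_rfl, zero_le_one⟩, ⟨zero_le_one, le_rfl⟩⟩
  have cX₀ := X₀.cont
  have cX₁ := X₁.cont
  have cY₀ := Y₀.cont
  have cY₁ := Y₁.cont
  have mX₀ := X₀.meas
  have mX₁ := X₁.meas
  have mY₀ := Y₀.meas
  have mY₁ := Y₁.meas
  -- `D` is the difference vector during the homotopy, and `P`, `Q`, `R` are its partial derivatives
  -- in `s`, `t`, `τ`. The mixed second derivatives are `M` in `s` and `τ`, `N` in `t` and `τ`, and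
  -- `Z = 0` in `s` and `t`. The three kernels built from `D` and two of `P`, `Q`, `R` are the
  -- coefficients of the solid angle form pulled back to the cube, and their divergence vanishes.
  let D : ℝ × ℝ × ℝ → Space3 := fun p =>
    (1 - p.2.2) • (X₀.X p.1 - Y₀.X p.2.1) + p.2.2 • (X₁.X p.1 - Y₁.X p.2.1)
  let P : ℝ × ℝ × ℝ → Space3 := fun p => (1 - p.2.2) • X₀.X' p.1 + p.2.2 • X₁.X' p.1
  let Q : ℝ × ℝ × ℝ → Space3 := fun p => -((1 - p.2.2) • Y₀.X' p.2.1 + p.2.2 • Y₁.X' p.2.1)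
  let R : ℝ × ℝ × ℝ → Space3 := fun p => (X₁.X p.1 - Y₁.X p.2.1) - (X₀.X p.1 - Y₀.X p.2.1)
  let M : ℝ × ℝ × ℝ → Space3 := fun p => X₁.X' p.1 - X₀.X' p.1
  let N : ℝ × ℝ × ℝ → Space3 := fun p => -(Y₁.X' p.2.1 - Y₀.X' p.2.1)
  let Z : ℝ × ℝ × ℝ → Space3 := fun _ => 0
  have cD : Continuous D := by fun_prop
  have mD : Measurable D := cD.measurable
  have mP : Measurable P := by fun_prop
  have mQ : Measurable Q := by fun_prop
  have cR : Continuous R := by fun_prop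
  have mR : Measurable R := cR.measurable
  have mM : Measurable M := by fun_prop
  have mN : Measurable N := by fun_prop
  have mZ : Measurable Z := measurable_const
  have hcomp : IsCompact (I ×ˢ I ×ˢ I) := isCompact_Icc.prod (isCompact_Icc.prod isCompact_Icc)
  have bD : BddOnSet (I ×ˢ I ×ˢ I) D := hcomp.exists_bound_of_continuousOn cD.continuousOn
  have bR : BddOnSet (I ×ˢ I ×ˢ I) R := hcomp.exists_bound_of_continuousOn cR.continuousOn
  have bτ : BddOnSet (I ×ˢ I ×ˢ I) fun p : ℝ × ℝ × ℝ => p.2.2 :=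
    hcomp.exists_bound_of_continuousOn (by fun_prop)
  have bτ' : BddOnSet (I ×ˢ I ×ˢ I) fun p : ℝ × ℝ × ℝ => 1 - p.2.2 :=
    hcomp.exists_bound_of_continuousOn (by fun_prop)
  have b1 : ∀ X : Curve3, BddOnSet (I ×ˢ I ×ˢ I) fun p : ℝ × ℝ × ℝ => X.X' p.1 := fun X =>
    X.bdd.imp fun M hM p _ => hM p.1
  have b2 : ∀ X : Curve3, BddOnSet (I ×ˢ I ×ˢ I) fun p : ℝ × ℝ × ℝ => X.X' p.2.1 := fun X =>
    X.bdd.imp fun M hM p _ => hM p.2.1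
  have bP : BddOnSet (I ×ˢ I ×ˢ I) P := (bτ'.smul (b1 X₀)).add (bτ.smul (b1 X₁))
  have bQ : BddOnSet (I ×ˢ I ×ˢ I) Q := ((bτ'.smul (b2 Y₀)).add (bτ.smul (b2 Y₁))).neg
  have bM : BddOnSet (I ×ˢ I ×ˢ I) M := (b1 X₁).sub (b1 X₀)
  have bN : BddOnSet (I ×ˢ I ×ˢ I) N := ((b2 Y₁).sub (b2 Y₀)).neg
  have bZ : BddOnSet (I ×ˢ I ×ˢ I) Z := .const 0
  have hD0 : ∀ p ∈ I ×ˢ I ×ˢ I, D p ≠ 0 := fun p hp => h p.1 hp.1 p.2.1 hp.2.1 p.2.2 hp.2.2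
  obtain ⟨p₀, hp₀, hmin⟩ := hcomp.exists_isMinOn ⟨(0, 0, 0), h01.1, h01.1, h01.1⟩
    cD.norm.continuousOn
  -- By compactness the curves keep a positive distance during the homotopy, so that the kernels and
  -- their derivatives are bounded.
  have hδ : 0 < ‖D p₀‖ := norm_pos_iff.mpr (hD0 p₀ hp₀)
  have hδ' : ∀ p ∈ I ×ˢ I ×ˢ I, ‖D p₀‖ ≤ ‖D p‖ := fun p hp => hmin hp
  -- restriction to faces
  have face : ∀ (φ : ℝ × ℝ → ℝ × ℝ × ℝ), Measurable φ → (∀ q ∈ I ×ˢ I, φ q ∈ I ×ˢ I ×ˢ I) →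
      ∀ {a b : ℝ × ℝ × ℝ → Space3}, Measurable a → Measurable b → BddOnSet (I ×ˢ I ×ˢ I) a →
      BddOnSet (I ×ˢ I ×ˢ I) b → Integrable (fun q => gaussKernel (D (φ q)) (a (φ q)) (b (φ q)))
        (unitMeasure.prod unitMeasure) := by
    intro φ mφ hφ a b ma mb ha hb
    obtain ⟨K, hK⟩ := bD.gaussKernel ha hb hδ hδ'
    exact integrable_of_bddOnSet ae_mem_square ((measurable_gaussKernel mD ma mb).comp mφ)
      ⟨K, fun q hq => hK _ (hφ q hq)⟩
  have fA := fun s (hs : s ∈ I) => face (fun q => (s, q.1, q.2)) (by fun_prop)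
    (fun q hq => ⟨hs, hq.1, hq.2⟩) mQ mR bQ bR
  have fB := fun t (ht : t ∈ I) => face (fun q => (q.1, t, q.2)) (by fun_prop)
    (fun q hq => ⟨hq.1, ht, hq.2⟩) mR mP bR bP
  have fC := fun τ (hτ : τ ∈ I) => face (fun q => (q.1, q.2, τ)) (by fun_prop)
    (fun q hq => ⟨hq.1, hq.2, hτ⟩) mP mQ bP bQ
  have slice : ∀ {f : ℝ × ℝ × ℝ → ℝ} (φ : ℝ → ℝ × ℝ × ℝ), Measurable φ → Measurable f →
      BddOnSet (I ×ˢ I ×ˢ I) f → (∀ s ∈ I, φ s ∈ I ×ˢ I ×ˢ I) →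
      Measurable (fun s => f (φ s)) ∧ BddOnSet I fun s => f (φ s) :=
    fun φ mφ mf ⟨K, hK⟩ hφ => ⟨mf.comp mφ, K, fun s hs => hK _ (hφ s hs)⟩
  obtain ⟨S₀, cS₀, dX₀⟩ := X₀.deriv
  obtain ⟨S₁, cS₁, dX₁⟩ := X₁.deriv
  obtain ⟨T₀, cT₀, dY₀⟩ := Y₀.deriv
  obtain ⟨T₁, cT₁, dY₁⟩ := Y₁.deriv
  have mA := measurable_gaussKernelDeriv mD mQ mR mP mZ mM
  have mB := measurable_gaussKernelDeriv mD mR mP mQ mN mZ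
  have mC := measurable_gaussKernelDeriv mD mP mQ mR mM mN
  have bA := bD.gaussKernelDeriv bQ bR bP bZ bM hδ hδ'
  have bB := bD.gaussKernelDeriv bR bP bQ bN bZ hδ hδ'
  have bC := bD.gaussKernelDeriv bP bQ bR bM bN hδ hδ'
  have key := integral_faces_eq_zero mA mB mC bA bB bC
    (fun p hp => gaussKernelDeriv_sum (D p) (P p) (Q p) (R p) (M p) (N p) (hD0 p hp))
    (a := fun q => gaussKernel (D (1, q.1, q.2)) (Q (1, q.1, q.2)) (R (1, q.1, q.2)) -
      gaussKernel (D (0, q.1, q.2)) (Q (0, q.1, q.2)) (R (0, q.1, q.2)))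
    (b := fun q => gaussKernel (D (q.1, 1, q.2)) (R (q.1, 1, q.2)) (P (q.1, 1, q.2)) -
      gaussKernel (D (q.1, 0, q.2)) (R (q.1, 0, q.2)) (P (q.1, 0, q.2)))
    (c := fun q => gaussKernel (D (q.1, q.2, 1)) (P (q.1, q.2, 1)) (Q (q.1, q.2, 1)) -
      gaussKernel (D (q.1, q.2, 0)) (P (q.1, q.2, 0)) (Q (q.1, q.2, 0)))
    ((fB 1 h01.2).sub (fB 0 h01.1)) ((fC 1 h01.2).sub (fC 0 h01.1)) ?_ ?_ ?_
  · rw [integral_sub (fA 1 h01.2) (fA 0 h01.1), integral_sub (fB 1 h01.2) (fB 0 h01.1),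
      integral_sub (fC 1 h01.2) (fC 0 h01.1)] at key
    -- The sign comes from `Q`, the derivative of the difference in `t`, which contains the velocity
    -- of the second curve negatively.
    have g1 : ∫ q, gaussKernel (D (q.1, q.2, 1)) (P (q.1, q.2, 1)) (Q (q.1, q.2, 1))
        ∂(unitMeasure.prod unitMeasure) = - gauss X₁ Y₁ := by
      rw [gauss, ← integral_neg]
      simp [D, P, Q, gaussKernel_neg_right]
    have g0 : ∫ q, gaussKernel (D (q.1, q.2, 0)) (P (q.1, q.2, 0)) (Q (q.1, q.2, 0))
        ∂(unitMeasure.prod unitMeasure) = - gauss X₀ Y₀ := by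
      rw [gauss, ← integral_neg]
      simp [D, P, Q, gaussKernel_neg_right]
    rw [g1, g0] at key
    simp only [faceLeft, faceRight]
    linarith
  · intro t ht τ hτ
    obtain ⟨m1, m2⟩ := slice (fun s => (s, t, τ)) (by fun_prop) mA bA fun s hs => ⟨hs, ht, hτ⟩
    refine integral_unit_of_hasDerivAt (f := fun s =>
      gaussKernel (D (s, t, τ)) (Q (s, t, τ)) (R (s, t, τ))) (cS₀.union cS₁) ?_ ?_ m1 m2
    · intro s hs
      refine (continuousAt_gaussKernel (x := fun s => D (s, t, τ)) (a := fun s => Q (s, t, τ))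
        (b := fun s => R (s, t, τ)) ?_ ?_ ?_ (hD0 (s, t, τ) ⟨hs, ht, hτ⟩)).continuousWithinAt
      · exact (cD.comp (by fun_prop : Continuous fun s : ℝ => (s, t, τ))).continuousAt
      · exact continuousAt_const
      · exact (cR.comp (by fun_prop : Continuous fun s : ℝ => (s, t, τ))).continuousAt
    · intro s hs hsS
      rw [Set.mem_union, not_or] at hsS
      have d0 := dX₀ s hsS.1
      have d1 := dX₁ s hsS.2
      refine hasDerivAt_gaussKernel ?_
        (show HasDerivAt (fun s => Q (s, t, τ)) (Z (s, t, τ)) s from hasDerivAt_const s (Q (0, t, τ))) ?_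
        (hD0 (s, t, τ) ⟨hs, ht, hτ⟩)
      · exact ((d0.sub_const (Y₀.X t)).const_smul (1 - τ)).add
          ((d1.sub_const (Y₁.X t)).const_smul τ)
      · exact (d1.sub_const (Y₁.X t)).sub (d0.sub_const (Y₀.X t))
  · intro s hs τ hτ
    obtain ⟨m1, m2⟩ := slice (fun t => (s, t, τ)) (by fun_prop) mB bB fun t ht => ⟨hs, ht, hτ⟩
    refine integral_unit_of_hasDerivAt (f := fun t =>
      gaussKernel (D (s, t, τ)) (R (s, t, τ)) (P (s, t, τ))) (cT₀.union cT₁) ?_ ?_ m1 m2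
    · intro t ht
      refine (continuousAt_gaussKernel (x := fun t => D (s, t, τ)) (a := fun t => R (s, t, τ))
        (b := fun t => P (s, t, τ)) ?_ ?_ ?_ (hD0 (s, t, τ) ⟨hs, ht, hτ⟩)).continuousWithinAt
      · exact (cD.comp (by fun_prop : Continuous fun t : ℝ => (s, t, τ))).continuousAt
      · exact (cR.comp (by fun_prop : Continuous fun t : ℝ => (s, t, τ))).continuousAt
      · exact continuousAt_const
    · intro t ht htS
      rw [Set.mem_union, not_or] at htS
      have d0 := dY₀ t htS.1
      have d1 := dY₁ t htS.2
      refine hasDerivAt_gaussKernel ?_ ?_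
        (show HasDerivAt (fun t => P (s, t, τ)) (Z (s, t, τ)) t from hasDerivAt_const t (P (s, 0, τ)))
        (hD0 (s, t, τ) ⟨hs, ht, hτ⟩)
      · refine (((d0.const_sub (X₀.X s)).const_smul (1 - τ)).add
          ((d1.const_sub (X₁.X s)).const_smul τ)).congr_deriv ?_
        simp only [Q, smul_neg, neg_add]
      · refine ((d1.const_sub (X₁.X s)).sub (d0.const_sub (X₀.X s))).congr_deriv ?_
        simp only [N]
        abel
  · intro s hs t ht
    obtain ⟨m1, m2⟩ := slice (fun τ => (s, t, τ)) (by fun_prop) mC bC fun τ hτ => ⟨hs, ht, hτ⟩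
    have lin : ∀ (a b : Space3) (τ : ℝ), HasDerivAt (fun τ : ℝ => (1 - τ) • a + τ • b) (b - a) τ := by
      intro a b τ
      refine ((((hasDerivAt_id τ).const_sub 1).smul_const a).add
        ((hasDerivAt_id τ).smul_const b)).congr_deriv ?_
      simp only [neg_smul, one_smul]
      abel
    have dD : ∀ τ, HasDerivAt (fun τ => D (s, t, τ)) (R (s, t, τ)) τ := fun τ =>
      lin (X₀.X s - Y₀.X t) (X₁.X s - Y₁.X t) τ
    have dP : ∀ τ, HasDerivAt (fun τ => P (s, t, τ)) (M (s, t, τ)) τ := fun τ =>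
      lin (X₀.X' s) (X₁.X' s) τ
    have dQ : ∀ τ, HasDerivAt (fun τ => Q (s, t, τ)) (N (s, t, τ)) τ := fun τ =>
      (lin (Y₀.X' t) (Y₁.X' t) τ).neg
    refine integral_unit_of_hasDerivAt (f := fun τ =>
      gaussKernel (D (s, t, τ)) (P (s, t, τ)) (Q (s, t, τ))) Set.countable_empty ?_ ?_ m1 m2
    · exact fun τ hτ => (continuousAt_gaussKernel (dD τ).continuousAt (dP τ).continuousAt
        (dQ τ).continuousAt (hD0 (s, t, τ) ⟨hs, ht, hτ⟩)).continuousWithinAt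
    · exact fun τ hτ _ => hasDerivAt_gaussKernel (dD τ) (dP τ) (dQ τ) (hD0 (s, t, τ) ⟨hs, ht, hτ⟩)

end Curve3

end GaussIntegral

/-! ### Gauss integrals of polygonal curves -/

section PolygonalCurves

open MeasureTheory

theorem gaussKernel_smul_left (x a b : Space3) (c : ℝ) :
    gaussKernel x (c • a) b = c * gaussKernel x a b := by
  simp only [gaussKernel, tripleProduct_eq, PiLp.smul_apply, smul_eq_mul]
  ring

theorem gaussKernel_swap (x a b : Space3) : gaussKernel (-x) b a = gaussKernel x a b := by
  simp only [gaussKernel, tripleProduct_eq, PiLp.neg_apply, norm_neg]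
  ring

namespace Curve3

/-- Exchanging the curves negates the difference vector and transposes the two velocities, and the
kernel is unchanged under both together. -/
theorem gauss_comm (X Y : Curve3) : gauss X Y = gauss Y X := by
  unfold gauss
  rw [← integral_prod_swap]
  refine integral_congr_ae (.of_forall fun p => ?_)
  simp only [Prod.fst_swap, Prod.snd_swap]
  rw [← gaussKernel_swap, neg_sub]

/-- The Gauss integrand of two disjoint curves is integrable. -/
theorem integrable_gauss (X Y : Curve3) (h : ∀ s ∈ I, ∀ t ∈ I, X.X s ≠ Y.X t) :
    Integrable (fun p : ℝ × ℝ => gaussKernel (X.X p.1 - Y.X p.2) (X.X' p.1) (Y.X' p.2))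
      (unitMeasure.prod unitMeasure) := by
  have cX := X.cont
  have cY := Y.cont
  have mX := X.meas
  have mY := Y.meas
  have h01 : (0 : ℝ) ∈ I := ⟨le_rfl, zero_le_one⟩
  have cD : Continuous fun p : ℝ × ℝ => X.X p.1 - Y.X p.2 := by fun_prop
  have hcomp : IsCompact (I ×ˢ I) := isCompact_Icc.prod isCompact_Icc
  obtain ⟨p₀, hp₀, hmin⟩ := hcomp.exists_isMinOn ⟨(0, 0), h01, h01⟩ cD.norm.continuousOn
  have hδ : 0 < ‖X.X p₀.1 - Y.X p₀.2‖ := norm_pos_iff.mpr (sub_ne_zero.mpr (h _ hp₀.1 _ hp₀.2))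
  have bD : BddOnSet (I ×ˢ I) fun p : ℝ × ℝ => X.X p.1 - Y.X p.2 :=
    hcomp.exists_bound_of_continuousOn cD.continuousOn
  refine integrable_of_bddOnSet ae_mem_square
    (measurable_gaussKernel cD.measurable (by fun_prop) (by fun_prop))
    (bD.gaussKernel (X.bdd.imp fun M hM p _ => hM p.1) (Y.bdd.imp fun M hM p _ => hM p.2) hδ
      fun p hp => hmin hp)

end Curve3

/-- A straight segment as a curve. -/
noncomputable def Segment3.curve (a : Segment3) : Curve3 where
  X := a.point
  X' _ := a.dir
  cont := by unfold Segment3.point; exact AffineMap.lineMap_continuous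
  meas := measurable_const
  bdd := ⟨_, fun _ => le_rfl⟩
  deriv := ⟨∅, Set.countable_empty, fun s _ => by
    unfold Segment3.point Segment3.dir; exact AffineMap.hasDerivAt_lineMap⟩

/-- Integration over a subdivision of the unit interval. -/
theorem integral_unit_eq_sum {F : ℝ → ℝ} (hF : Integrable F unitMeasure) {n : ℕ} {u : ℕ → ℝ}
    (h0 : u 0 = 0) (h1 : u n = 1) (hlt : ∀ i < n, u i < u (i + 1)) :
    ∫ s, F s ∂unitMeasure = ∑ i ∈ Finset.range n,
      ∫ s, (u (i + 1) - u i) * F (AffineMap.lineMap (u i) (u (i + 1)) s) ∂unitMeasure := by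
  have mono : ∀ j ≤ n, ∀ i ≤ j, u i ≤ u j := by
    intro j hj i hij
    induction j, hij using Nat.le_induction with
    | base => exact le_rfl
    | succ j _ ih => exact (ih (by lia)).trans (hlt j (by lia)).le
  have hint : ∀ i < n, IntervalIntegrable F volume (u i) (u (i + 1)) := by
    intro i hi
    rw [intervalIntegrable_iff_integrableOn_Ioc_of_le (hlt i hi).le]
    refine IntegrableOn.mono_set (t := Set.Ioc 0 1) hF (Set.Ioc_subset_Ioc ?_ ?_)
    · exact h0 ▸ mono i hi.le 0 (Nat.zero_le _)
    · exact h1 ▸ mono n le_rfl (i + 1) hi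
  rw [← intervalIntegral.integral_of_le zero_le_one, ← h0, ← h1,
    ← intervalIntegral.sum_integral_adjacent_intervals hint]
  refine Finset.sum_congr rfl fun i hi => ?_
  have hi' := hlt i (Finset.mem_range.mp hi)
  rw [← intervalIntegral.integral_of_le zero_le_one, intervalIntegral.integral_const_mul]
  have hne : u (i + 1) - u i ≠ 0 := (sub_pos.mpr hi').ne'
  have := intervalIntegral.integral_comp_mul_add (a := 0) (b := 1) F hne (u i)
  simp only [AffineMap.lineMap_apply, vsub_eq_sub, smul_eq_mul, vadd_eq_add]
  simp only [mul_comm _ (u (i + 1) - u i)]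
  rw [this, smul_eq_mul, mul_inv_cancel_left₀ hne]
  simp

end PolygonalCurves

/-! ### Edges of polygonal maps as curves -/

namespace OrientedGraph.PolygonalMap

open MeasureTheory

variable {V E : Type*} {G : OrientedGraph V E} (g : G.PolygonalMap)

theorem time_le (e : E) {i j : ℕ} (hij : i ≤ j) (hj : j ≤ g.num e) : g.time e i ≤ g.time e j := by
  induction j, hij using Nat.le_induction with
  | base => exact le_rfl
  | succ j _ ih => exact (ih (by lia)).trans (g.time_lt e j (by lia)).le

/-- The progress at time `t` on the `i`-th segment of the edge `e`. -/
noncomputable def progress (e : E) (i : ℕ) (t : ℝ) : ℝ :=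
  max 0 (min 1 ((t - g.time e i) / (g.time e (i + 1) - g.time e i)))

open Classical in
/-- The speed at time `t` on the `i`-th segment of the edge `e`. -/
noncomputable def speed (e : E) (i : ℕ) (t : ℝ) : ℝ :=
  if t ∈ Set.Ioo (g.time e i) (g.time e (i + 1)) then (g.time e (i + 1) - g.time e i)⁻¹ else 0

theorem progress_of_le {e : E} {i : ℕ} (hi : i < g.num e) {t : ℝ} (ht : t ≤ g.time e i) :
    g.progress e i t = 0 := by
  have := sub_pos.mpr (g.time_lt e i hi)
  exact max_eq_left ((min_le_right _ _).trans (div_nonpos_of_nonpos_of_nonneg (by linarith) this.le))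

theorem progress_of_ge {e : E} {i : ℕ} (hi : i < g.num e) {t : ℝ} (ht : g.time e (i + 1) ≤ t) :
    g.progress e i t = 1 := by
  have := sub_pos.mpr (g.time_lt e i hi)
  rw [progress, min_eq_left ((one_le_div this).mpr (by linarith)), max_eq_right zero_le_one]

theorem progress_of_mem {e : E} {i : ℕ} (hi : i < g.num e) {t : ℝ}
    (ht : t ∈ Set.Icc (g.time e i) (g.time e (i + 1))) :
    g.progress e i t = (t - g.time e i) / (g.time e (i + 1) - g.time e i) := by
  have := sub_pos.mpr (g.time_lt e i hi)
  rw [progress, min_eq_right ((div_le_one this).mpr (by linarith [ht.2])),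
    max_eq_right (div_nonneg (by linarith [ht.1]) this.le)]

theorem hasDerivAt_progress {e : E} {i : ℕ} (hi : i < g.num e) {t : ℝ} (h0 : t ≠ g.time e i)
    (h1 : t ≠ g.time e (i + 1)) : HasDerivAt (g.progress e i) (g.speed e i t) t := by
  rcases lt_or_gt_of_ne h0 with h | h
  · rw [speed, if_neg fun hh => hh.1.not_gt h]
    refine (hasDerivAt_const t (0 : ℝ)).congr_of_eventuallyEq ?_
    filter_upwards [Iio_mem_nhds h] with x hx using g.progress_of_le hi (le_of_lt hx)
  · rcases lt_or_gt_of_ne h1 with h' | h'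
    · rw [speed, if_pos ⟨h, h'⟩]
      have := ((hasDerivAt_id t).sub_const (g.time e i)).div_const
        (g.time e (i + 1) - g.time e i)
      rw [one_div] at this
      refine this.congr_of_eventuallyEq ?_
      filter_upwards [Ioo_mem_nhds h h'] with x hx
      exact g.progress_of_mem hi (Set.Ioo_subset_Icc_self hx)
    · rw [speed, if_neg fun hh => hh.2.not_gt h']
      refine (hasDerivAt_const t (1 : ℝ)).congr_of_eventuallyEq ?_
      filter_upwards [Ioi_mem_nhds h'] with x hx using g.progress_of_ge hi (le_of_lt hx)

/-- The curve that is the image of the edge `e`. -/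
noncomputable def curve (e : E) : Curve3 where
  -- Each segment contributes its direction times a clamped progress. This makes the curve
  -- continuous on the whole line and differentiable except at the corner times.
  X t := g.corner e 0 + ∑ i ∈ Finset.range (g.num e), g.progress e i t • (g.seg e i).dir
  X' t := ∑ i ∈ Finset.range (g.num e), g.speed e i t • (g.seg e i).dir
  cont := by unfold progress; fun_prop
  meas := by
    refine Finset.measurable_fun_sum _ fun i _ => Measurable.smul_const ?_ _
    exact Measurable.ite measurableSet_Ioo measurable_const measurable_const
  bdd := by
    refine ⟨∑ i ∈ Finset.range (g.num e), |(g.time e (i + 1) - g.time e i)⁻¹| *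
      ‖(g.seg e i).dir‖, fun s => (norm_sum_le _ _).trans (Finset.sum_le_sum fun i _ => ?_)⟩
    rw [norm_smul, Real.norm_eq_abs]
    refine mul_le_mul_of_nonneg_right ?_ (norm_nonneg _)
    rw [speed]
    split_ifs
    · exact le_rfl
    · simp
  deriv := by
    refine ⟨Set.range (g.time e), Set.countable_range _, fun s hs => ?_⟩
    refine (HasDerivAt.fun_sum fun i hi => ?_).const_add _
    exact (g.hasDerivAt_progress (Finset.mem_range.mp hi) (fun h => hs ⟨i, h.symm⟩)
      (fun h => hs ⟨i + 1, h.symm⟩)).smul_const _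

theorem param_mem (e : E) {i : ℕ} (hi : i < g.num e) {s : ℝ} (hs : s ∈ I) :
    g.param e i s ∈ Set.Icc (g.time e i) (g.time e (i + 1)) := by
  have := g.time_lt e i hi
  simp only [param, AffineMap.lineMap_apply, vsub_eq_sub, smul_eq_mul, vadd_eq_add, Set.mem_Icc]
  constructor <;> nlinarith [hs.1, hs.2]

theorem param_mem_unit (e : E) {i : ℕ} (hi : i < g.num e) {s : ℝ} (hs : s ∈ I) :
    g.param e i s ∈ I := by
  have h := g.param_mem e hi hs
  have h0 := g.time_le e (Nat.zero_le i) hi.le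
  have h1 := g.time_le e (i := i + 1) hi le_rfl
  rw [g.time_zero] at h0
  rw [g.time_num] at h1
  exact ⟨h0.trans h.1, h.2.trans h1⟩

/-- During the `i`-th segment the earlier ones are completed and their directions telescope to
`corner e i`, while the later ones have not begun. -/
theorem curve_param (e : E) {i : ℕ} (hi : i < g.num e) {s : ℝ} (hs : s ∈ I) :
    (g.curve e).X (g.param e i s) = (g.seg e i).point s := by
  have hmem := g.param_mem e hi hs
  have h1 : ∀ j ∈ Finset.range i, g.progress e j (g.param e i s) • (g.seg e j).dir =
      g.corner e (j + 1) - g.corner e j := by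
    intro j hj
    have hj := Finset.mem_range.mp hj
    rw [g.progress_of_ge (hj.trans hi) ((g.time_le e (by lia) hi.le).trans hmem.1), one_smul]
    rfl
  have h2 : ∀ j ∈ Finset.Ico (i + 1) (g.num e),
      g.progress e j (g.param e i s) • (g.seg e j).dir = 0 := by
    intro j hj
    have hj := Finset.mem_Ico.mp hj
    rw [g.progress_of_le hj.2 (hmem.2.trans (g.time_le e hj.1 hj.2.le)), zero_smul]
  have h3 : g.progress e i (g.param e i s) = s := by
    rw [g.progress_of_mem hi hmem]
    have := (sub_pos.mpr (g.time_lt e i hi)).ne'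
    simp only [param, AffineMap.lineMap_apply, vsub_eq_sub, smul_eq_mul, vadd_eq_add]
    rw [add_sub_cancel_right, mul_div_assoc, div_self this, mul_one]
  change g.corner e 0 + ∑ i ∈ Finset.range (g.num e), _ = _
  rw [← Finset.sum_range_add_sum_Ico _ (show i + 1 ≤ g.num e from hi), Finset.sum_eq_zero h2,
    Finset.sum_range_succ, Finset.sum_congr rfl h1, Finset.sum_range_sub, h3, add_zero,
    Segment3.point, AffineMap.lineMap_apply, Segment3.dir]
  simp only [seg, vsub_eq_sub, vadd_eq_add]
  abel

theorem speed_param (e : E) {i : ℕ} (hi : i < g.num e) {s : ℝ} (hs : s ∈ Set.Ioo (0 : ℝ) 1) :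
    (g.curve e).X' (g.param e i s) =
      (g.time e (i + 1) - g.time e i)⁻¹ • (g.seg e i).dir := by
  have hlt := g.time_lt e i hi
  have hmem : g.param e i s ∈ Set.Ioo (g.time e i) (g.time e (i + 1)) := by
    simp only [param, AffineMap.lineMap_apply, vsub_eq_sub, smul_eq_mul, vadd_eq_add, Set.mem_Ioo]
    constructor <;> nlinarith [hs.1, hs.2]
  change ∑ i ∈ Finset.range (g.num e), _ = _
  rw [Finset.sum_eq_single_of_mem i (Finset.mem_range.mpr hi), speed, if_pos hmem]
  intro j hj hji
  have hj := Finset.mem_range.mp hj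
  rw [speed, if_neg, zero_smul]
  intro h
  rcases lt_or_gt_of_ne hji with h' | h'
  · exact (h.2.trans_le (g.time_le e (i := j + 1) h' hi.le)).not_gt hmem.1
  · exact (hmem.2.trans_le (g.time_le e (i := i + 1) h' hj.le)).not_gt h.1

theorem curve_zero (e : E) : (g.curve e).X 0 = g.pos (G.src e) := by
  change g.corner e 0 + ∑ i ∈ Finset.range (g.num e), _ = _
  rw [Finset.sum_eq_zero, add_zero, g.corner_zero]
  intro i hi
  have hi := Finset.mem_range.mp hi
  rw [g.progress_of_le hi, zero_smul]
  exact g.time_zero e ▸ g.time_le e (Nat.zero_le i) hi.le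

theorem curve_one (e : E) : (g.curve e).X 1 = g.pos (G.tgt e) := by
  change g.corner e 0 + ∑ i ∈ Finset.range (g.num e), _ = _
  have h1 : ∀ j ∈ Finset.range (g.num e), g.progress e j 1 • (g.seg e j).dir =
      g.corner e (j + 1) - g.corner e j := by
    intro j hj
    have hj := Finset.mem_range.mp hj
    rw [g.progress_of_ge hj, one_smul]
    · rfl
    · exact g.time_num e ▸ g.time_le e (i := j + 1) hj le_rfl
  rw [Finset.sum_congr rfl h1, Finset.sum_range_sub, add_sub_cancel, g.corner_num]

theorem exists_param_eq (e : E) {t : ℝ} (ht : t ∈ I) :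
    ∃ i < g.num e, ∃ s ∈ I, g.param e i s = t := by
  have hn : 0 < g.num e := by
    by_contra h
    have h0 := g.time_zero e
    have h1 := g.time_num e
    rw [Nat.le_zero.mp (not_lt.mp h), h0] at h1
    exact zero_ne_one h1
  obtain ⟨i, hi, h1, h2⟩ : ∃ i < g.num e, g.time e i ≤ t ∧ t ≤ g.time e (i + 1) := by
    by_contra! hcon
    have : ∀ i ≤ g.num e, g.time e i ≤ t := by
      intro i
      induction i with
      | zero => exact fun _ => g.time_zero e ▸ ht.1
      | succ i ih => exact fun hi => (hcon i hi (ih (by lia))).le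
    have h := hcon (g.num e - 1) (by lia) (this _ (by lia))
    rw [Nat.sub_add_cancel hn, g.time_num] at h
    exact h.not_ge ht.2
  have hpos := sub_pos.mpr (g.time_lt e i hi)
  refine ⟨i, hi, (t - g.time e i) / (g.time e (i + 1) - g.time e i),
    ⟨div_nonneg (by linarith) hpos.le, (div_le_one hpos).mpr (by linarith)⟩, ?_⟩
  simp only [param, AffineMap.lineMap_apply, vsub_eq_sub, smul_eq_mul, vadd_eq_add]
  rw [div_mul_cancel₀ _ hpos.ne', sub_add_cancel]

/-- The integral over the first parameter is cut at the corner times. On each piece the factor from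
rescaling to the unit interval cancels the speed. -/
theorem gauss_curve_left (e : E) (Y : Curve3) (h : ∀ s ∈ I, ∀ t ∈ I, (g.curve e).X s ≠ Y.X t) :
    (g.curve e).gauss Y = ∑ i ∈ Finset.range (g.num e), (g.seg e i).curve.gauss Y := by
  have hint := (g.curve e).integrable_gauss Y h
  rw [Curve3.gauss, integral_prod _ hint, integral_unit_eq_sum hint.integral_prod_left
    (g.time_zero e) (g.time_num e) (g.time_lt e)]
  refine Finset.sum_congr rfl fun i hi => ?_
  have hi := Finset.mem_range.mp hi
  rw [Curve3.gauss, integral_prod]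
  swap
  · refine Curve3.integrable_gauss _ _ fun s hs t ht => ?_
    have := h _ (g.param_mem_unit e hi hs) t ht
    rwa [g.curve_param e hi hs] at this
  have hae : ∀ᵐ s ∂unitMeasure, s ∈ Set.Ioo (0 : ℝ) 1 := by
    rw [unitMeasure, ← restrict_Ioo_eq_restrict_Ioc]
    exact ae_restrict_mem measurableSet_Ioo
  refine integral_congr_ae (hae.mono fun s hs => ?_)
  have e1 := g.curve_param e hi (Set.Ioo_subset_Icc_self hs)
  have e2 := g.speed_param e hi hs
  have hpos := sub_pos.mpr (g.time_lt e i hi)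
  simp only [param] at e1 e2
  simp only [e1, e2, gaussKernel_smul_left, integral_const_mul]
  rw [mul_inv_cancel_left₀ hpos.ne']
  rfl

theorem gauss_curve_curve (e e' : E)
    (h : ∀ s ∈ I, ∀ t ∈ I, (g.curve e).X s ≠ (g.curve e').X t) :
    (g.curve e).gauss (g.curve e') = ∑ i ∈ Finset.range (g.num e),
      ∑ j ∈ Finset.range (g.num e'), (g.seg e i).curve.gauss (g.seg e' j).curve := by
  rw [g.gauss_curve_left e _ h]
  refine Finset.sum_congr rfl fun i hi => ?_
  have hi := Finset.mem_range.mp hi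
  rw [Curve3.gauss_comm, g.gauss_curve_left e' _ fun t ht s hs => ?_]
  · exact Finset.sum_congr rfl fun j _ => Curve3.gauss_comm _ _
  · have := h _ (g.param_mem_unit e hi hs) t ht
    rw [g.curve_param e hi hs] at this
    exact this.symm

end OrientedGraph.PolygonalMap

/-! ### Cyclic combinations of Gauss integrals -/

namespace OrientedGraph

variable {V E : Type*} {G : OrientedGraph V E} [Fintype V] [Fintype E]

/-- Summation by parts: flows are orthogonal to coboundaries of functions on the vertices. -/
theorem IsFlow.sum_mul_sub {z : E → ℚ} (hz : G.IsFlow z) (φ : V → ℝ) :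
    ∑ e, (z e : ℝ) * (φ (G.tgt e) - φ (G.src e)) = 0 := by
  classical
  have h : ∀ v, ∑ e, (z e : ℝ) * (G.inc e v : ℝ) = 0 := fun v => by
    have := congrFun hz v
    rw [bdry_apply] at this
    exact_mod_cast this
  have h2 : ∀ e, φ (G.tgt e) - φ (G.src e) = ∑ v, φ v * (G.inc e v : ℝ) := fun e => by
    have h3 : ∀ x v : V, ((if x = v then 1 else 0 : ℚ) : ℝ) = if x = v then 1 else 0 := fun x v => by
      split_ifs <;> simp
    simp [inc, mul_sub, Finset.sum_sub_distrib, h3]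
  calc ∑ e, (z e : ℝ) * (φ (G.tgt e) - φ (G.src e))
      = ∑ v, φ v * ∑ e, (z e : ℝ) * (G.inc e v : ℝ) := by
        simp only [h2, Finset.mul_sum]
        rw [Finset.sum_comm]
        exact Finset.sum_congr rfl fun v _ => Finset.sum_congr rfl fun e _ => by ring
    _ = 0 := by simp [h]

namespace PolygonalMap

/-- The combination of Gauss integrals with coefficients `w`. -/
noncomputable def gaussSum (g : G.PolygonalMap) (w : E → E → ℚ) : ℝ :=
  ∑ e, ∑ e', (w e e' : ℝ) * (g.curve e).gauss (g.curve e')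

/-- A cyclic combination of Gauss integrals does not change under straight-line homotopies during
which disjoint edges remain disjoint. -/
theorem gaussSum_eq {w : E → E → ℚ} (hw : G.IsWuCycle w) (g₀ g₁ : G.PolygonalMap)
    (h : ∀ e e', G.Disj e e' → ∀ s ∈ I, ∀ t ∈ I, ∀ τ ∈ I,
      (1 - τ) • ((g₀.curve e).X s - (g₀.curve e').X t) +
        τ • ((g₁.curve e).X s - (g₁.curve e').X t) ≠ 0) :
    g₁.gaussSum w = g₀.gaussSum w := by
  rw [← sub_eq_zero]
  simp only [gaussSum, ← Finset.sum_sub_distrib, ← mul_sub]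
  -- For fixed `e'` the left face terms are the coboundary of a function of the vertices of the
  -- first edge, and likewise for the right ones with `e` fixed. Both are therefore killed by the
  -- flow condition, once symmetry of `w` is used.
  have key : ∀ e e', (w e e' : ℝ) *
      ((g₁.curve e).gauss (g₁.curve e') - (g₀.curve e).gauss (g₀.curve e')) =
      (w e e' : ℝ) *
        ((fun v => Curve3.faceLeft (g₀.pos v) (g₁.pos v) (g₀.curve e') (g₁.curve e')) (G.tgt e) -
        (fun v => Curve3.faceLeft (g₀.pos v) (g₁.pos v) (g₀.curve e') (g₁.curve e')) (G.src e)) +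
      (w e e' : ℝ) *
        ((fun v => Curve3.faceRight (g₀.curve e) (g₁.curve e) (g₀.pos v) (g₁.pos v)) (G.tgt e') -
        (fun v => Curve3.faceRight (g₀.curve e) (g₁.curve e) (g₀.pos v) (g₁.pos v)) (G.src e')) := by
    intro e e'
    by_cases hd : w e e' = 0
    · simp [hd]
    · rw [Curve3.gauss_sub_gauss _ _ _ _ (h e e' (hw.disj e e' hd))]
      simp only [curve_zero, curve_one]
      ring
  simp only [key, Finset.sum_add_distrib]
  rw [Finset.sum_comm]
  have h1 : ∀ e', ∑ e, (w e e' : ℝ) *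
        ((fun v => Curve3.faceLeft (g₀.pos v) (g₁.pos v) (g₀.curve e') (g₁.curve e')) (G.tgt e) -
        (fun v => Curve3.faceLeft (g₀.pos v) (g₁.pos v) (g₀.curve e') (g₁.curve e'))
          (G.src e)) = 0 := by
    intro e'
    simp only [fun e => hw.symm e e']
    exact (hw.flow e').sum_mul_sub
      fun v => Curve3.faceLeft (g₀.pos v) (g₁.pos v) (g₀.curve e') (g₁.curve e')
  rw [Finset.sum_eq_zero fun e' _ => h1 e',
    Finset.sum_eq_zero fun e _ => (hw.flow e).sum_mul_sub
      fun v => Curve3.faceRight (g₀.curve e) (g₁.curve e) (g₀.pos v) (g₁.pos v), add_zero]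

/-- If two polygonal maps approximate the same embedding, their difference vectors at points of
disjoint edges have positive inner product with those of the embedding. -/
theorem Approximates.inner_pos {g : G.PolygonalMap} {f : G.SpatialEmbedding}
    (h : g.Approximates f) {e e' : E} (hd : G.Disj e e') {s t : ℝ} (hs : s ∈ I) (ht : t ∈ I) :
    0 < inner ℝ ((g.curve e).X s - (g.curve e').X t)
      ((f.curve e).extend s - (f.curve e').extend t) := by
  obtain ⟨i, hi, s', hs', rfl⟩ := g.exists_param_eq e hs
  obtain ⟨j, hj, t', ht', rfl⟩ := g.exists_param_eq e' ht
  have key := h e e' hd i hi j hj s' hs' t' ht'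
  rw [g.curve_param e hi hs', g.curve_param e' hj ht']
  revert key
  generalize (f.curve e).extend (g.param e i s') = a
  generalize (f.curve e').extend (g.param e' j t') = b
  generalize (g.seg e i).point s' = c
  generalize (g.seg e' j).point t' = d
  intro key
  -- The difference vector of `g` lies in an open ball around that of `f` which does not contain the
  -- origin, hence in an open half-space determined by the latter.
  have h1 : ‖(a - b) - (c - d)‖ < ‖a - b‖ := by
    refine lt_of_le_of_lt ?_ ((dist_eq_norm a b) ▸ key)
    rw [dist_eq_norm, dist_eq_norm, show (a - b) - (c - d) = (a - c) - (b - d) by abel]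
    exact norm_sub_le _ _
  have h2 := norm_sub_sq_real (a - b) (c - d)
  rw [real_inner_comm] at h2
  nlinarith [norm_nonneg (a - b - (c - d)), sq_nonneg ‖c - d‖]

theorem Approximates.curve_ne {g : G.PolygonalMap} {f : G.SpatialEmbedding}
    (h : g.Approximates f) {e e' : E} (hd : G.Disj e e') {s t : ℝ} (hs : s ∈ I) (ht : t ∈ I) :
    (g.curve e).X s ≠ (g.curve e').X t := by
  intro h0
  have := h.inner_pos hd hs ht
  rw [h0, sub_self, inner_zero_left] at this
  exact lt_irrefl _ this

/-- Two approximations of an embedding have the same cyclic combinations of Gauss integrals. -/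
theorem Approximates.gaussSum_eq {g₀ g₁ : G.PolygonalMap} {f : G.SpatialEmbedding}
    (h₀ : g₀.Approximates f) (h₁ : g₁.Approximates f) {w : E → E → ℚ} (hw : G.IsWuCycle w) :
    g₁.gaussSum w = g₀.gaussSum w := by
  refine PolygonalMap.gaussSum_eq hw g₀ g₁ fun e e' hd s hs t ht τ hτ h => ?_
  have p0 := h₀.inner_pos hd hs ht
  have p1 := h₁.inner_pos hd hs ht
  -- Both difference vectors have positive inner product with that of the embedding, so no convex
  -- combination of them vanishes.
  have := congrArg (fun x => inner ℝ x ((f.curve e).extend s - (f.curve e').extend t)) h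
  simp only [inner_add_left, real_inner_smul_left, inner_zero_left] at this
  rcases hτ.1.eq_or_lt with h0 | h0
  · rw [← h0] at this
    linarith
  · nlinarith [mul_pos h0 p1, mul_nonneg (sub_nonneg.mpr hτ.2) p0.le]

end PolygonalMap

end OrientedGraph

/-! ### A singular limit -/

section SingularLimit

open MeasureTheory Filter Topology

/-- The integral of `(1 + |w|²)^(-3/2)` over the plane. -/
noncomputable def planeIntegral : ℝ := ∫ w : ℝ × ℝ, (1 + w.1 ^ 2 + w.2 ^ 2) ^ (-(3 / 2) : ℝ)

theorem integrable_plane :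
    Integrable fun w : ℝ × ℝ => (1 + w.1 ^ 2 + w.2 ^ 2) ^ (-(3 / 2) : ℝ) := by
  have h := integrable_rpow_neg_one_add_norm_sq (E := ℝ × ℝ) (μ := volume) (r := 3) (by
    simp; norm_num)
  refine h.mono' (Measurable.aestronglyMeasurable (by fun_prop)) (.of_forall fun w => ?_)
  have h1 : 0 < 1 + w.1 ^ 2 + w.2 ^ 2 := by positivity
  rw [Real.norm_of_nonneg (Real.rpow_nonneg h1.le _), show (-3 / 2 : ℝ) = -(3 / 2) by norm_num]
  refine Real.rpow_le_rpow_of_nonpos (by positivity) ?_ (by norm_num)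
  rw [Prod.norm_def]
  rcases max_choice ‖w.1‖ ‖w.2‖ with h | h <;> rw [h, Real.norm_eq_abs, sq_abs] <;> nlinarith

/-- Positivity is all that is needed of this constant, which cancels when two crossing sums are
compared. -/
theorem planeIntegral_pos : 0 < planeIntegral := by
  have h1 : ∀ w : ℝ × ℝ, 0 < (1 + w.1 ^ 2 + w.2 ^ 2) ^ (-(3 / 2) : ℝ) := fun w =>
    Real.rpow_pos_of_pos (by positivity) _
  rw [planeIntegral, integral_pos_iff_support_of_nonneg (fun w => (h1 w).le) integrable_plane]
  have : Function.support (fun w : ℝ × ℝ => (1 + w.1 ^ 2 + w.2 ^ 2) ^ (-(3 / 2) : ℝ)) =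
    Set.univ := Set.eq_univ_of_forall fun w => (h1 w).ne'
  rw [this]
  simp

/-- Linear change of variables in the plane. -/
theorem integral_comp_linear_plane {g : ℝ × ℝ → ℝ} (hg : Measurable g) {a b c d : ℝ}
    (h : a * d - b * c ≠ 0) :
    ∫ w : ℝ × ℝ, g w =
      |a * d - b * c| * ∫ w : ℝ × ℝ, g (a * w.1 + b * w.2, c * w.1 + d * w.2) := by
  have hdet : LinearMap.det (Matrix.toLin (Module.Basis.finTwoProd ℝ) (Module.Basis.finTwoProd ℝ)
      !![a, b; c, d]) = a * d - b * c := by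
    rw [LinearMap.det_toLin, Matrix.det_fin_two_of]
  have hmap := Measure.map_linearMap_addHaar_eq_smul_addHaar (volume : Measure (ℝ × ℝ))
    (f := Matrix.toLin (Module.Basis.finTwoProd ℝ) (Module.Basis.finTwoProd ℝ) !![a, b; c, d])
    (hdet ▸ h)
  rw [hdet] at hmap
  have hfun : ⇑(Matrix.toLin (Module.Basis.finTwoProd ℝ) (Module.Basis.finTwoProd ℝ)
      !![a, b; c, d]) = fun w : ℝ × ℝ => (a * w.1 + b * w.2, c * w.1 + d * w.2) := by
    funext w
    exact Matrix.toLin_finTwoProd_apply a b c d w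
  have hi := integral_map (μ := (volume : Measure (ℝ × ℝ)))
    (φ := fun w : ℝ × ℝ => (a * w.1 + b * w.2, c * w.1 + d * w.2)) (f := g)
    (by fun_prop) hg.aestronglyMeasurable
  rw [hfun] at hmap
  rw [← hi, hmap, integral_smul_measure, ENNReal.toReal_ofReal (abs_nonneg _), smul_eq_mul,
    abs_inv, mul_inv_cancel_left₀ (abs_ne_zero.mpr h)]

/-- Completing the square gives a linear map `B` that turns the quadratic form into `k ^ 2` times
the standard one. Under `z = l • B w` the integrand yields a factor `l ^ (-3)` and the Jacobian `l ^
2`, which with the `l` in front balance. As `l → 0` the rescaled region fills the plane and the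
linear terms disappear, by dominated convergence. -/
theorem tendsto_singular_integral {α β γ k q₁ q₂ : ℝ} (hα : 0 < α) (hΔ : 0 < α * γ - β ^ 2)
    (hk : k ≠ 0) {R : Set (ℝ × ℝ)} (hR : MeasurableSet R) (hR0 : R ∈ 𝓝 (0 : ℝ × ℝ)) :
    Tendsto (fun l : ℝ => l * ∫ z in R, (α * z.1 ^ 2 + 2 * β * z.1 * z.2 + γ * z.2 ^ 2 +
      l ^ 2 * (k + q₁ * z.1 + q₂ * z.2) ^ 2) ^ (-(3 / 2) : ℝ)) (𝓝[>] 0)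
      (𝓝 (planeIntegral / (|k| * √(α * γ - β ^ 2)))) := by
  have hΔs : 0 < √(α * γ - β ^ 2) := Real.sqrt_pos.mpr hΔ
  have hαs : 0 < √α := Real.sqrt_pos.mpr hα
  have sqΔ := Real.sq_sqrt hΔ.le
  have sqα := Real.sq_sqrt hα.le
  revert hΔs hαs sqΔ sqα
  generalize √(α * γ - β ^ 2) = D
  generalize √α = A
  intro hΔs hαs sqΔ sqα
  have hk2 : 0 < k ^ 2 := by positivity
  -- the change of variables, up to the factor `l`
  let B : ℝ × ℝ → ℝ × ℝ := fun w =>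
    (k / A * w.1 + -(k * β) / (A * D) * w.2, 0 * w.1 + k * A / D * w.2)
  have cB : Continuous B := by fun_prop
  have hB : ∀ w, α * (B w).1 ^ 2 + 2 * β * (B w).1 * (B w).2 + γ * (B w).2 ^ 2 =
      k ^ 2 * (w.1 ^ 2 + w.2 ^ 2) := by
    intro w
    simp only [B]
    field_simp
    rw [← sqα] at sqΔ ⊢
    have : γ * A ^ 2 = D ^ 2 + β ^ 2 := by linarith
    linear_combination (k ^ 2 * w.2 ^ 2 * A ^ 2) * this
  let φ : ℝ → ℝ × ℝ → ℝ := fun l w => R.indicator 1 (l • B w) *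
    (k ^ 2 * (w.1 ^ 2 + w.2 ^ 2) + (k + l * (q₁ * (B w).1 + q₂ * (B w).2)) ^ 2) ^ (-(3 / 2) : ℝ)
  have step : ∀ l : ℝ, 0 < l → l * ∫ z in R, (α * z.1 ^ 2 + 2 * β * z.1 * z.2 + γ * z.2 ^ 2 +
      l ^ 2 * (k + q₁ * z.1 + q₂ * z.2) ^ 2) ^ (-(3 / 2) : ℝ) = k ^ 2 / D * ∫ w, φ l w := by
    intro l hl
    have hdet : l * (k / A) * (l * (k * A / D)) - l * (-(k * β) / (A * D)) * 0 =
        l ^ 2 * (k ^ 2 / D) := by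
      field_simp
      ring
    have hpos : 0 < l ^ 2 * (k ^ 2 / D) := by positivity
    rw [← integral_indicator hR, integral_comp_linear_plane (Measurable.indicator (by fun_prop) hR)
      (a := l * (k / A)) (b := l * (-(k * β) / (A * D))) (c := 0) (d := l * (k * A / D))
      (hdet ▸ hpos.ne'), hdet, abs_of_pos hpos, ← mul_assoc, ← integral_const_mul, ← integral_const_mul]
    congr 1
    funext w
    have hw : (l * (k / A) * w.1 + l * (-(k * β) / (A * D)) * w.2, 0 * w.1 + l * (k * A / D) * w.2)
        = l • B w := by
      ext <;> simp [B] <;> ring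
    rw [hw]
    by_cases hmem : l • B w ∈ R
    · simp only [φ, Set.indicator_of_mem hmem, Pi.one_apply, one_mul]
      have h1 : α * (l • B w).1 ^ 2 + 2 * β * (l • B w).1 * (l • B w).2 + γ * (l • B w).2 ^ 2 +
          l ^ 2 * (k + q₁ * (l • B w).1 + q₂ * (l • B w).2) ^ 2 = l ^ 2 *
          (k ^ 2 * (w.1 ^ 2 + w.2 ^ 2) + (k + l * (q₁ * (B w).1 + q₂ * (B w).2)) ^ 2) := by
        rw [← hB]
        simp only [Prod.smul_fst, Prod.smul_snd, smul_eq_mul]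
        ring
      rw [h1, Real.mul_rpow (by positivity) (by positivity)]
      have h2 : (l ^ 2) ^ (-(3 / 2) : ℝ) = (l ^ 3)⁻¹ := by
        rw [← Real.rpow_natCast, ← Real.rpow_mul hl.le, ← Real.rpow_natCast, ← Real.rpow_neg hl.le]
        norm_num
      rw [h2]
      field_simp
    · simp [φ, Set.indicator_of_notMem hmem]
  have hlim : planeIntegral / (|k| * D) = k ^ 2 / D *
      ∫ w : ℝ × ℝ, (k ^ 2) ^ (-(3 / 2) : ℝ) * (1 + w.1 ^ 2 + w.2 ^ 2) ^ (-(3 / 2) : ℝ) := by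
    have h2 : (k ^ 2) ^ (-(3 / 2) : ℝ) = (|k| ^ 3)⁻¹ := by
      rw [← sq_abs, ← Real.rpow_natCast, ← Real.rpow_mul (abs_nonneg k), ← Real.rpow_natCast,
        ← Real.rpow_neg (abs_nonneg k)]
      norm_num
    rw [integral_const_mul, h2, planeIntegral, ← sq_abs]
    have := abs_pos.mpr hk
    field_simp
  rw [hlim]
  refine Tendsto.congr' (f₁ := fun l => k ^ 2 / D * ∫ w, φ l w) ?_ (Tendsto.const_mul _ ?_)
  · filter_upwards [self_mem_nhdsWithin] with l hl using (step l hl).symm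
  -- domination
  obtain ⟨C, hC0, hC⟩ : ∃ C : ℝ, 0 < C ∧ ∀ w, (q₁ * (B w).1 + q₂ * (B w).2) ^ 2 ≤
      C * (w.1 ^ 2 + w.2 ^ 2) := by
    refine ⟨(q₁ * (k / A)) ^ 2 + (q₁ * (-(k * β) / (A * D)) + q₂ * (k * A / D)) ^ 2 + 1,
      by positivity, fun w => ?_⟩
    simp only [B]
    generalize k / A = x
    generalize -(k * β) / (A * D) = y
    generalize k * A / D = z
    nlinarith [sq_nonneg (q₁ * x * w.2 - (q₁ * y + q₂ * z) * w.1), sq_nonneg w.1, sq_nonneg w.2]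
  obtain ⟨c, hc0, hc⟩ : ∃ c : ℝ, 0 < c ∧ ∀ l ∈ Set.Ioo (0 : ℝ) 1, ∀ w : ℝ × ℝ,
      c * (1 + w.1 ^ 2 + w.2 ^ 2) ≤
        k ^ 2 * (w.1 ^ 2 + w.2 ^ 2) + (k + l * (q₁ * (B w).1 + q₂ * (B w).2)) ^ 2 := by
    -- The square `(k + l s) ^ 2` is at least `k ^ 2 / 2 - s ^ 2`. Only a fraction `μ` of it is
    -- used, so small that the loss `μ C (w.1 ^ 2 + w.2 ^ 2)` is absorbed by half of the quadratic
    -- term.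
    obtain ⟨μ, hμ0, hμ1, hμ2⟩ : ∃ μ : ℝ, 0 < μ ∧ μ ≤ 1 ∧ μ * C ≤ k ^ 2 / 2 := by
      refine ⟨min 1 (k ^ 2 / 2 / C), by positivity, min_le_left _ _, ?_⟩
      exact (le_div_iff₀ hC0).mp (min_le_right _ _)
    refine ⟨μ * (k ^ 2 / 2), by positivity, fun l hl w => ?_⟩
    have hw := hC w
    generalize q₁ * (B w).1 + q₂ * (B w).2 = s at hw
    have hl2 : l ^ 2 * s ^ 2 ≤ s ^ 2 := by
      have : l ^ 2 ≤ 1 := by nlinarith [hl.1, hl.2]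
      nlinarith [sq_nonneg s]
    have h1 : k ^ 2 / 2 - s ^ 2 ≤ (k + l * s) ^ 2 := by nlinarith [sq_nonneg (k + 2 * (l * s))]
    have h2 : μ * (k + l * s) ^ 2 ≤ (k + l * s) ^ 2 := by nlinarith [sq_nonneg (k + l * s)]
    have h3 : μ * (k ^ 2 / 2 - s ^ 2) ≤ μ * (k + l * s) ^ 2 := mul_le_mul_of_nonneg_left h1 hμ0.le
    have h4 : μ * s ^ 2 ≤ μ * (C * (w.1 ^ 2 + w.2 ^ 2)) := mul_le_mul_of_nonneg_left hw hμ0.le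
    have h5 : μ * C * (w.1 ^ 2 + w.2 ^ 2) ≤ k ^ 2 / 2 * (w.1 ^ 2 + w.2 ^ 2) :=
      mul_le_mul_of_nonneg_right hμ2 (by positivity)
    have h6 : μ * (k ^ 2 / 2 * (w.1 ^ 2 + w.2 ^ 2)) ≤ 1 * (k ^ 2 / 2 * (w.1 ^ 2 + w.2 ^ 2)) :=
      mul_le_mul_of_nonneg_right hμ1 (by positivity)
    nlinarith
  have hIoo : Set.Ioo (0 : ℝ) 1 ∈ 𝓝[>] (0 : ℝ) := Ioo_mem_nhdsGT zero_lt_one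
  refine tendsto_integral_filter_of_dominated_convergence
    (fun w => c ^ (-(3 / 2) : ℝ) * (1 + w.1 ^ 2 + w.2 ^ 2) ^ (-(3 / 2) : ℝ)) ?_ ?_
    (integrable_plane.const_mul _) ?_
  · refine .of_forall fun l => Measurable.aestronglyMeasurable ?_
    have mB := cB.measurable
    refine Measurable.mul ((measurable_const.indicator hR).comp (by fun_prop)) (by fun_prop)
  · filter_upwards [hIoo] with l hl
    refine .of_forall fun w => ?_
    have h0 : 0 < c * (1 + w.1 ^ 2 + w.2 ^ 2) := by positivity
    have h1 : 0 ≤ (k ^ 2 * (w.1 ^ 2 + w.2 ^ 2) +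
        (k + l * (q₁ * (B w).1 + q₂ * (B w).2)) ^ 2) ^ (-(3 / 2) : ℝ) := by positivity
    rw [← Real.mul_rpow hc0.le (by positivity), Real.norm_eq_abs, abs_mul, abs_of_nonneg h1]
    have h2 : |R.indicator (1 : ℝ × ℝ → ℝ) (l • B w)| ≤ 1 := by
      by_cases hm : l • B w ∈ R <;> simp [hm]
    refine (mul_le_of_le_one_left h1 h2).trans ?_
    exact Real.rpow_le_rpow_of_nonpos h0 (hc l hl w) (by norm_num)
  · refine .of_forall fun w => ?_
    have hnhds : 𝓝[>] (0 : ℝ) ≤ 𝓝 0 := nhdsWithin_le_nhds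
    have h1 : ∀ᶠ l : ℝ in 𝓝[>] 0, R.indicator (1 : ℝ × ℝ → ℝ) (l • B w) = 1 := by
      have : Tendsto (fun l : ℝ => l • B w) (𝓝[>] 0) (𝓝 0) := by
        have h : Continuous fun l : ℝ => l • B w := by fun_prop
        have h' := h.tendsto 0
        rw [zero_smul] at h'
        exact h'.mono_left hnhds
      filter_upwards [this hR0] with l hl
      exact Set.indicator_of_mem (show l • B w ∈ R from hl) _
    have h0 : k ^ 2 * (w.1 ^ 2 + w.2 ^ 2) + k ^ 2 ≠ 0 := by positivity
    have h2 : Tendsto (fun l : ℝ => (k ^ 2 * (w.1 ^ 2 + w.2 ^ 2) +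
        (k + l * (q₁ * (B w).1 + q₂ * (B w).2)) ^ 2) ^ (-(3 / 2) : ℝ)) (𝓝[>] 0)
        (𝓝 ((k ^ 2 * (w.1 ^ 2 + w.2 ^ 2) + k ^ 2) ^ (-(3 / 2) : ℝ))) := by
      have h : Continuous fun l : ℝ => k ^ 2 * (w.1 ^ 2 + w.2 ^ 2) +
        (k + l * (q₁ * (B w).1 + q₂ * (B w).2)) ^ 2 := by fun_prop
      have h' := (h.tendsto 0).mono_left hnhds
      simp only [zero_mul, add_zero] at h'
      exact h'.rpow_const (.inl h0)
    rw [← Real.mul_rpow hk2.le (by positivity), show k ^ 2 * (1 + w.1 ^ 2 + w.2 ^ 2) =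
      k ^ 2 * (w.1 ^ 2 + w.2 ^ 2) + k ^ 2 by ring]
    refine h2.congr' ?_
    filter_upwards [h1] with l hl
    simp only [φ, hl, one_mul]

end SingularLimit

/-! ### Squeezing space along a direction -/

section Squeeze

open MeasureTheory Filter Topology

/-- The linear map that multiplies by `l` in the direction `d` and fixes the vectors orthogonal to
`d`. -/
noncomputable def squeeze (d : Space3) (l : ℝ) (z : Space3) : Space3 :=
  z - ((1 - l) * inner ℝ z d / ‖d‖ ^ 2) • d

theorem squeeze_add (d : Space3) (l : ℝ) (x y : Space3) :
    squeeze d l (x + y) = squeeze d l x + squeeze d l y := by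
  rw [squeeze, inner_add_left, mul_add, add_div, add_smul, squeeze, squeeze]
  abel

theorem squeeze_smul (d : Space3) (l c : ℝ) (x : Space3) :
    squeeze d l (c • x) = c • squeeze d l x := by
  rw [squeeze, squeeze, real_inner_smul_left, smul_sub, smul_smul]
  ring_nf

theorem squeeze_sub (d : Space3) (l : ℝ) (x y : Space3) :
    squeeze d l (x - y) = squeeze d l x - squeeze d l y := by
  rw [sub_eq_add_neg, ← neg_one_smul ℝ y, squeeze_add, squeeze_smul, neg_one_smul, sub_eq_add_neg]

/-- The straight-line homotopy from the identity to a squeeze consists of squeezes. For `l > 0` and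
`t` in the unit interval their factors stay positive, so that all of them are injective. -/
theorem homotopy_squeeze (d : Space3) (l t : ℝ) (z : Space3) :
    (1 - t) • z + t • squeeze d l z = squeeze d (1 - t + t * l) z := by
  simp only [squeeze, smul_sub, smul_smul]
  rw [add_sub, ← add_smul, show 1 - t + t = 1 by ring, one_smul]
  ring_nf

/-- The inner product of the projections of two vectors along `d`. -/
noncomputable def planar (d x y : Space3) : ℝ := inner ℝ x y - inner ℝ x d * inner ℝ y d / ‖d‖ ^ 2

variable {d : Space3} (hd : d ≠ 0)
include hd

theorem normSq_squeeze (l : ℝ) (z : Space3) :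
    ‖squeeze d l z‖ ^ 2 = planar d z z + l ^ 2 * (inner ℝ z d ^ 2 / ‖d‖ ^ 2) := by
  have hN : ‖d‖ ^ 2 ≠ 0 := by simpa using hd
  rw [squeeze, norm_sub_sq_real, real_inner_smul_right, norm_smul, mul_pow, Real.norm_eq_abs,
    sq_abs, planar, real_inner_self_eq_norm_sq]
  field_simp
  ring

theorem planar_self_nonneg (z : Space3) : 0 ≤ planar d z z := by
  have := normSq_squeeze hd 0 z
  rw [zero_pow two_ne_zero, zero_mul, add_zero] at this
  exact this ▸ sq_nonneg _

theorem exists_eq_smul_of_planar_self (z : Space3) (hz : planar d z z = 0) : ∃ r : ℝ, z = r • d := by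
  have := normSq_squeeze hd 0 z
  rw [zero_pow two_ne_zero, zero_mul, add_zero, hz] at this
  have h0 : squeeze d 0 z = 0 := by simpa using this
  exact ⟨_, sub_eq_zero.mp h0⟩

theorem squeeze_ne_zero {l : ℝ} (hl : l ≠ 0) {z : Space3} (hz : z ≠ 0) : squeeze d l z ≠ 0 := by
  intro h
  have hN : 0 < ‖d‖ ^ 2 := by positivity
  have h1 := normSq_squeeze hd l z
  rw [h, norm_zero, zero_pow two_ne_zero] at h1
  have h2 := planar_self_nonneg hd z
  have h3 : 0 ≤ l ^ 2 * (inner ℝ z d ^ 2 / ‖d‖ ^ 2) := by positivity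
  obtain ⟨r, rfl⟩ := exists_eq_smul_of_planar_self hd z (by linarith)
  have h4 : l ^ 2 * (inner ℝ (r • d) d ^ 2 / ‖d‖ ^ 2) = 0 := by linarith
  rw [real_inner_smul_left, real_inner_self_eq_norm_sq] at h4
  have hr : r ≠ 0 := fun h => hz (by rw [h, zero_smul])
  have : l ^ 2 * ((r * ‖d‖ ^ 2) ^ 2 / ‖d‖ ^ 2) ≠ 0 := by positivity
  exact this h4

/-- The determinant of the squeeze is `l`: subtracting `c` times the rank-one map `z ↦ ⟨z, d⟩ d`
from the identity gives determinant `1 - c ‖d‖ ^ 2`. -/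
theorem tripleProduct_squeeze (l : ℝ) (x y z : Space3) :
    tripleProduct (squeeze d l x) (squeeze d l y) (squeeze d l z) = l * tripleProduct x y z := by
  have hN : ‖d‖ ^ 2 ≠ 0 := by simpa using hd
  have key : ∀ c : ℝ, tripleProduct (x - (c * inner ℝ x d) • d) (y - (c * inner ℝ y d) • d)
      (z - (c * inner ℝ z d) • d) = (1 - c * ‖d‖ ^ 2) * tripleProduct x y z := by
    intro c
    simp only [tripleProduct_eq, normSq_eq, inner_eq, PiLp.sub_apply, PiLp.smul_apply, smul_eq_mul]
    ring
  have := key ((1 - l) / ‖d‖ ^ 2)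
  rw [div_mul_cancel₀ _ hN, sub_sub_cancel] at this
  rw [← this]
  simp only [squeeze, div_mul_eq_mul_div]

/-- Both sides are the squared area of the projected parallelogram: a Gram determinant on the left,
volume over height on the right. -/
theorem planar_gram (a b : Space3) :
    planar d a a * planar d b b - planar d a b ^ 2 = tripleProduct a b d ^ 2 / ‖d‖ ^ 2 := by
  have hN : ‖d‖ ^ 2 ≠ 0 := by simpa using hd
  have key : (‖d‖ ^ 2 * inner ℝ a a - inner ℝ a d * inner ℝ a d) *
      (‖d‖ ^ 2 * inner ℝ b b - inner ℝ b d * inner ℝ b d) -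
      (‖d‖ ^ 2 * inner ℝ a b - inner ℝ a d * inner ℝ b d) ^ 2 =
      ‖d‖ ^ 2 * tripleProduct a b d ^ 2 := by
    simp only [tripleProduct_eq, normSq_eq, inner_eq]
    ring
  rw [planar, planar, planar, eq_div_iff hN]
  field_simp
  linear_combination key

theorem gaussKernel_squeeze (l : ℝ) (x a b : Space3) :
    gaussKernel (squeeze d l x) (squeeze d l a) (squeeze d l b) = l * (tripleProduct x a b *
      (planar d x x + l ^ 2 * (inner ℝ x d ^ 2 / ‖d‖ ^ 2)) ^ (-(3 / 2) : ℝ)) := by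
  rw [gaussKernel, tripleProduct_squeeze hd, normSq_squeeze hd, mul_assoc]

end Squeeze

/-! ### The Gauss integral of squeezed segments -/

namespace Segment3

open MeasureTheory Filter Topology

variable {d : Space3}

/-- The image of a segment under `squeeze`. -/
noncomputable def squeeze (d : Space3) (l : ℝ) (a : Segment3) : Segment3 :=
  ⟨_root_.squeeze d l a.initial, _root_.squeeze d l a.final⟩

theorem point_eq (a : Segment3) (s : ℝ) : a.point s = a.initial + s • a.dir := by
  rw [point, AffineMap.lineMap_apply, dir, vsub_eq_sub, vadd_eq_add, add_comm]

theorem dir_squeeze (l : ℝ) (a : Segment3) : (a.squeeze d l).dir = _root_.squeeze d l a.dir := by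
  simp only [dir, squeeze, squeeze_sub]

theorem point_squeeze (l : ℝ) (a : Segment3) (s : ℝ) :
    (a.squeeze d l).point s = _root_.squeeze d l (a.point s) := by
  rw [point_eq, point_eq, dir_squeeze, squeeze_add, squeeze_smul, squeeze]

theorem gauss_squeeze (hd : d ≠ 0) (l : ℝ) (a b : Segment3) :
    (a.squeeze d l).curve.gauss (b.squeeze d l).curve =
      ∫ p : ℝ × ℝ, l * (tripleProduct (a.point p.1 - b.point p.2) a.dir b.dir *
        (planar d (a.point p.1 - b.point p.2) (a.point p.1 - b.point p.2) + l ^ 2 *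
        (inner ℝ (a.point p.1 - b.point p.2) d ^ 2 / ‖d‖ ^ 2)) ^ (-(3 / 2) : ℝ))
        ∂(unitMeasure.prod unitMeasure) := by
  refine integral_congr_ae (.of_forall fun p => ?_)
  simp only [curve, point_squeeze, dir_squeeze]
  rw [← squeeze_sub, gaussKernel_squeeze hd]

theorem continuous_point (a : Segment3) : Continuous a.point := a.curve.cont

theorem crossingSign_of_not_crossing {a b : Segment3}
    (h : ∀ s ∈ I, ∀ t ∈ I, ∀ r : ℝ, a.point s - b.point t ≠ r • d) : crossingSign d a b = 0 := by
  have h1 : ¬ Over d a b := fun ⟨s, hs, t, ht, r, _, he⟩ => h s hs t ht r he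
  have h2 : ¬ Over d b a := fun ⟨s, hs, t, ht, r, _, he⟩ => h t ht s hs (-r) (by
    rw [neg_smul, ← he, neg_sub])
  rw [crossingSign, if_neg h1, if_neg h2, add_zero]

/-- Without a crossing the projected distance has a positive minimum, so the integrand is `l` times
a bounded function. -/
theorem tendsto_gauss_squeeze_of_not_crossing (hd : d ≠ 0) {a b : Segment3}
    (h : ∀ s ∈ I, ∀ t ∈ I, ∀ r : ℝ, a.point s - b.point t ≠ r • d) :
    Tendsto (fun l => (a.squeeze d l).curve.gauss (b.squeeze d l).curve) (𝓝[>] 0) (𝓝 0) := by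
  have ca := a.continuous_point
  have cb := b.continuous_point
  have h01 : (0 : ℝ) ∈ I := ⟨le_rfl, zero_le_one⟩
  have hN : 0 < ‖d‖ ^ 2 := by positivity
  have hcomp : IsCompact (I ×ˢ I) := isCompact_Icc.prod isCompact_Icc
  have cT : Continuous fun p : ℝ × ℝ => tripleProduct (a.point p.1 - b.point p.2) a.dir b.dir :=
    continuous_tripleProduct (by fun_prop) (by fun_prop) (by fun_prop)
  have cP : Continuous fun p : ℝ × ℝ =>
      planar d (a.point p.1 - b.point p.2) (a.point p.1 - b.point p.2) := by
    unfold planar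
    fun_prop
  obtain ⟨M, hM⟩ := hcomp.exists_bound_of_continuousOn cT.continuousOn
  obtain ⟨p₀, hp₀, hmin⟩ := hcomp.exists_isMinOn ⟨(0, 0), h01, h01⟩ cP.continuousOn
  have hpos : 0 < planar d (a.point p₀.1 - b.point p₀.2) (a.point p₀.1 - b.point p₀.2) := by
    refine (planar_self_nonneg hd _).lt_of_ne' fun h0 => ?_
    obtain ⟨r, hr⟩ := exists_eq_smul_of_planar_self hd _ h0
    exact h _ hp₀.1 _ hp₀.2 r hr
  replace hmin : ∀ p ∈ I ×ˢ I, planar d (a.point p₀.1 - b.point p₀.2)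
      (a.point p₀.1 - b.point p₀.2) ≤ planar d (a.point p.1 - b.point p.2)
      (a.point p.1 - b.point p.2) := fun p hp => hmin hp
  revert hpos hmin
  generalize planar d (a.point p₀.1 - b.point p₀.2) (a.point p₀.1 - b.point p₀.2) = c
  intro hpos hmin
  have hlim : Tendsto (fun l : ℝ => l * (M * c ^ (-(3 / 2) : ℝ)) *
      (unitMeasure.prod unitMeasure).real Set.univ) (𝓝[>] 0) (𝓝 0) := by
    have hc : Continuous fun l : ℝ => l * (M * c ^ (-(3 / 2) : ℝ)) *
      (unitMeasure.prod unitMeasure).real Set.univ := by fun_prop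
    have := hc.tendsto 0
    simp only [zero_mul] at this
    exact this.mono_left nhdsWithin_le_nhds
  refine squeeze_zero_norm' ?_ hlim
  filter_upwards [self_mem_nhdsWithin] with l hl
  rw [gauss_squeeze hd]
  refine norm_integral_le_of_norm_le_const (ae_mem_square.mono fun p hp => ?_)
  have h1 : c ≤ planar d (a.point p.1 - b.point p.2) (a.point p.1 - b.point p.2) := hmin p hp
  have h2 : 0 ≤ l ^ 2 * (inner ℝ (a.point p.1 - b.point p.2) d ^ 2 / ‖d‖ ^ 2) := by positivity
  rw [norm_mul, norm_mul, Real.norm_of_nonneg (le_of_lt hl),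
    Real.norm_of_nonneg (Real.rpow_nonneg (by linarith) _)]
  refine mul_le_mul_of_nonneg_left (mul_le_mul (hM p hp) ?_
    (Real.rpow_nonneg (by linarith) _) ((norm_nonneg _).trans (hM p hp))) (le_of_lt hl)
  exact Real.rpow_le_rpow_of_nonpos hpos (by linarith) (by norm_num)

/-- Two differences between points of the segments differ by a combination of the two directions,
and the triple product with these directions detects the multiple of `d`. -/
theorem crossing_unique {a b : Segment3} (hT : tripleProduct a.dir b.dir d ≠ 0) {s t s' t' r r' : ℝ}
    (h : a.point s - b.point t = r • d) (h' : a.point s' - b.point t' = r' • d) : r = r' := by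
  have key : (r - r') • d = (s - s') • a.dir - (t - t') • b.dir := by
    rw [sub_smul, ← h, ← h', point_eq, point_eq, point_eq, point_eq, sub_smul, sub_smul]
    abel
  have h1 : tripleProduct a.dir b.dir ((r - r') • d) = (r - r') * tripleProduct a.dir b.dir d := by
    simp only [tripleProduct_eq, PiLp.smul_apply, smul_eq_mul]
    ring
  have h2 : tripleProduct a.dir b.dir ((s - s') • a.dir - (t - t') • b.dir) = 0 := by
    simp only [tripleProduct_eq, PiLp.sub_apply, PiLp.smul_apply, smul_eq_mul]
    ring
  rw [key, h2] at h1
  exact sub_eq_zero.mp ((mul_eq_zero.mp h1.symm).resolve_right hT)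

/-- The sign of `r` tells which strand is above, and exchanging the strands reverses the triple
product. In both cases the crossing sign is the sign of `r` times that of the triple product. -/
theorem crossingSign_of_crossing {a b : Segment3} (hT : tripleProduct a.dir b.dir d ≠ 0)
    {s t r : ℝ} (hs : s ∈ I) (ht : t ∈ I) (h : a.point s - b.point t = r • d) (hr : r ≠ 0) :
    (crossingSign d a b : ℝ) = r * tripleProduct a.dir b.dir d /
      (|r| * |tripleProduct a.dir b.dir d|) := by
  have hswap : tripleProduct b.dir a.dir d = - tripleProduct a.dir b.dir d := by
    simp only [tripleProduct_eq]
    ring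
  have hsgn : ∀ x : ℝ, x ≠ 0 → (((SignType.sign x : ℤ) : ℤ) : ℝ) = x / |x| := by
    intro x hx
    rcases lt_or_gt_of_ne hx with h | h
    · simp [sign_neg h, abs_of_neg h, div_neg, div_self hx]
    · simp [sign_pos h, abs_of_pos h, div_self hx]
  have hab : Over d a b ↔ 0 < r := by
    refine ⟨fun ⟨s', _, t', _, r', hr', h'⟩ => ?_, fun hr => ⟨s, hs, t, ht, r, hr, h⟩⟩
    rwa [crossing_unique hT h h']
  have hba : Over d b a ↔ r < 0 := by
    refine ⟨fun ⟨t', _, s', _, r', hr', h'⟩ => ?_, fun hr => ⟨t, ht, s, hs, -r, neg_pos.mpr hr, ?_⟩⟩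
    · have h'' : a.point s' - b.point t' = (-r') • d := by rw [neg_smul, ← h', neg_sub]
      rw [crossing_unique hT h h'']
      exact neg_neg_of_pos hr'
    · rw [neg_smul, ← h, neg_sub]
  have hT' := abs_pos.mpr hT
  rw [crossingSign, hswap]
  rcases lt_or_gt_of_ne hr with h0 | h0
  · rw [if_neg (fun h => h0.not_gt (hab.mp h)), if_pos (hba.mpr h0), zero_add,
      hsgn _ (neg_ne_zero.mpr hT), abs_neg, abs_of_neg h0]
    field_simp
  · rw [if_pos (hab.mpr h0), if_neg (fun h => h0.not_gt (hba.mp h)), add_zero, hsgn _ hT,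
      abs_of_pos h0]
    field_simp

/-- With the crossing moved to the origin, the triple product in the numerator is the constant `r`
times that of the directions and `d`, and the squared distance has the form treated in
`tendsto_singular_integral` with `k = r ‖d‖`. By `planar_gram` the factors `‖d‖` cancel, and only
the constant and the sign remain. -/
theorem tendsto_gauss_squeeze_of_crossing (hd : d ≠ 0) {a b : Segment3}
    (hT : tripleProduct a.dir b.dir d ≠ 0) {s t r : ℝ} (hs : s ∈ Set.Ioo (0 : ℝ) 1)
    (ht : t ∈ Set.Ioo (0 : ℝ) 1) (h : a.point s - b.point t = r • d) (hr : r ≠ 0) :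
    Tendsto (fun l => (a.squeeze d l).curve.gauss (b.squeeze d l).curve) (𝓝[>] 0)
      (𝓝 (planeIntegral * crossingSign d a b)) := by
  have hN : 0 < ‖d‖ := norm_pos_iff.mpr hd
  have hT' := abs_pos.mpr hT
  have hr' := abs_pos.mpr hr
  have hgram := planar_gram hd a.dir b.dir
  have hΔ : 0 < planar d a.dir a.dir * planar d b.dir b.dir - (-planar d a.dir b.dir) ^ 2 := by
    rw [neg_sq, hgram]
    positivity
  have hα : 0 < planar d a.dir a.dir := by
    refine (planar_self_nonneg hd _).lt_of_ne' fun h0 => ?_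
    rw [h0] at hΔ
    nlinarith [sq_nonneg (-planar d a.dir b.dir)]
  have hS : MeasurableSet (Set.Ioc (0 : ℝ) 1 ×ˢ Set.Ioc (0 : ℝ) 1) :=
    measurableSet_Ioc.prod measurableSet_Ioc
  have hR : MeasurableSet ((fun z : ℝ × ℝ => z + (s, t)) ⁻¹' (Set.Ioc 0 1 ×ˢ Set.Ioc 0 1)) :=
    hS.preimage (by fun_prop)
  have hR0 : (fun z : ℝ × ℝ => z + (s, t)) ⁻¹' (Set.Ioc 0 1 ×ˢ Set.Ioc 0 1) ∈ 𝓝 (0 : ℝ × ℝ) := by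
    refine ContinuousAt.preimage_mem_nhds (by fun_prop) ?_
    rw [zero_add]
    exact prod_mem_nhds (Ioc_mem_nhds hs.1 hs.2) (Ioc_mem_nhds ht.1 ht.2)
  have key := (tendsto_singular_integral (k := r * ‖d‖) (q₁ := inner ℝ a.dir d / ‖d‖)
    (q₂ := -(inner ℝ b.dir d / ‖d‖)) hα hΔ (by positivity) hR hR0).const_mul
    (r * tripleProduct a.dir b.dir d)
  have hval : r * tripleProduct a.dir b.dir d * (planeIntegral / (|r * ‖d‖| *
      √(planar d a.dir a.dir * planar d b.dir b.dir - (-planar d a.dir b.dir) ^ 2))) =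
      planeIntegral * crossingSign d a b := by
    rw [crossingSign_of_crossing hT (Set.Ioo_subset_Icc_self hs) (Set.Ioo_subset_Icc_self ht) h hr,
      neg_sq, hgram, Real.sqrt_div' _ (by positivity), Real.sqrt_sq_eq_abs,
      Real.sqrt_sq hN.le, abs_mul, abs_of_pos hN]
    field_simp
  rw [hval] at key
  refine key.congr fun l => ?_
  rw [gauss_squeeze hd, unitMeasure, Measure.prod_restrict, ← integral_indicator hR,
    ← integral_indicator hS, ← Measure.volume_eq_prod, ← integral_const_mul, ← integral_const_mul]
  conv_rhs => rw [← integral_add_right_eq_self _ ((s, t) : ℝ × ℝ)]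
  congr 1
  funext z
  by_cases hz : z + (s, t) ∈ Set.Ioc (0 : ℝ) 1 ×ˢ Set.Ioc (0 : ℝ) 1
  · rw [Set.indicator_of_mem hz, Set.indicator_of_mem (show z ∈ (fun z : ℝ × ℝ => z + (s, t)) ⁻¹'
      (Set.Ioc 0 1 ×ˢ Set.Ioc 0 1) from hz)]
    have hD : a.point (z + (s, t)).1 - b.point (z + (s, t)).2 =
        r • d + (z.1 • a.dir - z.2 • b.dir) := by
      rw [← h, point_eq, point_eq, point_eq, point_eq]
      simp only [Prod.fst_add, Prod.snd_add, add_smul]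
      abel
    rw [hD]
    have h1 : tripleProduct (r • d + (z.1 • a.dir - z.2 • b.dir)) a.dir b.dir =
        r * tripleProduct a.dir b.dir d := by
      simp only [tripleProduct_eq, PiLp.sub_apply, PiLp.add_apply, PiLp.smul_apply, smul_eq_mul]
      ring
    have h2 : planar d (r • d + (z.1 • a.dir - z.2 • b.dir))
        (r • d + (z.1 • a.dir - z.2 • b.dir)) = planar d a.dir a.dir * z.1 ^ 2 +
        2 * -planar d a.dir b.dir * z.1 * z.2 + planar d b.dir b.dir * z.2 ^ 2 := by
      simp only [planar, inner_add_left, inner_add_right, inner_sub_left, inner_sub_right,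
        real_inner_smul_left, real_inner_smul_right, real_inner_self_eq_norm_sq d,
        real_inner_comm a.dir d, real_inner_comm b.dir d, real_inner_comm b.dir a.dir]
      field_simp
      ring
    have h3 : inner ℝ (r • d + (z.1 • a.dir - z.2 • b.dir)) d ^ 2 / ‖d‖ ^ 2 =
        (r * ‖d‖ + inner ℝ a.dir d / ‖d‖ * z.1 + -(inner ℝ b.dir d / ‖d‖) * z.2) ^ 2 := by
      simp only [inner_add_left, inner_sub_left, real_inner_smul_left,
        real_inner_self_eq_norm_sq d]
      field_simp
      ring
    rw [h1, h2, h3]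
    ring
  · rw [Set.indicator_of_notMem hz, Set.indicator_of_notMem (show z ∉ (fun z : ℝ × ℝ => z + (s, t)) ⁻¹'
      (Set.Ioc 0 1 ×ˢ Set.Ioc 0 1) from hz)]
    simp

/-- Squeezing along `d` makes the Gauss integral of two segments concentrate in their crossing. -/
theorem tendsto_gauss_squeeze (hd : d ≠ 0) {a b : Segment3} (hreg : IsRegularPair d a b)
    (hne : ∀ s ∈ I, ∀ t ∈ I, a.point s ≠ b.point t) :
    Tendsto (fun l => (a.squeeze d l).curve.gauss (b.squeeze d l).curve) (𝓝[>] 0)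
      (𝓝 (planeIntegral * crossingSign d a b)) := by
  by_cases h : ∀ s ∈ I, ∀ t ∈ I, ∀ r : ℝ, a.point s - b.point t ≠ r • d
  · rw [crossingSign_of_not_crossing h, Int.cast_zero, mul_zero]
    exact tendsto_gauss_squeeze_of_not_crossing hd h
  · push Not at h
    obtain ⟨s, hs, t, ht, r, h⟩ := h
    obtain ⟨hs', ht', hT⟩ := hreg s hs t ht r h
    refine tendsto_gauss_squeeze_of_crossing hd hT hs' ht' h fun h0 => hne s hs t ht ?_
    rw [h0, zero_smul] at h
    exact sub_eq_zero.mp h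

end Segment3

/-! ### Gauss integrals and crossing signs -/

namespace OrientedGraph.PolygonalMap

open MeasureTheory Filter Topology

variable {V E : Type*} {G : OrientedGraph V E} {d : Space3}

/-- The composition of a polygonal map with `squeeze d l`. -/
noncomputable def squeeze (g : G.PolygonalMap) (d : Space3) (l : ℝ) : G.PolygonalMap where
  num := g.num
  time := g.time
  time_zero := g.time_zero
  time_num := g.time_num
  time_lt := g.time_lt
  pos v := _root_.squeeze d l (g.pos v)
  corner e i := _root_.squeeze d l (g.corner e i)
  corner_zero e := by rw [g.corner_zero]
  corner_num e := by rw [g.corner_num]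

theorem seg_squeeze (g : G.PolygonalMap) (l : ℝ) (e : E) (i : ℕ) :
    (g.squeeze d l).seg e i = (g.seg e i).squeeze d l :=
  rfl

theorem curve_squeeze (g : G.PolygonalMap) (l : ℝ) (e : E) {s : ℝ} (hs : s ∈ I) :
    ((g.squeeze d l).curve e).X s = _root_.squeeze d l ((g.curve e).X s) := by
  obtain ⟨i, hi, s', hs', rfl⟩ := g.exists_param_eq e hs
  rw [g.curve_param e hi hs', ← Segment3.point_squeeze, ← seg_squeeze]
  exact (g.squeeze d l).curve_param e hi hs'

variable [Fintype V] [Fintype E] {w : E → E → ℚ} {g : G.PolygonalMap}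

/-- Every stage of the squeezing homotopy applies an injective linear map to the difference vectors,
so disjoint edges stay disjoint. -/
theorem gaussSum_squeeze (hw : G.IsWuCycle w)
    (hg : ∀ e e', G.Disj e e' → ∀ s ∈ I, ∀ t ∈ I, (g.curve e).X s ≠ (g.curve e').X t)
    (hd : d ≠ 0) {l : ℝ} (hl0 : 0 < l) :
    (g.squeeze d l).gaussSum w = g.gaussSum w := by
  refine gaussSum_eq hw _ _ fun e e' he s hs t ht τ hτ => ?_
  rw [curve_squeeze g l e hs, curve_squeeze g l e' ht, ← squeeze_sub, homotopy_squeeze]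
  refine squeeze_ne_zero hd ?_ (sub_ne_zero.mpr (hg e e' he s hs t ht))
  rcases hτ.2.eq_or_lt with h | h
  · rw [h]
    linarith
  · nlinarith [hτ.1]

/-- A cyclic combination of Gauss integrals is computed by the crossings in any regular
projection. -/
theorem gaussSum_eq_sum_crossingSum (hw : G.IsWuCycle w)
    (hg : ∀ e e', G.Disj e e' → ∀ s ∈ I, ∀ t ∈ I, (g.curve e).X s ≠ (g.curve e').X t)
    (hd : g.IsRegularDirection d) :
    g.gaussSum w = ∑ e, ∑ e', (w e e' : ℝ) * (planeIntegral * g.crossingSum d e e') := by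
  have hlim : Tendsto (fun l => (g.squeeze d l).gaussSum w) (𝓝[>] 0)
      (𝓝 (∑ e, ∑ e', (w e e' : ℝ) * (planeIntegral * g.crossingSum d e e'))) := by
    refine tendsto_finsetSum _ fun e _ => tendsto_finsetSum _ fun e' _ => ?_
    by_cases hw0 : w e e' = 0
    · simp [hw0]
    have he := hw.disj e e' hw0
    refine Tendsto.const_mul _ ?_
    have hlim' : Tendsto (fun l => ∑ i ∈ Finset.range (g.num e), ∑ j ∈ Finset.range (g.num e'),
        ((g.seg e i).squeeze d l).curve.gauss ((g.seg e' j).squeeze d l).curve) (𝓝[>] 0)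
        (𝓝 (planeIntegral * g.crossingSum d e e')) := by
      rw [crossingSum]
      push_cast
      simp only [Finset.mul_sum]
      refine tendsto_finsetSum _ fun i hi => tendsto_finsetSum _ fun j hj => ?_
      have hi := Finset.mem_range.mp hi
      have hj := Finset.mem_range.mp hj
      refine Segment3.tendsto_gauss_squeeze hd.1 (hd.2 e e' he i hi j hj) fun s hs t ht => ?_
      rw [← g.curve_param e hi hs, ← g.curve_param e' hj ht]
      exact hg e e' he _ (g.param_mem_unit e hi hs) _ (g.param_mem_unit e' hj ht)
    refine hlim'.congr' ?_
    filter_upwards [self_mem_nhdsWithin] with l hl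
    refine ((g.squeeze d l).gauss_curve_curve e e' fun s hs t ht => ?_).symm
    rw [curve_squeeze g l e hs, curve_squeeze g l e' ht, ← sub_ne_zero, ← squeeze_sub]
    exact squeeze_ne_zero hd.1 (ne_of_gt hl) (sub_ne_zero.mpr (hg e e' he s hs t ht))
  -- The sum does not depend on `l`, so it equals its own limit.
  refine tendsto_nhds_unique (tendsto_const_nhds.congr' ?_) hlim
  filter_upwards [self_mem_nhdsWithin] with l hl
  exact (gaussSum_squeeze hw hg hd.1 hl).symm

/-- A cyclic combination of crossing numbers depends only on the embedding, not on the polygonal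
approximation or the projection. -/
theorem Approximates.sum_crossingSum_eq (hw : G.IsWuCycle w) {f : G.SpatialEmbedding}
    {g₀ g₁ : G.PolygonalMap} {d₀ d₁ : Space3} (h₀ : g₀.Approximates f) (h₁ : g₁.Approximates f)
    (hd₀ : g₀.IsRegularDirection d₀) (hd₁ : g₁.IsRegularDirection d₁) :
    ∑ e, ∑ e', w e e' * g₁.crossingSum d₁ e e' = ∑ e, ∑ e', w e e' * g₀.crossingSum d₀ e e' := by
  have key := h₀.gaussSum_eq h₁ hw
  rw [gaussSum_eq_sum_crossingSum hw (fun e e' he s hs t ht => h₁.curve_ne he hs ht) hd₁,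
    gaussSum_eq_sum_crossingSum hw (fun e e' he s hs t ht => h₀.curve_ne he hs ht) hd₀] at key
  simp only [mul_left_comm _ planeIntegral, ← Finset.mul_sum] at key
  exact_mod_cast mul_left_cancel₀ planeIntegral_pos.ne' key

end OrientedGraph.PolygonalMap

namespace OrientedGraph

/-! ### Homomorphisms from the linking module -/

section LinkingHom

variable {V E : Type*} {G : OrientedGraph V E}

theorem pairSymbol_of_disj {e e' : E} (h : G.Disj e e') :
    G.pairSymbol e e' = Finsupp.single ⟨s(e, e'), Sym2.fromRel_prop.mpr h⟩ 1 :=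
  dif_pos h

theorem pairSymbol_of_not_disj {e e' : E} (h : ¬ G.Disj e e') : G.pairSymbol e e' = 0 :=
  dif_neg h

theorem pairSymbol_comm (e e' : E) : G.pairSymbol e e' = G.pairSymbol e' e := by
  by_cases h : G.Disj e e'
  · rw [pairSymbol_of_disj h, pairSymbol_of_disj (G.disj_symmetric.symm _ _ h)]
    congr 2
    exact Sym2.eq_swap
  · rw [pairSymbol_of_not_disj h,
      pairSymbol_of_not_disj fun h' => h (G.disj_symmetric.symm _ _ h')]

variable [Fintype E]

/-- The values of a homomorphism at the generators of the linking module. -/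
noncomputable def homValues (ψ : G.LinkingModule →ₗ[ℤ] ℚ) (e e' : E) : ℚ :=
  ψ (Submodule.Quotient.mk (G.pairSymbol e e'))

/-- At a vertex off `e` the flow condition says that the homomorphism kills `δ(V^{e,v})`. At an end
of `e` it is trivial, since no edge disjoint from `e` arrives there. -/
theorem isWuCycle_homValues (ψ : G.LinkingModule →ₗ[ℤ] ℚ) : G.IsWuCycle (homValues ψ) where
  symm e e' := by rw [homValues, pairSymbol_comm, homValues]
  disj e e' h := by
    by_contra hd
    exact h (by rw [homValues, pairSymbol_of_not_disj hd, Submodule.Quotient.mk_zero, map_zero])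
  flow e := by
    classical
    funext v
    rw [bdry_apply, Pi.zero_apply]
    by_cases hv : v = G.src e ∨ v = G.tgt e
    · refine Finset.sum_eq_zero fun k _ => ?_
      by_cases hk : G.IsEnd k v
      · have : ¬ G.Disj e k := not_disj_of_isEnd (hv.imp Eq.symm Eq.symm) hk
        rw [homValues, pairSymbol_of_not_disj this, Submodule.Quotient.mk_zero, map_zero, zero_mul]
      · rw [inc_eq_zero hk, mul_zero]
    · push Not at hv
      have h0 : (Submodule.Quotient.mk (G.delta e v) : G.LinkingModule) = 0 :=
        (Submodule.Quotient.mk_eq_zero _).mpr (Submodule.subset_span ⟨e, v, hv.1, hv.2, rfl⟩)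
      have h1 := congrArg ψ h0
      rw [← Submodule.mkQ_apply, delta] at h1
      simp only [map_sub, map_sum, map_zero, Submodule.mkQ_apply] at h1
      simp only [inc, mul_sub, mul_ite, mul_one, mul_zero, Finset.sum_sub_distrib,
        ← Finset.sum_filter, homValues]
      linarith

/-- The homomorphism from the linking module defined by a Wu cycle. -/
noncomputable def IsWuCycle.toHom {w : E → E → ℚ} (hw : G.IsWuCycle w) :
    G.LinkingModule →ₗ[ℤ] ℚ :=
  G.boundaries.liftQ
    (Finsupp.linearCombination ℤ fun p : G.disjointPairs => Sym2.lift ⟨w, hw.symm⟩ p.1) (by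
      classical
      have hsymbol : ∀ e e', Finsupp.linearCombination ℤ
          (fun p : G.disjointPairs => Sym2.lift ⟨w, hw.symm⟩ p.1) (G.pairSymbol e e') =
          w e e' := by
        intro e e'
        by_cases h : G.Disj e e'
        · rw [pairSymbol_of_disj h]
          simp
        · rw [pairSymbol_of_not_disj h, map_zero]
          by_contra hne
          exact h (hw.disj e e' (Ne.symm hne))
      rw [boundaries, Submodule.span_le]
      rintro z ⟨e, v, -, -, rfl⟩
      have h1 := congrFun (hw.flow e) v
      rw [bdry_apply, Pi.zero_apply] at h1
      simp only [inc, mul_sub, mul_ite, mul_one, mul_zero, Finset.sum_sub_distrib,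
        ← Finset.sum_filter] at h1
      rw [SetLike.mem_coe, LinearMap.mem_ker, delta]
      simp only [map_sub, map_sum, hsymbol]
      linarith)

theorem IsWuCycle.homValues_toHom {w : E → E → ℚ} (hw : G.IsWuCycle w) :
    homValues hw.toHom = w := by
  funext e e'
  rw [homValues, IsWuCycle.toHom, Submodule.liftQ_apply]
  by_cases h : G.Disj e e'
  · rw [pairSymbol_of_disj h]
    simp
  · rw [pairSymbol_of_not_disj h, map_zero]
    by_contra hne
    exact h (hw.disj e e' (Ne.symm hne))

/-- Disjoint edges are distinct, so each unordered pair comes from exactly two ordered ones. -/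
theorem sum_sum_sym2 (F : Sym2 E → ℚ) (hF : ∀ p ∉ G.disjointPairs, F p = 0)
    [Fintype G.disjointPairs] :
    ∑ e, ∑ e', F s(e, e') = 2 * ∑ p : G.disjointPairs, F p := by
  classical
  have h1 : ∑ p : G.disjointPairs, F p = ∑ p, F p :=
    Fintype.sum_of_injective Subtype.val Subtype.val_injective _ _
      (fun p hp => hF p fun h => hp ⟨⟨p, h⟩, rfl⟩) fun _ => rfl
  rw [h1, ← Fintype.sum_prod_type' (f := fun e e' => F s(e, e')),
    ← Finset.sum_fiberwise Finset.univ (fun x : E × E => s(x.1, x.2)), Finset.mul_sum]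
  refine Finset.sum_congr rfl fun p _ => ?_
  rw [Finset.sum_congr rfl fun x hx => congrArg F (Finset.mem_filter.mp hx).2, Finset.sum_const,
    nsmul_eq_mul]
  by_cases hp : p ∈ G.disjointPairs
  · congr 1
    induction p with
    | h a b =>
      have hd : G.Disj a b := Sym2.fromRel_prop.mp hp
      have hab : a ≠ b := fun h => hd.1 (by rw [h])
      have : Finset.univ.filter (fun x : E × E => s(x.1, x.2) = s(a, b)) = {(a, b), (b, a)} := by
        ext ⟨x, y⟩
        simp
      rw [this, Finset.card_pair fun h => hab (Prod.ext_iff.mp h).1]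
      norm_num
  · rw [hF p hp, mul_zero, mul_zero]

/-- This translates the reduced Wu invariant into the pairing of a Wu cycle with crossing numbers.
The factor `2` comes from summing over ordered pairs. -/
theorem sum_homValues_crossingSum (ψ : G.LinkingModule →ₗ[ℤ] ℚ) (g : G.PolygonalMap)
    (d : Space3) :
    ∑ e, ∑ e', homValues ψ e e' * g.crossingSum d e e' = 2 * ψ (g.linkingClass d) := by
  classical
  let _ : Fintype G.disjointPairs := Fintype.ofFinite _
  have hw := isWuCycle_homValues ψ
  let F : Sym2 E → ℚ := Sym2.lift ⟨fun e e' => homValues ψ e e' * g.crossingSum d e e',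
    fun e e' => by simp only [hw.symm e e', g.crossingSum_comm d e e']⟩
  have hF : ∀ p ∉ G.disjointPairs, F p = 0 := by
    intro p
    induction p with
    | h a b =>
      intro hp
      have : homValues ψ a b = 0 := by
        by_contra hne
        exact hp (Sym2.fromRel_prop.mpr (hw.disj a b hne))
      simp [F, this]
  have key := sum_sum_sym2 F hF
  simp only [F, Sym2.lift_mk] at key
  rw [key, PolygonalMap.linkingClass, Finsupp.equivFunOnFinite_symm_eq_sum,
    ← Submodule.mkQ_apply, map_sum, map_sum]
  congr 1
  refine Finset.sum_congr rfl fun ⟨p, hp⟩ _ => ?_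
  induction p with
  | h a b =>
    have hd : G.Disj a b := Sym2.fromRel_prop.mp hp
    have h1 : ∀ n : ℤ, Finsupp.single (⟨s(a, b), hp⟩ : G.disjointPairs) n =
        n • G.pairSymbol a b := fun n => by
      rw [pairSymbol_of_disj hd, Finsupp.smul_single, smul_eq_mul, mul_one]
    rw [h1, map_smul, map_smul, zsmul_eq_mul]
    simp only [Sym2.lift_mk, homValues, Submodule.mkQ_apply]
    ring

/-- If the linking module is isomorphic to `ℤ`, every Wu cycle is a multiple of the one given by
the isomorphism. -/
theorem IsWuCycle.exists_eq_smul {w : E → E → ℚ} (hw : G.IsWuCycle w)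
    (φ : G.LinkingModule ≃ₗ[ℤ] ℤ) :
    ∃ c : ℚ, w = c • homValues ((Int.castAddHom ℚ).toIntLinearMap ∘ₗ φ.toLinearMap) := by
  -- The multiple is the value of the homomorphism at the generator of the linking module.
  refine ⟨hw.toHom (φ.symm 1), ?_⟩
  conv_lhs => rw [← hw.homValues_toHom]
  funext e e'
  simp only [homValues, Pi.smul_apply, smul_eq_mul, LinearMap.comp_apply,
    AddMonoidHom.coe_toIntLinearMap, Int.coe_castAddHom, LinearEquiv.coe_coe]
  generalize (Submodule.Quotient.mk (G.pairSymbol e e') : G.LinkingModule) = x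
  have h : x = φ x • φ.symm 1 := by
    rw [← map_smul, smul_eq_mul, mul_one, LinearEquiv.symm_apply_apply]
  conv_lhs => rw [h, map_smul, zsmul_eq_mul]
  ring

end LinkingHom

/-! ### Restriction to subgraphs -/

section Restriction

variable {V E : Type*} {G : OrientedGraph V E} (K : G.Subgraph)

theorem Subgraph.toGraph_disj {e e' : K.edges} : K.toGraph.Disj e e' ↔ G.Disj e e' := by
  simp only [Disj, Subgraph.toGraph, ne_eq, Subtype.mk.injEq]

/-- The restriction of a polygonal map to a subgraph. -/
def PolygonalMap.restrict (g : G.PolygonalMap) : K.toGraph.PolygonalMap where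
  num e := g.num e
  time e := g.time e
  time_zero e := g.time_zero e
  time_num e := g.time_num e
  time_lt e := g.time_lt e
  pos v := g.pos v
  corner e := g.corner e
  corner_zero e := g.corner_zero e
  corner_num e := g.corner_num e

theorem PolygonalMap.Approximates.restrict {g : G.PolygonalMap} {f : G.SpatialEmbedding}
    (h : g.Approximates f) : (g.restrict K).Approximates (f.restrict K) := fun e e' hd =>
  h e e' (K.toGraph_disj.mp hd)

theorem PolygonalMap.IsRegularDirection.restrict {g : G.PolygonalMap} {d : Space3}
    (h : g.IsRegularDirection d) : (g.restrict K).IsRegularDirection d :=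
  ⟨h.1, fun e e' hd => h.2 e e' (K.toGraph_disj.mp hd)⟩

variable [Fintype E]

theorem IsWuCycle.restrict {w : E → E → ℚ} (hw : G.IsWuCycle w)
    (hK : ∀ e e', w e e' ≠ 0 → e ∈ K.edges ∧ e' ∈ K.edges) :
    K.toGraph.IsWuCycle fun e e' => w e e' where
  symm e e' := hw.symm e e'
  disj e e' h := K.toGraph_disj.mpr (hw.disj e e' h)
  flow e := by
    funext v
    rw [bdry_apply, Pi.zero_apply]
    have := congrFun (hw.flow e) v
    rw [bdry_apply, Pi.zero_apply] at this
    rw [← this]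
    refine Fintype.sum_of_injective Subtype.val Subtype.val_injective _ _ (fun b hb => ?_) fun b => ?_
    · by_cases h0 : w e b = 0
      · rw [h0, zero_mul]
      · exact absurd ⟨⟨b, (hK _ _ h0).2⟩, rfl⟩ hb
    · classical
      have h : ∀ x : K.verts, (if x = v then (1 : ℚ) else 0) = if (x : V) = v then 1 else 0 :=
        fun x => if_congr Subtype.ext_iff rfl rfl
      have h' : K.toGraph.inc b v = G.inc b v := by
        unfold inc
        convert congrArg₂ (· - ·) (h (K.toGraph.tgt b)) (h (K.toGraph.src b)) <;> rfl
      rw [h']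

open Classical in
/-- Extension by zero of a function on pairs of edges of a subgraph. -/
noncomputable def Subgraph.extendZero (u : K.edges → K.edges → ℚ) (e e' : E) : ℚ :=
  if h : e ∈ K.edges ∧ e' ∈ K.edges then u ⟨e, h.1⟩ ⟨e', h.2⟩ else 0

theorem Subgraph.extendZero_coe (u : K.edges → K.edges → ℚ) (e e' : K.edges) :
    K.extendZero u e e' = u e e' :=
  dif_pos ⟨e.2, e'.2⟩

theorem Subgraph.extendZero_of_not (u : K.edges → K.edges → ℚ) {e e' : E}
    (h : ¬ (e ∈ K.edges ∧ e' ∈ K.edges)) : K.extendZero u e e' = 0 :=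
  dif_neg h

theorem Subgraph.sum_extendZero_mul (u : K.edges → K.edges → ℚ) (c : E → E → ℚ) :
    ∑ e, ∑ e', K.extendZero u e e' * c e e' = ∑ e, ∑ e', u e e' * c e e' := by
  symm
  refine Fintype.sum_of_injective Subtype.val Subtype.val_injective _ _ (fun e he => ?_) fun e =>
    Fintype.sum_of_injective Subtype.val Subtype.val_injective _ _ (fun e' he' => ?_) fun e' => ?_
  · refine Finset.sum_eq_zero fun e' _ => ?_
    rw [K.extendZero_of_not u fun h => he ⟨⟨e, h.1⟩, rfl⟩, zero_mul]
  · rw [K.extendZero_of_not u fun h => he' ⟨⟨e', h.2⟩, rfl⟩, zero_mul]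
  · rw [K.extendZero_coe]

end Restriction

end OrientedGraph

/-! ### Assembly of the two halves -/

theorem theorem4p3 {V E : Type*} [Finite V] [Fintype E] (G : OrientedGraph V E)
    (k : ℕ) (H : Fin k → G.Subgraph)
    (hH : Set.range H = {K : G.Subgraph | K.toGraph.IsTwoTrianglesOrKuratowski})
    (εs : ∀ q, (H q).toGraph.LinkingModule ≃ₗ[ℤ] ℤ)
    (ε : G.LinkingModule →ₗ[ℤ] ℤ) :
    ∃ m : ℤ, m ≠ 0 ∧ ∃ ms : Fin k → ℤ,
      ∀ (f : G.SpatialEmbedding)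
        (x : G.LinkingModule) (y : ∀ q, (H q).toGraph.LinkingModule),
        f.IsWuInvariant x → (∀ q, (f.restrict (H q)).IsWuInvariant (y q)) →
          m * ε x = ∑ q, ms q * εs q (y q) := by
  classical
  let _ : Fintype V := Fintype.ofFinite V
  let ψ : G.LinkingModule →ₗ[ℤ] ℚ := (Int.castAddHom ℚ).toIntLinearMap ∘ₗ ε
  let ψs : ∀ q, (H q).toGraph.LinkingModule →ₗ[ℤ] ℚ := fun q =>
    (Int.castAddHom ℚ).toIntLinearMap ∘ₗ (εs q).toLinearMap
  -- A Wu cycle supported on some `H q` restricts to one of that subgraph, where all Wu cycles are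
  -- multiples of the one given by `εs q`.
  have hle : G.gen Finset.univ ≤
      Submodule.span ℚ (Set.range fun q => (H q).extendZero (OrientedGraph.homValues (ψs q))) := by
    refine Submodule.span_le.mpr ?_
    rintro w ⟨hw, K, hK, hsupp, -⟩
    obtain ⟨q, rfl⟩ : K ∈ Set.range H := hH ▸ hK
    obtain ⟨c, hc⟩ := (hw.restrict (H q) hsupp).exists_eq_smul (εs q)
    have : w = c • (H q).extendZero (OrientedGraph.homValues (ψs q)) := by
      funext e e'
      by_cases h : e ∈ (H q).edges ∧ e' ∈ (H q).edges
      · have := congrFun (congrFun hc ⟨e, h.1⟩) ⟨e', h.2⟩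
        simp only [Pi.smul_apply] at this ⊢
        rw [this, ← (H q).extendZero_coe (OrientedGraph.homValues (ψs q))]
      · simp only [Pi.smul_apply, (H q).extendZero_of_not _ h, smul_zero]
        by_contra hne
        exact h (hsupp e e' hne)
    rw [this]
    exact Submodule.smul_mem _ c (Submodule.subset_span ⟨q, rfl⟩)
  obtain ⟨c, hc⟩ := Submodule.mem_span_range_iff_exists_fun ℚ |>.mp
    (hle (OrientedGraph.isWuCycle_homValues ψ).mem_gen)
  -- The coefficients `c` are rational and do not depend on the embedding. A common denominator `m`
  -- makes them integral.
  obtain ⟨⟨m, hm⟩, hint⟩ := IsLocalization.exist_integer_multiples_of_finite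
    (nonZeroDivisors ℤ) c
  choose ms hms using hint
  refine ⟨m, nonZeroDivisors.ne_zero hm, ms, fun f x y hx hy => ?_⟩
  obtain ⟨g, d, hg, hd, rfl⟩ := hx
  have key : (ε (g.linkingClass d) : ℚ) = ∑ q, c q * (εs q (y q) : ℚ) := by
    have h1 := OrientedGraph.sum_homValues_crossingSum ψ g d
    have h2 : ∀ q, ∑ e, ∑ e', (H q).extendZero (OrientedGraph.homValues (ψs q)) e e' * g.crossingSum d e e' =
        2 * (εs q (y q) : ℚ) := by
      intro q
      let _ : Fintype (H q).verts := Fintype.ofFinite _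
      obtain ⟨g', d', hg', hd', hy'⟩ := hy q
      rw [(H q).sum_extendZero_mul, hy']
      have h3 := OrientedGraph.sum_homValues_crossingSum (ψs q) g' d'
      -- The restriction of `g` to `H q` and the map `g'` from which `y q` is computed both
      -- approximate the restricted embedding, so invariance on the subgraph allows all terms to be
      -- computed from `g` and `d`.
      rw [← OrientedGraph.PolygonalMap.Approximates.sum_crossingSum_eq (OrientedGraph.isWuCycle_homValues (ψs q)) hg'
        (hg.restrict (H q)) hd' (hd.restrict (H q))] at h3
      exact h3
    have h4 : ∑ e, ∑ e', OrientedGraph.homValues ψ e e' * g.crossingSum d e e' =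
        ∑ q, c q * (2 * (εs q (y q) : ℚ)) := by
      have hpt : ∀ e e', OrientedGraph.homValues ψ e e' =
          ∑ q, c q * (H q).extendZero (OrientedGraph.homValues (ψs q)) e e' := fun e e' => by
        rw [← hc]
        simp only [Finset.sum_apply, Pi.smul_apply, smul_eq_mul]
      simp only [← h2, hpt, Finset.sum_mul, Finset.mul_sum, mul_assoc]
      exact (Finset.sum_congr rfl fun e _ => Finset.sum_comm).trans Finset.sum_comm
    rw [h1] at h4
    have h5 : ψ (g.linkingClass d) = (ε (g.linkingClass d) : ℚ) := rfl
    rw [← h5]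
    simp only [mul_left_comm _ (2 : ℚ), ← Finset.mul_sum] at h4
    exact mul_left_cancel₀ two_ne_zero h4
  have hms' : ∀ q, (ms q : ℚ) = m * c q := fun q => by
    have := hms q
    simpa using this
  have : ((m * ε (g.linkingClass d) : ℤ) : ℚ) = ((∑ q, ms q * εs q (y q) : ℤ) : ℚ) := by
    push_cast
    rw [key, Finset.mul_sum]
    exact Finset.sum_congr rfl fun q _ => by rw [hms', mul_assoc]
  exact_mod_cast this
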